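/- Let $(\overline M,\overline g)$ be a smooth Lorentzian manifold (Hausdorff, second countable, without boundary) of dimension $n+2\ge 2$ and signature $(-,+,\dots,+)$. For an $n$-dimensional manifold $Q$, call $(\overline M,\overline g)$ a *simple pp-wave modeled on $Q$* if it is isometric to a Lorentzian manifold $$\bigl(\mathbb R\times I\times Q,\ \mathrm dv\otimes\mathrm ds+\mathrm ds\otimes\mathrm dv+u^{-2}\,\mathrm ds^2+g_s\bigr),$$ where $I\subset\mathbb R$ is a nonempty open interval, $v$ and $s$ are the coordinates on $\mathbb R$ and $I$, $(g_s)_{s\in I}$ is a smooth family of Riemannian metrics on $Q$, and $u\colon I\times Q\to\mathbb R_{>0}$ is a smooth function. Then $(\overline M,\overline g)$ is a simple pp-wave modeled on some compact connected manifold $Q$ (without boundary) if and only if both of the following hold: 1. There exist a smooth vector field $V$ on $\overline M$ and a function $s\in C^\infty(\overline M)$ such that $V$ is lightlike (i.e. $\overline g(V,V)\equiv 0$ and $V$ vanishes nowhere), parallel for the Levi-Civita connection, complete, and $V=\mathrm{grad}^{\overline g}s$. 2. For these $V$ and $s$ there is a connected spacelike (embedded) hypersurface $M\subset\overline M$ such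 that - each integral curve $\gamma\colon\mathbb R\to\overline M$ of $V$ intersects $M$ exactly once, i.e. $\gamma(t)\in M$ for exactly one $t\in\mathbb R$; - for each $c\in s(M)$ the level set $M\cap s^{-1}(c)$ is compact and connected. Here connected spaces and sets are nonempty by convention. -/

import Mathlib

universe w

open Set Bundle Manifold Topology VectorField
open scoped ContDiff

noncomputable section

/-! ### Lorentzian metrics and their Levi-Civita connection -/

section Lorentz

/-- A smooth Lorentzian metric on a manifold `M`: a smooth symmetric `(0,2)`-tensor field which at
every point has signature `(-,+,…,+)`, i.e. there is a timelike vector on whose orthogonal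
complement the form is positive definite. -/
structure LorentzMetric {E : Type*} [NormedAddCommGroup E] [NormedSpace ℝ E]
    {H : Type*} [TopologicalSpace H] (I : ModelWithCorners ℝ E H)
    (M : Type*) [TopologicalSpace M] [ChartedSpace H M] [IsManifold I ∞ M] where
  /-- the bilinear form on each tangent space -/
  val (x : M) : TangentSpace I x →L[ℝ] TangentSpace I x →L[ℝ] ℝ
  symm (x : M) (v w : TangentSpace I x) : val x v w = val x w v
  signature (x : M) : ∃ v : TangentSpace I x, val x v v < 0 ∧
    ∀ w : TangentSpace I x, val x v w = 0 → w ≠ 0 → 0 < val x w w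
  contMDiff : ContMDiff I (I.prod 𝓘(ℝ, E →L[ℝ] E →L[ℝ] ℝ)) ∞
    (fun x ↦ TotalSpace.mk' (E →L[ℝ] E →L[ℝ] ℝ)
      (E := fun x : M ↦ TangentSpace I x →L[ℝ] TangentSpace I x →L[ℝ] ℝ) x (val x))

namespace LorentzMetric

variable {E : Type*} [NormedAddCommGroup E] [NormedSpace ℝ E]
  {H : Type*} [TopologicalSpace H] {I : ModelWithCorners ℝ E H}
  {M : Type*} [TopologicalSpace M] [ChartedSpace H M] [IsManifold I ∞ M]
  (g : LorentzMetric I M)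

lemma eq_zero_of_val_eq_zero {x : M} {a : TangentSpace I x} (h : ∀ b, g.val x a b = 0) : a = 0 := by
  obtain ⟨v, -, hv⟩ := g.signature x
  by_contra ha
  have h1 := hv a (by rw [g.symm, h]) ha
  rw [h] at h1
  exact lt_irrefl _ h1

lemma ext_val {x : M} {a a' : TangentSpace I x} (h : ∀ b, g.val x a b = g.val x a' b) : a = a' :=
  sub_eq_zero.1 (g.eq_zero_of_val_eq_zero fun b ↦ by simp [h b])

lemma mdifferentiableAt_val {x : M} {X Y : Π x : M, TangentSpace I x}
    (hX : MDiffAt (T% X) x) (hY : MDiffAt (T% Y) x) :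
    MDiffAt (fun y ↦ g.val y (X y) (Y y)) x := by
  have h := MDifferentiableAt.clm_bundle_apply₂ (F₁ := E) (F₂ := E) (F₃ := ℝ)
    (E₃ := Bundle.Trivial M ℝ)
    ((g.contMDiff x).mdifferentiableAt (by simp)) hX hY
  simp only [← mdifferentiableWithinAt_univ, mdifferentiableWithinAt_totalSpace] at h ⊢
  exact h.2

/-- The Koszul expression
`X g(V,Y) + V g(X,Y) - Y g(X,V) + g([X,V],Y) - g([X,Y],V) - g([V,Y],X)` at the point `x`,
which equals `2 g(∇_X V, Y)`. -/
def koszul (V X Y : Π x : M, TangentSpace I x) (x : M) : ℝ :=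
  d% (fun y ↦ g.val y (V y) (Y y)) x (X x) + d% (fun y ↦ g.val y (X y) (Y y)) x (V x)
    - d% (fun y ↦ g.val y (X y) (V y)) x (Y x)
    + g.val x (mlieBracket I X V x) (Y x) - g.val x (mlieBracket I X Y x) (V x)
    - g.val x (mlieBracket I V Y x) (X x)

variable [FiniteDimensional ℝ E]

lemma koszul_tensorial_left {V Y : Π x : M, TangentSpace I x} {x : M}
    (hV : MDiffAt (T% V) x) (hY : MDiffAt (T% Y) x) :
    TensorialAt I E (fun X ↦ g.koszul V X Y x) x where
  smul {f X} hf hX := by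
    have h1 : (fun y ↦ g.val y ((f • X) y) (Y y)) = f * fun y ↦ g.val y (X y) (Y y) := by
      ext y; simp
    have h2 : (fun y ↦ g.val y ((f • X) y) (V y)) = f * fun y ↦ g.val y (X y) (V y) := by
      ext y; simp
    simp only [koszul, h1, h2, mvfderiv_mul hf (g.mdifferentiableAt_val hX hY),
      mvfderiv_mul hf (g.mdifferentiableAt_val hX hV), mlieBracket_smul_left hf hX]
    simp
    ring
  add {X X'} hX hX' := by
    have h1 : (fun y ↦ g.val y ((X + X') y) (Y y)) =
        (fun y ↦ g.val y (X y) (Y y)) + fun y ↦ g.val y (X' y) (Y y) := by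
      ext y; simp
    have h2 : (fun y ↦ g.val y ((X + X') y) (V y)) =
        (fun y ↦ g.val y (X y) (V y)) + fun y ↦ g.val y (X' y) (V y) := by
      ext y; simp
    simp only [koszul, h1, h2,
      mvfderiv_add (g.mdifferentiableAt_val hX hY) (g.mdifferentiableAt_val hX' hY),
      mvfderiv_add (g.mdifferentiableAt_val hX hV) (g.mdifferentiableAt_val hX' hV),
      mlieBracket_add_left hX hX']
    simp
    ring

lemma koszul_tensorial_right {V X : Π x : M, TangentSpace I x} {x : M}
    (hV : MDiffAt (T% V) x) (hX : MDiffAt (T% X) x) :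
    TensorialAt I E (fun Y ↦ g.koszul V X Y x) x where
  smul {f Y} hf hY := by
    have h1 : (fun y ↦ g.val y (X y) ((f • Y) y)) = f * fun y ↦ g.val y (X y) (Y y) := by
      ext y; simp
    have h2 : (fun y ↦ g.val y (V y) ((f • Y) y)) = f * fun y ↦ g.val y (V y) (Y y) := by
      ext y; simp
    simp only [koszul, h1, h2, mvfderiv_mul hf (g.mdifferentiableAt_val hX hY),
      mvfderiv_mul hf (g.mdifferentiableAt_val hV hY), mlieBracket_smul_right hf hY]
    simp [g.symm x (Y x) _]
    ring
  add {Y Y'} hY hY' := by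
    have h1 : (fun y ↦ g.val y (X y) ((Y + Y') y)) =
        (fun y ↦ g.val y (X y) (Y y)) + fun y ↦ g.val y (X y) (Y' y) := by
      ext y; simp
    have h2 : (fun y ↦ g.val y (V y) ((Y + Y') y)) =
        (fun y ↦ g.val y (V y) (Y y)) + fun y ↦ g.val y (V y) (Y' y) := by
      ext y; simp
    simp only [koszul, h1, h2,
      mvfderiv_add (g.mdifferentiableAt_val hX hY) (g.mdifferentiableAt_val hX hY'),
      mvfderiv_add (g.mdifferentiableAt_val hV hY) (g.mdifferentiableAt_val hV hY'),
      mlieBracket_add_right hY hY']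
    simp
    ring

open Classical in
/-- The Koszul expression of `V` at `x`, as a bilinear form on the tangent space at `x`
(zero by convention if `V` is not differentiable at `x`). -/
def koszulForm (V : Π x : M, TangentSpace I x) (x : M) :
    TangentSpace I x →L[ℝ] TangentSpace I x →L[ℝ] ℝ :=
  if hV : MDiffAt (T% V) x then
    TensorialAt.mkHom₂ (fun X Y ↦ g.koszul V X Y x) x
      (fun _ hY ↦ g.koszul_tensorial_left hV hY) (fun _ hX ↦ g.koszul_tensorial_right hV hX)
  else 0

lemma koszulForm_apply {V X Y : Π x : M, TangentSpace I x} {x : M}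
    (hV : MDiffAt (T% V) x) (hX : MDiffAt (T% X) x) (hY : MDiffAt (T% Y) x) :
    g.koszulForm V x (X x) (Y x) = g.koszul V X Y x := by
  rw [koszulForm, dif_pos hV]
  exact TensorialAt.mkHom₂_apply _ _ hX hY

/-- The musical isomorphism `♭ : T_x M → T_x^* M` of the metric. -/
def flat (x : M) : TangentSpace I x ≃ₗ[ℝ] (TangentSpace I x →L[ℝ] ℝ) :=
  haveI : FiniteDimensional ℝ (TangentSpace I x) := inferInstanceAs (FiniteDimensional ℝ E)
  haveI : T2Space (TangentSpace I x) := inferInstanceAs (T2Space E)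
  LinearEquiv.ofInjectiveOfFinrankEq (g.val x).toLinearMap
    (by
      rw [← LinearMap.ker_eq_bot, LinearMap.ker_eq_bot']
      intro a ha
      exact g.eq_zero_of_val_eq_zero fun b ↦ by
        simpa using congrArg (fun l : TangentSpace I x →L[ℝ] ℝ ↦ l b) ha)
    (by
      rw [← (LinearMap.toContinuousLinearMap (𝕜 := ℝ) (E := TangentSpace I x)
        (F' := ℝ)).finrank_eq]
      exact (Subspace.dual_finrank_eq (K := ℝ) (V := TangentSpace I x)).symm)

lemma flat_apply (x : M) (a b : TangentSpace I x) : g.flat x a b = g.val x a b := rfl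

/-- The vector `∇_X V` at `x`, defined by `2 g(∇_X V, Y) = koszul V X Y` for all `Y`. -/
def leviCivitaAux (V : Π x : M, TangentSpace I x) (x : M) :
    TangentSpace I x →L[ℝ] TangentSpace I x :=
  haveI : FiniteDimensional ℝ (TangentSpace I x) := inferInstanceAs (FiniteDimensional ℝ E)
  haveI : T2Space (TangentSpace I x) := inferInstanceAs (T2Space E)
  LinearMap.toContinuousLinearMap
    ((1 / 2 : ℝ) • ((g.flat x).symm.toLinearMap ∘ₗ (g.koszulForm V x).toLinearMap))

lemma two_mul_val_leviCivitaAux {V X Y : Π x : M, TangentSpace I x} {x : M}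
    (hV : MDiffAt (T% V) x) (hX : MDiffAt (T% X) x) (hY : MDiffAt (T% Y) x) :
    2 * g.val x (g.leviCivitaAux V x (X x)) (Y x) = g.koszul V X Y x := by
  rw [← g.koszulForm_apply hV hX hY]
  have h : g.leviCivitaAux V x (X x) =
    (1 / 2 : ℝ) • (g.flat x).symm (g.koszulForm V x (X x)) := rfl
  rw [h, map_smul, smul_apply, ← flat_apply, LinearEquiv.apply_symm_apply]
  simp

lemma eq_of_forall_two_mul_val {x : M} {a a' : TangentSpace I x}
    (h : ∀ Y : Π x : M, TangentSpace I x, MDiffAt (T% Y) x →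
      2 * g.val x a (Y x) = 2 * g.val x a' (Y x)) : a = a' := by
  refine g.ext_val fun b ↦ ?_
  have := h (FiberBundle.extend E b) (FiberBundle.mdifferentiableAt_extend ..)
  simp only [FiberBundle.extend_apply_self] at this
  linarith

lemma exists_section_eq {x : M} (a : TangentSpace I x) :
    ∃ X : Π x : M, TangentSpace I x, X x = a ∧ MDiffAt (T% X) x :=
  ⟨FiberBundle.extend E a, FiberBundle.extend_apply_self .., FiberBundle.mdifferentiableAt_extend ..⟩

lemma isCovariantDerivativeOn_leviCivitaAux :
    IsCovariantDerivativeOn (I := I) (M := M) E g.leviCivitaAux univ where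
  add {V V' x} hV hV' _ := by
    ext a
    refine g.eq_of_forall_two_mul_val fun Y hY ↦ ?_
    obtain ⟨X, rfl, hX⟩ := exists_section_eq (I := I) a
    have h1 : (fun y ↦ g.val y ((V + V') y) (Y y)) =
        (fun y ↦ g.val y (V y) (Y y)) + fun y ↦ g.val y (V' y) (Y y) := by
      ext y; simp
    have h2 : (fun y ↦ g.val y (X y) ((V + V') y)) =
        (fun y ↦ g.val y (X y) (V y)) + fun y ↦ g.val y (X y) (V' y) := by
      ext y; simp
    rw [g.two_mul_val_leviCivitaAux (mdifferentiableAt_add_section hV hV') hX hY,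
      add_apply, map_add, add_apply, mul_add,
      g.two_mul_val_leviCivitaAux hV hX hY, g.two_mul_val_leviCivitaAux hV' hX hY]
    simp only [koszul, h1, h2,
      mvfderiv_add (g.mdifferentiableAt_val hX hV) (g.mdifferentiableAt_val hX hV'),
      mvfderiv_add (g.mdifferentiableAt_val hV hY) (g.mdifferentiableAt_val hV' hY),
      mlieBracket_add_left hV hV', mlieBracket_add_right hV hV']
    simp
    ring
  leibniz {V f x} hV hf _ := by
    ext a
    refine g.eq_of_forall_two_mul_val fun Y hY ↦ ?_
    obtain ⟨X, rfl, hX⟩ := exists_section_eq (I := I) a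
    have h1 : (fun y ↦ g.val y ((f • V) y) (Y y)) = f * fun y ↦ g.val y (V y) (Y y) := by
      ext y; simp
    have h2 : (fun y ↦ g.val y (X y) ((f • V) y)) = f * fun y ↦ g.val y (X y) (V y) := by
      ext y; simp
    have h3 : 2 * g.val x ((f x • g.leviCivitaAux V x + (d% f x).smulRight (V x)) (X x)) (Y x) =
        f x * (2 * g.val x (g.leviCivitaAux V x (X x)) (Y x)) +
          2 * (d% f x (X x) * g.val x (V x) (Y x)) := by
      simp
      ring
    rw [h3, g.two_mul_val_leviCivitaAux (hf.smul_section hV) hX hY,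
      g.two_mul_val_leviCivitaAux hV hX hY]
    simp only [koszul, h1, h2, mvfderiv_mul hf (g.mdifferentiableAt_val hX hV),
      mvfderiv_mul hf (g.mdifferentiableAt_val hV hY), mlieBracket_smul_left hf hV,
      mlieBracket_smul_right hf hV]
    simp [g.symm x (X x) (V x)]
    ring

/-- The Levi-Civita connection of a Lorentzian metric. -/
def leviCivita : CovariantDerivative I E (TangentSpace I : M → Type _) where
  toFun := g.leviCivitaAux
  isCovariantDerivativeOnUniv := g.isCovariantDerivativeOn_leviCivitaAux

/-- The Levi-Civita connection is torsion-free. -/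
theorem leviCivita_torsion : g.leviCivita.torsion = 0 := by
  rw [CovariantDerivative.torsion_eq_zero_iff]
  intro X Y x hX hY
  refine g.eq_of_forall_two_mul_val fun Z hZ ↦ ?_
  have h1 := g.two_mul_val_leviCivitaAux hX hY hZ
  have h2 := g.two_mul_val_leviCivitaAux hY hX hZ
  have h3 : (fun y ↦ g.val y (X y) (Y y)) = fun y ↦ g.val y (Y y) (X y) := by
    ext y; exact g.symm ..
  have h4 : g.val x (mlieBracket I Y X x) (Z x) = - g.val x (mlieBracket I X Y x) (Z x) := by
    rw [mlieBracket_swap_apply]; simp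
  change 2 * g.val x (g.leviCivitaAux Y x (X x) - g.leviCivitaAux X x (Y x)) (Z x) = _
  rw [map_sub, sub_apply, mul_sub, h1, h2]
  simp only [koszul, h3, h4]
  ring

/-- The Levi-Civita connection is compatible with the metric. -/
theorem leviCivita_metric {X Y Z : Π x : M, TangentSpace I x} {x : M}
    (hX : MDiffAt (T% X) x) (hY : MDiffAt (T% Y) x) (hZ : MDiffAt (T% Z) x) :
    d% (fun y ↦ g.val y (Y y) (Z y)) x (X x) =
      g.val x (g.leviCivita Y x (X x)) (Z x) + g.val x (Y x) (g.leviCivita Z x (X x)) := by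
  have h1 := g.two_mul_val_leviCivitaAux hY hX hZ
  have h2 := g.two_mul_val_leviCivitaAux hZ hX hY
  have h3 : ∀ X Y : Π x : M, TangentSpace I x,
      (fun y ↦ g.val y (X y) (Y y)) = fun y ↦ g.val y (Y y) (X y) := by
    intro X Y; ext y; exact g.symm ..
  have h4 : g.val x (mlieBracket I Z Y x) (X x) = - g.val x (mlieBracket I Y Z x) (X x) := by
    rw [mlieBracket_swap_apply]; simp
  change _ = g.val x (g.leviCivitaAux Y x (X x)) (Z x) + g.val x (Y x) (g.leviCivitaAux Z x (X x))
  rw [g.symm x (Y x)]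
  simp only [koszul, h4, h3 Z Y] at h1 h2
  rw [h3 X Y] at h1
  rw [h3 X Z] at h1 h2
  rw [h3 X Y] at h2
  linarith

/-- A vector field is lightlike if it is null and nowhere vanishing. -/
def IsLightlike (V : Π x : M, TangentSpace I x) : Prop :=
  ∀ x, g.val x (V x) (V x) = 0 ∧ V x ≠ 0

/-- A vector field `V` is parallel if `∇V = 0` for the Levi-Civita connection `∇`. -/
def IsParallel (V : Π x : M, TangentSpace I x) : Prop :=
  ∀ x, g.leviCivita V x = 0

/-- `V` is the gradient vector field of the function `s`: `g(V, ξ) = ds(ξ)` for all `ξ`. -/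
def IsGradient (V : Π x : M, TangentSpace I x) (s : M → ℝ) : Prop :=
  ∀ x (ξ : TangentSpace I x), g.val x (V x) ξ = d% s x ξ

end LorentzMetric
end Lorentz

/-! ### Complete vector fields and spacelike hypersurfaces -/

section Hypersurfaces

variable {E : Type*} [NormedAddCommGroup E] [NormedSpace ℝ E]
  {H : Type*} [TopologicalSpace H] {I : ModelWithCorners ℝ E H}
  {M : Type*} [TopologicalSpace M] [ChartedSpace H M]

/-- A vector field is complete if through every point there is an integral curve defined on all
of `ℝ`. -/
def IsCompleteVectorField (V : Π x : M, TangentSpace I x) : Prop :=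
  ∀ x : M, ∃ γ : ℝ → M, γ 0 = x ∧ IsMIntegralCurve (I := I) γ V

variable (I) in
/-- `f` is a local defining function of the set `S` at `x`: on an open neighbourhood `U` of `x` it
is smooth and `S ∩ U` is its zero set, and `df_x ≠ 0`. A set `S` is a smooth embedded hypersurface
if it has such a function at each of its points; the tangent space `T_x S` is then the kernel of
`df_x`. -/
def IsLocalDefiningFunctionAt (S : Set M) (f : M → ℝ) (x : M) : Prop :=
  (∃ U : Set M, IsOpen U ∧ x ∈ U ∧ ContMDiffOn I 𝓘(ℝ, ℝ) ∞ f U ∧ S ∩ U = {y ∈ U | f y = 0}) ∧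
    mvfderiv I f x ≠ 0

/-- `S ⊆ M` is a spacelike hypersurface: a smooth embedded hypersurface such that `g` is positive
definite on each tangent space `T_x S`. -/
def LorentzMetric.IsSpacelikeHypersurface [IsManifold I ∞ M] (g : LorentzMetric I M)
    (S : Set M) : Prop :=
  ∀ x ∈ S, ∃ f : M → ℝ, IsLocalDefiningFunctionAt I S f x ∧
    ∀ ξ : TangentSpace I x, mvfderiv I f x ξ = 0 → ξ ≠ 0 → 0 < g.val x ξ ξ

end Hypersurfaces

/-! ### Simple pp-waves -/

section PPWave

/-- The data of a parametrized simple pp-wave modeled on `Q`: a (nonempty) open interval `J`, a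
smooth family `h s`, `s ∈ J`, of Riemannian metrics on `Q`, and a smooth positive function `u` on
`J × Q`. -/
structure SimplePPWaveData (n : ℕ) (Q : Type*) [TopologicalSpace Q]
    [ChartedSpace (EuclideanSpace ℝ (Fin n)) Q] [IsManifold (𝓡 n) ∞ Q] where
  J : TopologicalSpace.Opens ℝ
  nonempty : (J : Set ℝ).Nonempty
  ordConnected : (J : Set ℝ).OrdConnected
  h : J → ContMDiffRiemannianMetric (𝓡 n) ∞ (EuclideanSpace ℝ (Fin n))
    (fun x : Q ↦ TangentSpace (𝓡 n) x)
  contMDiff_h : ContMDiff (𝓘(ℝ, ℝ).prod (𝓡 n))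
    ((𝓡 n).prod 𝓘(ℝ, EuclideanSpace ℝ (Fin n) →L[ℝ] EuclideanSpace ℝ (Fin n) →L[ℝ] ℝ)) ∞
    (fun p : J × Q ↦ TotalSpace.mk'
      (EuclideanSpace ℝ (Fin n) →L[ℝ] EuclideanSpace ℝ (Fin n) →L[ℝ] ℝ)
      (E := fun x : Q ↦ TangentSpace (𝓡 n) x →L[ℝ] TangentSpace (𝓡 n) x →L[ℝ] ℝ)
      p.2 ((h p.1).inner p.2))
  u : J × Q → ℝ
  u_pos : ∀ p, 0 < u p
  contMDiff_u : ContMDiff (𝓘(ℝ, ℝ).prod (𝓡 n)) 𝓘(ℝ, ℝ) ∞ u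

/-- The product model of the manifolds `ℝ × J × Q`. -/
abbrev ppModel (n : ℕ) := 𝓘(ℝ, ℝ).prod (𝓘(ℝ, ℝ).prod (𝓡 n))

namespace SimplePPWaveData

variable {n : ℕ} {Q : Type*} [TopologicalSpace Q]
  [ChartedSpace (EuclideanSpace ℝ (Fin n)) Q] [IsManifold (𝓡 n) ∞ Q]
  (P : SimplePPWaveData n Q)

/-- The differential `dv` of the first coordinate on `ℝ × J × Q`. -/
def dv (p : ℝ × P.J × Q) : TangentSpace (ppModel n) p →L[ℝ] ℝ :=
  mvfderiv (ppModel n) (fun q : ℝ × P.J × Q ↦ q.1) p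

/-- The differential `ds` of the second coordinate on `ℝ × J × Q`. -/
def ds (p : ℝ × P.J × Q) : TangentSpace (ppModel n) p →L[ℝ] ℝ :=
  mvfderiv (ppModel n) (fun q : ℝ × P.J × Q ↦ (q.2.1 : ℝ)) p

/-- The differential of the projection `ℝ × J × Q → Q`. -/
def dprQ (p : ℝ × P.J × Q) : TangentSpace (ppModel n) p →L[ℝ] TangentSpace (𝓡 n) p.2.2 :=
  mfderiv (ppModel n) (𝓡 n) (fun q : ℝ × P.J × Q ↦ q.2.2) p

/-- The metric `dv ⊗ ds + ds ⊗ dv + u⁻² ds² + h_s` on `ℝ × J × Q`. -/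
def metric (p : ℝ × P.J × Q) (ξ η : TangentSpace (ppModel n) p) : ℝ :=
  P.dv p ξ * P.ds p η + P.ds p ξ * P.dv p η + (P.u p.2)⁻¹ ^ 2 * (P.ds p ξ * P.ds p η)
    + (P.h p.2.1).inner p.2.2 (P.dprQ p ξ) (P.dprQ p η)

end SimplePPWaveData

/-- The Lorentzian manifold `(M, g)` is a simple pp-wave modeled on `Q`: it is isometric to a
parametrized simple pp-wave `(ℝ × J × Q, dv ⊗ ds + ds ⊗ dv + u⁻² ds² + h_s)`. -/
def LorentzMetric.IsSimplePPWaveModeledOn {n : ℕ} {M : Type*} [TopologicalSpace M]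
    [ChartedSpace (EuclideanSpace ℝ (Fin (n + 2))) M] [IsManifold (𝓡 (n + 2)) ∞ M]
    (g : LorentzMetric (𝓡 (n + 2)) M)
    (Q : Type*) [TopologicalSpace Q] [ChartedSpace (EuclideanSpace ℝ (Fin n)) Q]
    [IsManifold (𝓡 n) ∞ Q] : Prop :=
  ∃ (P : SimplePPWaveData n Q) (Φ : Diffeomorph (ppModel n) (𝓡 (n + 2)) (ℝ × P.J × Q) M ∞),
    ∀ (p : ℝ × P.J × Q) (ξ η : TangentSpace (ppModel n) p),
      g.val (Φ p) (mfderiv (ppModel n) (𝓡 (n + 2)) Φ p ξ)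
        (mfderiv (ppModel n) (𝓡 (n + 2)) Φ p η) = P.metric p ξ η

end PPWave

end

/-! Suppose first that `V`, `s` and the hypersurface `S` are given, and let `φ` be the flow of `V`.
A null vector cannot be tangent to a spacelike hypersurface, so `S` is transverse to `V`. As every
flow line meets `S` once, the implicit function theorem yields a smooth `v` with `v ∘ φ_t = v + t`
and `S = {v = 0}` (`IsGlobalFlow.exists_timeFunction`). Since `V` is parallel, `φ_t` is an isometry
(`IsGlobalFlow.val_mfderiv_mfderiv`), so all level sets of `v` are spacelike. Moreover `ds(V) = g(V,
V) = 0`, so `φ` preserves `s`.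

The second coordinate direction is `W = grad v - g(grad v, grad v) V`. It satisfies `dv(W) = 0`,
`ds(W) = 1` and `g(V, W) = 1`, is orthogonal to the common level sets of `v` and `s`, and is
invariant under `φ`. The decisive point is that the integral curves of `W` exist over the whole
interval `J = s(S)` (`exists_integralCurve_of_fibres`). Compactness of a fibre of `s` on `S` gives a
uniform existence time near it. The flowed fibre is then compact, and relatively open in the target
fibre because one can flow back; connectedness makes it the whole target fibre. Local pieces are
joined along the interval `J`, giving a transport `Θ` along `W`.

With `Q = {v = 0, s = c₀}`, the map `(a, c, q) ↦ φ_a (Θ_c q)` is a diffeomorphism from `ℝ × J × Q`.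
Its partial derivatives are `V`, `W` and vectors tangent to the slices. The inner products listed
above give `dv ⊗ ds + ds ⊗ dv + g(W, W) ds² + h_s`, where `u⁻² = g(W, W) > 0` and `h_s` is the
metric induced on the slice `{v = 0}` over `s`.

Conversely, on a simple pp-wave the gradient of the coordinate `s` is `∂_v`. Its products with
coordinate fields are constant and no metric coefficient depends on `v`, so the Koszul formula gives
`∇∂_v = 0`. Its integral curves are the `v`-lines, and `{v = 0}`, a copy of `J × Q`, is the required
hypersurface.

The analytic groundwork is the smooth dependence of flows on initial values, obtained from the
implicit function theorem in a space of continuous curves, and the manifold structure of regular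
level sets. -/

noncomputable section

/-! ### Smoothness of composition operators on spaces of continuous functions -/

section Nemytskii

universe u

variable {K : Type*} [TopologicalSpace K] [CompactSpace K]
  {E F : Type u} [NormedAddCommGroup E] [NormedSpace ℝ E] [NormedAddCommGroup F] [NormedSpace ℝ F]

/-- Pointwise application of a continuous bilinear map to a pair of continuous functions. -/
def ContinuousMap.pointwiseApply {G : Type*} [NormedAddCommGroup G] [NormedSpace ℝ G]
    (B : G →L[ℝ] E →L[ℝ] F) : C(K, G) →L[ℝ] C(K, E) →L[ℝ] C(K, F) :=
  LinearMap.mkContinuous₂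
    (LinearMap.mk₂ ℝ
      (fun (A : C(K, G)) (h : C(K, E)) ↦ (⟨fun t ↦ B (A t) (h t), by fun_prop⟩ : C(K, F)))
      (fun _ _ _ ↦ by ext; simp) (fun _ _ _ ↦ by ext; simp)
      (fun _ _ _ ↦ by ext; simp) (fun _ _ _ ↦ by ext; simp)) ‖B‖
    (fun A h ↦ by
      rw [ContinuousMap.norm_le _ (by positivity)]
      intro t
      refine (B.le_opNorm₂ (A t) (h t)).trans ?_
      gcongr
      exacts [A.norm_coe_le_norm t, h.norm_coe_le_norm t])

lemma ContDiff.pointwiseApply {G X : Type*} [NormedAddCommGroup G] [NormedSpace ℝ G]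
    [NormedAddCommGroup X] [NormedSpace ℝ X] (B : G →L[ℝ] E →L[ℝ] F) {n : ℕ∞ω} {f : X → C(K, G)}
    (hf : ContDiff ℝ n f) : ContDiff ℝ n (fun x ↦ ContinuousMap.pointwiseApply B (f x)) :=
  (ContinuousMap.pointwiseApply (K := K) B).isBoundedLinearMap.contDiff.comp hf

/-- Continuity of `f'` is uniform near the compact range of `α`, so the pointwise mean value
estimate holds with one constant for all `t` and becomes an estimate in the supremum norm. -/
lemma ContinuousMap.hasFDerivAt_postcomp {f : C(E, F)} {f' : C(E, E →L[ℝ] F)}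
    (hf : ∀ x, HasFDerivAt f (f' x) x) (α : C(K, E)) :
    HasFDerivAt (fun β : C(K, E) ↦ f.comp β)
      (ContinuousMap.pointwiseApply (.id ℝ (E →L[ℝ] F)) (f'.comp α)) α := by
  refine HasFDerivAt.of_isLittleO (Asymptotics.isLittleO_iff.2 fun c hc ↦ ?_)
  have hK : IsCompact (range α) := isCompact_range α.continuous
  obtain ⟨δ, hδ, H⟩ := Metric.mem_uniformity_dist.1
    (hK.uniformContinuousAt_of_continuousAt f' (fun a _ ↦ f'.continuous.continuousAt)
      (Metric.dist_mem_uniformity hc))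
  filter_upwards [Metric.ball_mem_nhds α hδ] with β hβ
  rw [ContinuousMap.norm_le _ (by positivity)]
  intro t
  have hβt : dist (β t) (α t) < δ := (ContinuousMap.dist_apply_le_dist t).trans_lt hβ
  have h1 := (convex_ball (α t) δ).norm_image_sub_le_of_norm_hasFDerivWithin_le' (f := f)
    (f' := f') (φ := f' (α t)) (C := c) (x := α t) (y := β t)
    (fun x _ ↦ (hf x).hasFDerivWithinAt)
    (fun x hx ↦ by
      have := @H (α t) x (by rwa [dist_comm]) ⟨t, rfl⟩
      rw [← dist_eq_norm, dist_comm]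
      exact this.le) (Metric.mem_ball_self hδ) hβt
  refine h1.trans ?_
  gcongr
  exact (β - α).norm_coe_le_norm t

/-- The derivative is again postcomposition, with `f'`, followed by a bounded bilinear operation, so
induction on the order applies. The target `F` varies in the induction because `f'` takes values in
`E →L[ℝ] F`; this is why `E` and `F` share a universe. -/
lemma ContinuousMap.contDiff_postcomp (n : ℕ) :
    ∀ {F : Type u} [NormedAddCommGroup F] [NormedSpace ℝ F] {f : C(E, F)},
      ContDiff ℝ n f → ContDiff ℝ n (fun β : C(K, E) ↦ f.comp β) := by
  induction n with
  | zero =>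
    intro F _ _ f _
    exact contDiff_zero.2 (ContinuousMap.continuous_postcomp f)
  | succ n ih =>
    intro F _ _ f hf
    obtain ⟨f', hf', h⟩ := contDiff_succ_iff_hasFDerivAt.1 hf
    exact contDiff_succ_iff_hasFDerivAt.2
      ⟨_, (ih (f := ⟨f', hf'.continuous⟩) hf').pointwiseApply (.id ℝ (E →L[ℝ] F)),
        fun α ↦ ContinuousMap.hasFDerivAt_postcomp (f' := ⟨f', hf'.continuous⟩) h α⟩

end Nemytskii

/-! ### Smooth local flows in Banach spaces -/

section EuclideanFlow

open MeasureTheory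

variable {E : Type*} [NormedAddCommGroup E] [NormedSpace ℝ E]

/-- The primitive vanishing at `0` of a continuous function on the unit interval. -/
def ContinuousMap.primitive [CompleteSpace E] : C(Icc (0 : ℝ) 1, E) →L[ℝ] C(Icc (0 : ℝ) 1, E) :=
  LinearMap.mkContinuous
    { toFun := fun β ↦ ⟨fun t ↦ ∫ τ in (0 : ℝ)..t, β (projIcc 0 1 zero_le_one τ), by
        have h : Continuous fun τ : ℝ ↦ β (projIcc 0 1 zero_le_one τ) :=
          β.continuous.comp continuous_projIcc
        exact (intervalIntegral.continuous_primitive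
          (fun a b ↦ h.intervalIntegrable a b) 0).comp continuous_subtype_val⟩
      map_add' := fun β β' ↦ by
        ext t
        have h (β : C(Icc (0 : ℝ) 1, E)) : Continuous fun τ : ℝ ↦ β (projIcc 0 1 zero_le_one τ) :=
          β.continuous.comp continuous_projIcc
        exact intervalIntegral.integral_add ((h β).intervalIntegrable _ _)
          ((h β').intervalIntegrable _ _)
      map_smul' := fun c β ↦ by
        ext t
        exact intervalIntegral.integral_smul _ _ } 1
    (fun β ↦ by
      rw [one_mul, ContinuousMap.norm_le _ (norm_nonneg _)]
      intro t
      have := intervalIntegral.norm_integral_le_of_norm_le_const (a := (0 : ℝ)) (b := t)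
        (f := fun τ ↦ β (projIcc 0 1 zero_le_one τ)) (C := ‖β‖)
        (fun τ _ ↦ β.norm_coe_le_norm _)
      refine this.trans ?_
      rw [sub_zero, abs_of_nonneg t.2.1]
      exact mul_le_of_le_one_right (norm_nonneg _) t.2.2)

/-- A smooth vector field on a Banach space has a local flow, which is smooth at the base point. -/
theorem exists_localFlow_contDiffAt [CompleteSpace E] {f : E → E} (hf : ContDiff ℝ ∞ f) (x₀ : E) :
    ∃ θ : ℝ × E → E, ∃ ε > (0 : ℝ), ∃ r > (0 : ℝ),
      (∀ x ∈ Metric.ball x₀ r, θ (0, x) = x ∧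
        ∀ t ∈ Ioo (-ε) ε, HasDerivAt (fun τ ↦ θ (τ, x)) (f (θ (t, x))) t) ∧
      ContDiffAt ℝ ∞ θ (0, x₀) := by
  obtain ⟨ε, hε, a, r, L, C, hr, hPL⟩ :=
    IsPicardLindelof.of_contDiffAt_one (hf.of_le (by simp) : ContDiff ℝ 1 f).contDiffAt (x₀ := x₀)
  obtain ⟨α, hα, hαc⟩ :=
    (hPL 0).exists_forall_mem_closedBall_eq_hasDerivWithinAt_continuousOn
  simp only [zero_sub, zero_add] at hα hαc
  have hr' : (0 : ℝ) < r := hr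
  have hd : ∀ x ∈ Metric.ball x₀ r, ∀ t ∈ Ioo (-ε) ε,
      HasDerivAt (fun τ ↦ α (x, τ)) (f (α (x, t))) t := fun x hx t ht ↦
    ((hα x (Metric.ball_subset_closedBall hx)).2 t (Ioo_subset_Icc_self ht)).hasDerivAt
      (Icc_mem_nhds ht.1 ht.2)
  refine ⟨fun p ↦ α (p.2, p.1), ε, hε, r, hr', fun x hx ↦
    ⟨(hα x (Metric.ball_subset_closedBall hx)).1, hd x hx⟩, contDiffAt_infty.2 fun n ↦ ?_⟩
  -- The order is raised to be positive, as the implicit function theorem requires.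
  suffices h : ContDiffAt ℝ (n + 1 : ℕ) (fun p : ℝ × E ↦ α (p.2, p.1)) (0, x₀) from
    h.of_le (by exact_mod_cast n.le_succ)
  let fc : C(E, E) := ⟨f, hf.continuous⟩
  let cst : E →L[ℝ] C(Icc (0 : ℝ) 1, E) := ContinuousLinearMap.const ℝ (Icc (0 : ℝ) 1)
  -- The zeros `β` of `G ((τ, x), ·)` are the rescaled solutions `t ↦ α (x, τ t)` on the unit
  -- interval. Rescaling turns the time `τ` into a parameter, so smoothness in time and initial
  -- value come out together.
  let G : (ℝ × E) × C(Icc (0 : ℝ) 1, E) → C(Icc (0 : ℝ) 1, E) := fun p ↦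
    p.2 - cst p.1.2 - p.1.1 • ContinuousMap.primitive (fc.comp p.2)
  have hN : ContDiff ℝ (n + 1 : ℕ) (fun β : C(Icc (0 : ℝ) 1, E) ↦ fc.comp β) :=
    ContinuousMap.contDiff_postcomp (n + 1) (hf.of_le (by exact_mod_cast le_top))
  have hG : ContDiff ℝ (n + 1 : ℕ) G :=
    (contDiff_snd.sub (cst.contDiff.comp (contDiff_snd.comp contDiff_fst))).sub
      ((contDiff_fst.comp contDiff_fst).smul
        (ContinuousMap.primitive.contDiff.comp (hN.comp contDiff_snd)))
  let u : (ℝ × E) × C(Icc (0 : ℝ) 1, E) := ((0, x₀), cst x₀)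
  have hGu : G u = 0 := by simp [G, u]
  have hn : ((n + 1 : ℕ) : ℕ∞ω) ≠ 0 := by simp
  -- At `τ = 0` the integral term vanishes, so the partial derivative in `β` is the identity.
  have hGd : fderiv ℝ G u ∘L .inr ℝ (ℝ × E) C(Icc (0 : ℝ) 1, E) = .id ℝ _ := by
    have h1 : HasFDerivAt (fun β : C(Icc (0 : ℝ) 1, E) ↦ G ((0, x₀), β))
        (fderiv ℝ G u ∘L .inr ℝ (ℝ × E) C(Icc (0 : ℝ) 1, E)) (cst x₀) :=
      ((hG.differentiable hn).differentiableAt (x := u)).hasFDerivAt.comp (cst x₀)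
        (hasFDerivAt_prodMk_right (0, x₀) (cst x₀))
    have h2 : HasFDerivAt (fun β : C(Icc (0 : ℝ) 1, E) ↦ G ((0, x₀), β)) (.id ℝ _) (cst x₀) := by
      simpa [G] using (hasFDerivAt_id (𝕜 := ℝ) (cst x₀)).sub_const (cst x₀)
    exact h1.unique h2
  have hinv : (fderiv ℝ G u ∘L .inr ℝ (ℝ × E) C(Icc (0 : ℝ) 1, E)).IsInvertible := by
    rw [hGd]; exact ⟨.refl ℝ _, rfl⟩
  have hGu' : ContDiffAt ℝ (n + 1 : ℕ) G u := hG.contDiffAt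
  have huniq := hGu'.eventually_apply_eq_iff_implicitFunction hn hinv
  have hsm := hGu'.contDiffAt_implicitFunction hn hinv
  let S := hGu'.implicitFunction hn hinv
  let e1 : Icc (0 : ℝ) 1 := ⟨1, by simp⟩
  have hev : ContDiffAt ℝ (n + 1 : ℕ) (fun p ↦ S p e1) (0, x₀) :=
    (ContinuousMap.evalCLM ℝ e1 : C(Icc (0 : ℝ) 1, E) →L[ℝ] E).contDiff.contDiffAt.comp _ hsm
  refine hev.congr_of_eventuallyEq ?_
  -- The implicit function describes the zeros of `G` only near the constant curve `x₀`. Joint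
  -- continuity of `α` forces the Picard–Lindelöf curves into that neighbourhood for small `τ`.
  obtain ⟨V1, hV1, V2, hV2, hV⟩ := mem_nhds_prod_iff.1 huniq
  obtain ⟨δ, hδ, hδV⟩ := Metric.mem_nhds_iff.1 hV2
  have hcont : ContinuousAt (fun p : ℝ × E ↦ α (p.2, p.1)) (0, x₀) := by
    have : ContinuousAt α (x₀, 0) := hαc.continuousAt
      (prod_mem_nhds (Metric.closedBall_mem_nhds x₀ hr') (Icc_mem_nhds (by simpa) (by simpa)))
    exact ContinuousAt.comp (f := fun p : ℝ × E ↦ (p.2, p.1)) (x := (0, x₀)) this (by fun_prop)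
  have hα0 : α (x₀, 0) = x₀ := (hα x₀ (Metric.mem_closedBall_self r.2)).1
  have hnear := hcont.eventually (Metric.ball_mem_nhds _ (half_pos hδ))
  simp only [hα0] at hnear
  obtain ⟨T, hT, R, hR, hTR⟩ := mem_nhds_prod_iff.1 hnear
  obtain ⟨η, hη, hηT⟩ := Metric.mem_nhds_iff.1 hT
  have hmem : (Metric.ball (0 : ℝ) (min η ε)) ×ˢ (R ∩ Metric.ball x₀ r) ∈ 𝓝 ((0 : ℝ), x₀) :=
    prod_mem_nhds (Metric.ball_mem_nhds _ (lt_min hη hε))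
      (Filter.inter_mem hR (Metric.ball_mem_nhds _ hr'))
  filter_upwards [hmem, hV1] with p hp hpV1
  obtain ⟨τ, x⟩ := p
  obtain ⟨hτ, hxR, hxr⟩ := hp
  have hscale : ∀ t : ℝ, t ∈ Icc (0 : ℝ) 1 → |τ * t| < min η ε := fun t ht ↦ by
    rw [abs_mul, abs_of_nonneg ht.1]
    have : |τ| < min η ε := by simpa using hτ
    exact (mul_le_of_le_one_right (abs_nonneg _) ht.2).trans_lt this
  have hIoo : ∀ t : ℝ, t ∈ Icc (0 : ℝ) 1 → τ * t ∈ Ioo (-ε) ε := fun t ht ↦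
    abs_lt.1 ((hscale t ht).trans_le (min_le_right _ _))
  have hder : ∀ t : ℝ, t ∈ Icc (0 : ℝ) 1 →
      HasDerivAt (fun t ↦ α (x, τ * t)) (τ • f (α (x, τ * t))) t := fun t ht ↦ by
    have h1 : HasDerivAt (fun t : ℝ ↦ τ * t) τ t := by
      simpa using (hasDerivAt_id t).const_mul τ
    exact (hd x hxr _ (hIoo t ht)).scomp t h1
  let c : C(Icc (0 : ℝ) 1, E) := ⟨fun t ↦ α (x, τ * t), by
    refine continuousOn_iff_continuous_domRestrict (s := Icc (0 : ℝ) 1)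
      (f := fun t ↦ α (x, τ * t)) |>.1 ?_
    exact fun t ht ↦ (hder t ht).continuousAt.continuousWithinAt⟩
  have hcV2 : c ∈ V2 := by
    apply hδV
    rw [Metric.mem_ball]
    refine ((ContinuousMap.dist_le (half_pos hδ).le).2 fun t ↦ ?_).trans_lt (half_lt_self hδ)
    have : ((τ * t : ℝ), x) ∈ T ×ˢ R :=
      ⟨hηT (by simpa using (hscale t t.2).trans_le (min_le_left _ _)), hxR⟩
    exact (Metric.mem_ball.1 (hTR this)).le
  have hGc : G ((τ, x), c) = 0 := by
    ext t
    have hsub : ∀ s ∈ uIcc (0 : ℝ) t, s ∈ Icc (0 : ℝ) 1 := fun s hs ↦ by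
      rw [uIcc_of_le t.2.1] at hs
      exact ⟨hs.1, hs.2.trans t.2.2⟩
    have hcont' : Continuous fun s : ℝ ↦ τ • f (c (projIcc 0 1 zero_le_one s)) :=
      (hf.continuous.comp (c.continuous.comp continuous_projIcc)).const_smul τ
    have h1 : ∫ s in (0 : ℝ)..t, τ • f (c (projIcc 0 1 zero_le_one s)) =
        α (x, τ * t) - α (x, τ * 0) := by
      refine intervalIntegral.integral_eq_sub_of_hasDerivAt (f := fun s ↦ α (x, τ * s))
        (fun s hs ↦ ?_) (hcont'.intervalIntegrable _ _)
      have := hder s (hsub s hs)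
      have h2 : c (projIcc 0 1 zero_le_one s) = α (x, τ * s) := by
        rw [projIcc_of_mem _ (hsub s hs)]; rfl
      rwa [h2]
    rw [intervalIntegral.integral_smul, mul_zero,
      (hα x (Metric.ball_subset_closedBall hxr)).1] at h1
    change α (x, τ * t) - x -
      τ • ∫ s in (0 : ℝ)..t, f (c (projIcc 0 1 zero_le_one s)) = 0
    rw [h1]
    abel
  have hSc : S (τ, x) = c :=
    (hV (show ((τ, x), c) ∈ V1 ×ˢ V2 from ⟨hpV1, hcV2⟩)).1 (by rw [hGc, hGu])
  change α (x, τ) = S (τ, x) e1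
  rw [hSc]
  change α (x, τ) = α (x, τ * 1)
  rw [mul_one]

end EuclideanFlow


/-! ### Smooth flows on manifolds -/

section ManifoldFlow

variable {E : Type*} [NormedAddCommGroup E] [NormedSpace ℝ E]
  {M : Type*} [TopologicalSpace M] [ChartedSpace E M] [IsManifold 𝓘(ℝ, E) ∞ M]

/-- The derivative of a smooth vector-valued function along a smooth vector field is smooth. -/
lemma ContMDiffAt.mfderiv_apply_section {G : Type*} [NormedAddCommGroup G] [NormedSpace ℝ G]
    {F : M → G} {X : Π x : M, TangentSpace 𝓘(ℝ, E) x} {x : M}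
    (hF : ContMDiffAt 𝓘(ℝ, E) 𝓘(ℝ, G) ∞ F x)
    (hX : ContMDiffAt 𝓘(ℝ, E) 𝓘(ℝ, E).tangent ∞ (T% X) x) :
    ContMDiffAt 𝓘(ℝ, E) 𝓘(ℝ, G) ∞ (fun y ↦ (mfderiv 𝓘(ℝ, E) 𝓘(ℝ, G) F y (X y) : G)) x := by
  have h1 : ContMDiffAt 𝓘(ℝ, E) 𝓘(ℝ, G).tangent ∞
      (fun y ↦ (⟨F y, mfderiv 𝓘(ℝ, E) 𝓘(ℝ, G) F y (X y)⟩ : TangentBundle 𝓘(ℝ, G) G)) x :=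
    ContMDiffAt.clm_apply_of_inCoordinates (hF.mfderiv_const le_rfl) hX hF
  exact (contMDiff_snd_tangentBundle_modelSpace G 𝓘(ℝ, G)).contMDiffAt.comp x h1

omit [IsManifold 𝓘(ℝ, E) ∞ M] in
lemma HasMFDerivAt.comp_hasDerivAt {γ : ℝ → E} {t : ℝ} {a : E} {f : E → M}
    (hγ : HasDerivAt γ a t) (hf : MDifferentiableAt 𝓘(ℝ, E) 𝓘(ℝ, E) f (γ t)) :
    HasMFDerivAt 𝓘(ℝ, ℝ) 𝓘(ℝ, E) (fun τ ↦ f (γ τ)) t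
      ((1 : ℝ →L[ℝ] ℝ).smulRight (mfderiv 𝓘(ℝ, E) 𝓘(ℝ, E) f (γ t) a)) := by
  have h := HasMFDerivAt.comp t hf.hasMFDerivAt (hasMFDerivAt_iff_hasFDerivAt.2 hγ.hasFDerivAt)
  have e : (1 : ℝ →L[ℝ] ℝ).smulRight (mfderiv 𝓘(ℝ, E) 𝓘(ℝ, E) f (γ t) a) =
      mfderiv 𝓘(ℝ, E) 𝓘(ℝ, E) f (γ t) ∘L ContinuousLinearMap.toSpanSingleton ℝ a := by
    ext
    change (1 : ℝ) • _ = mfderiv 𝓘(ℝ, E) 𝓘(ℝ, E) f (γ t) ((1 : ℝ) • a)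
    rw [one_smul, one_smul]
  rw [e]
  exact h

/-- A vector field that is smooth near `c` agrees near `c` with a globally smooth one. -/
lemma exists_contDiff_eqOn_ball [FiniteDimensional ℝ E] {f : E → E} {U : Set E} (hU : IsOpen U)
    (hf : ContDiffOn ℝ ∞ f U) {c : E} (hc : c ∈ U) :
    ∃ f' : E → E, ContDiff ℝ ∞ f' ∧ ∃ δ > 0, Metric.ball c δ ⊆ U ∧ EqOn f' f (Metric.ball c δ) := by
  obtain ⟨R, hR, hRU⟩ := Metric.nhds_basis_closedBall.mem_iff.1 (hU.mem_nhds hc)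
  let b : ContDiffBump c := ⟨R / 2, R, by linarith, by linarith⟩
  refine ⟨fun x ↦ b x • f x, ?_, R / 2, by linarith,
    ((Metric.ball_subset_ball (by linarith)).trans Metric.ball_subset_closedBall).trans hRU,
    fun x hx ↦ ?_⟩
  · rw [← contMDiff_iff_contDiff]
    refine contMDiff_of_tsupport fun x hx ↦ ?_
    have hx' : x ∈ U := by
      have := tsupport_smul_subset_left b f hx
      rw [b.tsupport_eq] at this
      exact hRU this
    exact (b.contDiff.contDiffAt.smul (hf.contDiffAt (hU.mem_nhds hx'))).contMDiffAt
  · simp [b.one_of_mem_closedBall (Metric.ball_subset_closedBall hx)]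

/-- A smooth vector field on a manifold has a local flow near every point `x₀`, which is smooth
at `(0, x₀)`. -/
theorem exists_localFlow_contMDiffAt [FiniteDimensional ℝ E] {X : Π x : M, TangentSpace 𝓘(ℝ, E) x}
    (hX : ContMDiff 𝓘(ℝ, E) 𝓘(ℝ, E).tangent ∞ (T% X)) (x₀ : M) :
    ∃ θ : ℝ × M → M, ∃ ε > (0 : ℝ), ∃ U ∈ 𝓝 x₀,
      (∀ x ∈ U, θ (0, x) = x ∧ IsMIntegralCurveOn (fun t ↦ θ (t, x)) X (Ioo (-ε) ε)) ∧
      ContMDiffAt (𝓘(ℝ, ℝ).prod 𝓘(ℝ, E)) 𝓘(ℝ, E) ∞ θ (0, x₀) := by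
  have : CompleteSpace E := FiniteDimensional.complete ℝ E
  set χ := extChartAt 𝓘(ℝ, E) x₀ with hχ
  have hto : IsOpen χ.target := isOpen_extChartAt_target x₀
  have hsymm : ∀ z ∈ χ.target, ContMDiffAt 𝓘(ℝ, E) 𝓘(ℝ, E) ∞ χ.symm z := fun z hz ↦
    (contMDiffOn_extChartAt_symm x₀).contMDiffAt (hto.mem_nhds hz)
  have hchart : ∀ x ∈ χ.source, ContMDiffAt 𝓘(ℝ, E) 𝓘(ℝ, E) ∞ χ x := fun x hx ↦
    contMDiffAt_extChartAt' (by rwa [hχ, extChartAt_source] at hx)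
  let f : E → E := fun z ↦ mfderiv 𝓘(ℝ, E) 𝓘(ℝ, E) χ (χ.symm z) (X (χ.symm z))
  have hf : ContDiffOn ℝ ∞ f χ.target := by
    intro z hz
    have h1 := (hchart _ (χ.map_target hz)).mfderiv_apply_section (hX (χ.symm z))
    exact ((h1.comp z (hsymm z hz)).contDiffAt).contDiffWithinAt
  -- The Euclidean theorem needs a globally smooth field, so the chart expression is cut off. Below,
  -- times are shortened until solutions stay in the ball where the cut-off changes nothing.
  obtain ⟨f', hf', δ, hδ, hδU, hff'⟩ :=
    exists_contDiff_eqOn_ball hto hf (mem_extChartAt_target (I := 𝓘(ℝ, E)) x₀)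
  obtain ⟨θ, ε, hε, r, hr, hθ, hθs⟩ := exists_localFlow_contDiffAt hf' (χ x₀)
  have hθ0 : θ (0, χ x₀) = χ x₀ := (hθ _ (Metric.mem_ball_self hr)).1
  have hnear := hθs.continuousAt.eventually
    (Metric.ball_mem_nhds (θ (0, χ x₀)) hδ)
  rw [hθ0] at hnear
  obtain ⟨T, hT, R, hR, hTR⟩ := mem_nhds_prod_iff.1 hnear
  obtain ⟨η, hη, hηT⟩ := Metric.mem_nhds_iff.1 hT
  have hbox : ∀ t ∈ Ioo (-min η ε) (min η ε), ∀ z ∈ R, θ (t, z) ∈ Metric.ball (χ x₀) δ := by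
    intro t ht z hz
    have : (t, z) ∈ T ×ˢ R :=
      ⟨hηT (by simpa using (abs_lt.2 ht).trans_le (min_le_left _ _)), hz⟩
    exact hTR this
  refine ⟨fun p ↦ χ.symm (θ (p.1, χ p.2)), min η ε, lt_min hη hε,
    χ.source ∩ χ ⁻¹' (R ∩ Metric.ball (χ x₀) r), ?_, ?_, ?_⟩
  · exact Filter.inter_mem (extChartAt_source_mem_nhds x₀)
      ((continuousAt_extChartAt x₀).preimage_mem_nhds
        (Filter.inter_mem hR (Metric.ball_mem_nhds _ hr)))
  · rintro x ⟨hxs, hxR, hxr⟩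
    refine ⟨by simp [(hθ _ hxr).1, χ.left_inv hxs], fun t ht ↦ ?_⟩
    have ht' : t ∈ Ioo (-ε) ε := abs_lt.1 ((abs_lt.2 ht).trans_le (min_le_right _ _))
    have hb := hbox t ht _ hxR
    have hz := hδU hb
    have h1 := HasMFDerivAt.comp_hasDerivAt ((hθ _ hxr).2 t ht')
      ((hsymm _ hz).mdifferentiableAt (by simp))
    have h2 : mfderiv 𝓘(ℝ, E) 𝓘(ℝ, E) χ.symm (θ (t, χ x)) (f' (θ (t, χ x))) =
        X (χ.symm (θ (t, χ x))) := by
      rw [hff' hb]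
      have h3 := mfderivWithin_extChartAt_symm_comp_mfderiv_extChartAt (I := 𝓘(ℝ, E)) hz
      rw [modelWithCornersSelf_coe, range_id, mfderivWithin_univ] at h3
      exact congrArg (fun L ↦ L (X (χ.symm (θ (t, χ x))))) h3
    rw [h2] at h1
    exact h1.hasMFDerivWithinAt
  · have h1 : ContMDiffAt (𝓘(ℝ, ℝ).prod 𝓘(ℝ, E)) 𝓘(ℝ, ℝ × E) ∞
        (fun p : ℝ × M ↦ (p.1, χ p.2)) (0, x₀) :=
      contMDiffAt_fst.prodMk_space
        ((hchart x₀ (mem_extChartAt_source x₀)).comp ((0 : ℝ), x₀) contMDiffAt_snd)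
    have h2 := ContMDiffAt.comp ((0 : ℝ), x₀) hθs.contMDiffAt h1
    refine ContMDiffAt.comp ((0 : ℝ), x₀) (hsymm _ ?_) h2
    change θ (0, χ x₀) ∈ _
    rw [hθ0]
    exact mem_extChartAt_target x₀

/-- Two integral curves of a smooth vector field on an open interval agree if they agree at one
point. -/
lemma IsMIntegralCurveOn.eq_of_ordConnected [T2Space M] {X : Π x : M, TangentSpace 𝓘(ℝ, E) x}
    (hX : ContMDiff 𝓘(ℝ, E) 𝓘(ℝ, E).tangent ∞ (T% X)) {O : Set ℝ} (hO : IsOpen O)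
    (hO' : O.OrdConnected) {γ γ' : ℝ → M} (hγ : IsMIntegralCurveOn γ X O)
    (hγ' : IsMIntegralCurveOn γ' X O) {t t' : ℝ} (ht : t ∈ O) (ht' : t' ∈ O) (h : γ t = γ' t) :
    γ t' = γ' t' := by
  obtain ⟨δ, hδ, h1⟩ := Metric.isOpen_iff.1 hO t ht
  obtain ⟨δ', hδ', h2⟩ := Metric.isOpen_iff.1 hO t' ht'
  -- Uniqueness is available on bounded open intervals, so endpoints `a, b ∈ O` strictly enclosing
  -- `t` and `t'` are chosen.
  obtain ⟨a, ha, hat, hat'⟩ : ∃ a ∈ O, a < t ∧ a < t' := by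
    rcases le_total t t' with hle | hle
    · exact ⟨t - δ / 2, h1 (by rw [Metric.mem_ball, Real.dist_eq, abs_lt]; constructor <;> linarith),
        by linarith, by linarith⟩
    · exact ⟨t' - δ' / 2,
        h2 (by rw [Metric.mem_ball, Real.dist_eq, abs_lt]; constructor <;> linarith),
        by linarith, by linarith⟩
  obtain ⟨b, hb, hbt, hbt'⟩ : ∃ b ∈ O, t < b ∧ t' < b := by
    rcases le_total t t' with hle | hle
    · exact ⟨t' + δ' / 2,
        h2 (by rw [Metric.mem_ball, Real.dist_eq, abs_lt]; constructor <;> linarith),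
        by linarith, by linarith⟩
    · exact ⟨t + δ / 2, h1 (by rw [Metric.mem_ball, Real.dist_eq, abs_lt]; constructor <;> linarith),
        by linarith, by linarith⟩
  have hab : Ioo a b ⊆ O := Ioo_subset_Icc_self.trans (hO'.out ha hb)
  exact isMIntegralCurveOn_Ioo_eqOn_of_contMDiff_boundaryless ⟨hat, hbt⟩ (hX.of_le (by simp))
    (hγ.mono hab) (hγ'.mono hab) h ⟨hat', hbt'⟩

/-- The flow of a smooth vector field is smooth on every open domain. -/
theorem contMDiffOn_flow [FiniteDimensional ℝ E] [T2Space M] {X : Π x : M, TangentSpace 𝓘(ℝ, E) x}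
    (hX : ContMDiff 𝓘(ℝ, E) 𝓘(ℝ, E).tangent ∞ (T% X)) {D : Set (ℝ × M)} (hD : IsOpen D)
    (h0 : ∀ p ∈ D, ((0 : ℝ), p.2) ∈ D) (hconn : ∀ x, {t | (t, x) ∈ D}.OrdConnected)
    {φ : ℝ × M → M} (hφ0 : ∀ x, ((0 : ℝ), x) ∈ D → φ (0, x) = x)
    (hφ : ∀ x, IsMIntegralCurveOn (fun t ↦ φ (t, x)) X {t | (t, x) ∈ D}) :
    ContMDiffOn (𝓘(ℝ, ℝ).prod 𝓘(ℝ, E)) 𝓘(ℝ, E) ∞ φ D := by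
  -- The order is made finite because only then does smoothness at a point spread to a
  -- neighbourhood.
  suffices H : ∀ n : ℕ, ∀ p ∈ D, ContMDiffAt (𝓘(ℝ, ℝ).prod 𝓘(ℝ, E)) 𝓘(ℝ, E) n φ p from
    fun p hp ↦ (contMDiffAt_infty.2 fun n ↦ H n p hp).contMDiffWithinAt
  intro n
  have hDs : ∀ x, IsOpen {t | (t, x) ∈ D} := fun x ↦ hD.preimage (by fun_prop)
  -- By uniqueness `φ (t', x) = θ (t' - t, φ (t, x))` for nearby times. Hence smoothness of one time
  -- slice at `x₁` gives joint smoothness at all nearby times.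
  have step : ∀ x₁ t₀, (t₀, x₁) ∈ D → ∃ N ∈ 𝓝 t₀, ∀ t ∈ N, (t, x₁) ∈ D ∧
      (ContMDiffAt 𝓘(ℝ, E) 𝓘(ℝ, E) n (fun x ↦ φ (t, x)) x₁ →
        ∀ t' ∈ N, ContMDiffAt (𝓘(ℝ, ℝ).prod 𝓘(ℝ, E)) 𝓘(ℝ, E) n φ (t', x₁)) := by
    intro x₁ t₀ ht₀
    obtain ⟨θ, ε, hε, U, hU, hθ, hθs⟩ := exists_localFlow_contMDiffAt hX (φ (t₀, x₁))
    obtain ⟨T, hT, R, hR, hTR⟩ := mem_nhds_prod_iff.1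
      ((contMDiffAt_iff_contMDiffAt_nhds (by simp)).1
        (hθs.of_le (by exact_mod_cast le_top : (n : ℕ∞ω) ≤ ∞)))
    obtain ⟨η, hη, hηT⟩ := Metric.mem_nhds_iff.1 hT
    have hc : ContinuousAt (fun t ↦ φ (t, x₁)) t₀ :=
      ((hφ x₁ t₀ ht₀).hasMFDerivAt ((hDs x₁).mem_nhds ht₀)).continuousAt
    refine ⟨{t | (t, x₁) ∈ D} ∩ Metric.ball t₀ (min η ε / 2) ∩
      (fun t ↦ φ (t, x₁)) ⁻¹' (R ∩ interior U), ?_, ?_⟩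
    · exact Filter.inter_mem (Filter.inter_mem ((hDs x₁).mem_nhds ht₀)
        (Metric.ball_mem_nhds _ (half_pos (lt_min hη hε))))
        (hc.preimage_mem_nhds (Filter.inter_mem hR (interior_mem_nhds.2 hU)))
    · rintro t ⟨⟨htD, htb⟩, htR, htU⟩
      refine ⟨htD, fun hs t' ⟨⟨htD', htb'⟩, _, _⟩ ↦ ?_⟩
      have habs : |t' - t| < min η ε := by
        rw [Metric.mem_ball] at htb htb'
        rw [← Real.dist_eq]
        linarith [dist_triangle_right t' t t₀]
      have hs' : ContMDiffAt (𝓘(ℝ, ℝ).prod 𝓘(ℝ, E)) (𝓘(ℝ, ℝ).prod 𝓘(ℝ, E)) n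
          (fun p : ℝ × M ↦ (p.1 - t, φ (t, p.2))) (t', x₁) :=
        ((contMDiff_id.sub contMDiff_const).contMDiffAt.comp (t', x₁) contMDiffAt_fst).prodMk
          (ContMDiffAt.comp (g := fun x ↦ φ (t, x)) (t', x₁) hs contMDiffAt_snd)
      have hmem : (t' - t, φ (t, x₁)) ∈ T ×ˢ R :=
        ⟨hηT (by simpa using habs.trans_le (min_le_left _ _)), htR⟩
      refine (ContMDiffAt.comp (t', x₁) (hTR hmem) hs').congr_of_eventuallyEq ?_
      have e1 : ∀ᶠ p : ℝ × M in 𝓝 (t', x₁), p ∈ D := hD.mem_nhds htD'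
      have e2 : ∀ᶠ p : ℝ × M in 𝓝 (t', x₁), (t, p.2) ∈ D :=
        (show Continuous fun p : ℝ × M ↦ (t, p.2) by fun_prop).continuousAt.preimage_mem_nhds
          (hD.mem_nhds htD)
      have e3 : ∀ᶠ p : ℝ × M in 𝓝 (t', x₁), φ (t, p.2) ∈ U :=
        (ContinuousAt.comp (f := fun p : ℝ × M ↦ p.2) (x := (t', x₁))
          hs.continuousAt continuousAt_snd).preimage_mem_nhds (mem_interior_iff_mem_nhds.1 htU)
      have e4 : ∀ᶠ p : ℝ × M in 𝓝 (t', x₁), |p.1 - t| < ε :=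
        (show Continuous fun p : ℝ × M ↦ |p.1 - t| by fun_prop).continuousAt.eventually_lt
          continuousAt_const (habs.trans_le (min_le_right _ _))
      filter_upwards [e1, e2, e3, e4] with p h1 h2 h3 h4
      obtain ⟨τ, x⟩ := p
      have hc1 : IsMIntegralCurveOn (fun τ ↦ θ (τ - t, φ (t, x))) X (Ioo (t - ε) (t + ε)) := by
        have := (hθ _ h3).2.comp_add (-t)
        refine this.mono fun τ hτ ↦ ?_
        simp only [Set.mem_ofPred_eq, mem_Ioo] at hτ ⊢
        constructor <;> linarith
      refine IsMIntegralCurveOn.eq_of_ordConnected hX ((hDs x).inter isOpen_Ioo)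
        ((hconn x).inter ordConnected_Ioo) ((hφ x).mono inter_subset_left)
        (hc1.mono inter_subset_right) (t := t) (t' := τ) ⟨h2, by simp [hε]⟩ ⟨h1, ?_⟩ ?_
      · have := abs_lt.1 h4
        constructor <;> linarith
      · simp [(hθ _ h3).1]
  have slice : ∀ t x₁, ContMDiffAt (𝓘(ℝ, ℝ).prod 𝓘(ℝ, E)) 𝓘(ℝ, E) n φ (t, x₁) →
      ContMDiffAt 𝓘(ℝ, E) 𝓘(ℝ, E) n (fun x ↦ φ (t, x)) x₁ := fun t x₁ h ↦
    ContMDiffAt.comp x₁ h (contMDiffAt_const.prodMk contMDiffAt_id)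
  rintro ⟨t₁, x₁⟩ hp
  have h0' := h0 _ hp
  -- Smoothness propagates in both directions between nearby times, hence along the interval from
  -- `0`, where the slice is the identity, to `t₁`.
  have key := (hconn x₁).isPreconnected.induction₂' (fun t t' ↦
    ContMDiffAt 𝓘(ℝ, E) 𝓘(ℝ, E) n (fun x ↦ φ (t, x)) x₁ →
      ContMDiffAt 𝓘(ℝ, E) 𝓘(ℝ, E) n (fun x ↦ φ (t', x)) x₁)
    (fun t ht ↦ by
      obtain ⟨N, hN, H⟩ := step x₁ t ht
      filter_upwards [mem_nhdsWithin_of_mem_nhds hN] with t' ht'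
      exact ⟨fun h ↦ slice _ _ ((H t (mem_of_mem_nhds hN)).2 h t' ht'),
        fun h ↦ slice _ _ ((H t' ht').2 h t (mem_of_mem_nhds hN))⟩)
    (fun _ _ _ _ _ _ h h' ↦ h' ∘ h) h0' hp
  have hid : ContMDiffAt 𝓘(ℝ, E) 𝓘(ℝ, E) n (fun x ↦ φ (0, x)) x₁ := by
    refine contMDiffAt_id.congr_of_eventuallyEq ?_
    filter_upwards [(show Continuous fun x : M ↦ ((0 : ℝ), x) by fun_prop).continuousAt
      |>.preimage_mem_nhds (hD.mem_nhds h0')] with x hx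
    exact hφ0 x hx
  obtain ⟨N, hN, H⟩ := step x₁ t₁ hp
  exact (H t₁ (mem_of_mem_nhds hN)).2 (key hid) t₁ (mem_of_mem_nhds hN)

/-- Near a compact set, the integral curves of a smooth vector field exist for a uniform time. -/
lemma IsCompact.exists_uniform_isMIntegralCurveOn [FiniteDimensional ℝ E]
    {X : Π x : M, TangentSpace 𝓘(ℝ, E) x}
    (hX : ContMDiff 𝓘(ℝ, E) 𝓘(ℝ, E).tangent ∞ (T% X)) {K : Set M} (hK : IsCompact K) :
    ∃ ε > (0 : ℝ), ∃ U : Set M, IsOpen U ∧ K ⊆ U ∧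
      ∀ x ∈ U, ∃ γ : ℝ → M, γ 0 = x ∧ IsMIntegralCurveOn γ X (Ioo (-ε) ε) := by
  refine hK.induction_on (p := fun K ↦ ∃ ε > (0 : ℝ), ∃ U : Set M, IsOpen U ∧ K ⊆ U ∧
      ∀ x ∈ U, ∃ γ : ℝ → M, γ 0 = x ∧ IsMIntegralCurveOn γ X (Ioo (-ε) ε))
    ⟨1, one_pos, ∅, isOpen_empty, subset_rfl, by simp⟩ ?_ ?_ ?_
  · rintro s t hst ⟨ε, hε, U, hU, hKU, H⟩
    exact ⟨ε, hε, U, hU, hst.trans hKU, H⟩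
  · rintro s t ⟨ε, hε, U, hU, hKU, H⟩ ⟨ε', hε', U', hU', hKU', H'⟩
    refine ⟨min ε ε', lt_min hε hε', U ∪ U', hU.union hU', union_subset_union hKU hKU', ?_⟩
    rintro x (hx | hx)
    · obtain ⟨γ, h0, h⟩ := H x hx
      exact ⟨γ, h0, h.mono (Ioo_subset_Ioo (neg_le_neg (min_le_left _ _)) (min_le_left _ _))⟩
    · obtain ⟨γ, h0, h⟩ := H' x hx
      exact ⟨γ, h0, h.mono (Ioo_subset_Ioo (neg_le_neg (min_le_right _ _)) (min_le_right _ _))⟩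
  · intro x hx
    obtain ⟨θ, ε, hε, U, hU, hθ, -⟩ := exists_localFlow_contMDiffAt hX x
    exact ⟨interior U, mem_nhdsWithin_of_mem_nhds (interior_mem_nhds.2 hU), ε, hε, interior U,
      isOpen_interior, subset_rfl, fun y hy ↦ ⟨fun t ↦ θ (t, y), hθ y (interior_subset hy)⟩⟩

end ManifoldFlow


/-! ### Regular level sets as manifolds -/

section LevelSet

variable {E : Type*} [NormedAddCommGroup E] [NormedSpace ℝ E] [FiniteDimensional ℝ E]
  {F : Type*} [NormedAddCommGroup F] [NormedSpace ℝ F] [FiniteDimensional ℝ F] {n : ℕ}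

/-- A surjective linear map is the first component of a linear isomorphism with a product. -/
lemma ContinuousLinearMap.exists_equiv_prod_of_surjective (A : E →L[ℝ] F)
    (hA : Function.Surjective A) (hn : Module.finrank ℝ E = Module.finrank ℝ F + n) :
    ∃ (P : E →L[ℝ] EuclideanSpace ℝ (Fin n)) (L : E ≃L[ℝ] F × EuclideanSpace ℝ (Fin n)),
      (L : E →L[ℝ] F × EuclideanSpace ℝ (Fin n)) = A.prod P := by
  have hk : Module.finrank ℝ (A : E →ₗ[ℝ] F).ker =
      Module.finrank ℝ (EuclideanSpace ℝ (Fin n)) := by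
    have h1 := LinearMap.finrank_range_add_finrank_ker (A : E →ₗ[ℝ] F)
    rw [LinearMap.range_eq_top.2 hA, finrank_top, hn] at h1
    rw [finrank_euclideanSpace_fin]
    omega
  obtain ⟨p, hp⟩ := (A : E →ₗ[ℝ] F).ker.subtype.exists_leftInverse_of_injective (by simp)
  let e := LinearEquiv.ofFinrankEq _ _ hk
  let P : E →ₗ[ℝ] EuclideanSpace ℝ (Fin n) := e.toLinearMap ∘ₗ p
  have hinj : Function.Injective ((A : E →ₗ[ℝ] F).prod P) := by
    rw [← LinearMap.ker_eq_bot, LinearMap.ker_eq_bot']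
    intro x hx
    have h1 : A x = 0 := congrArg Prod.fst hx
    have h2 : e (p x) = 0 := congrArg Prod.snd hx
    have h3 : p x = ⟨x, h1⟩ := LinearMap.congr_fun hp (⟨x, h1⟩ : (A : E →ₗ[ℝ] F).ker)
    rw [map_eq_zero_iff e e.injective, h3] at h2
    exact congrArg Subtype.val h2
  let L := LinearEquiv.ofInjectiveOfFinrankEq ((A : E →ₗ[ℝ] F).prod P) hinj
    (by rw [Module.finrank_prod, hn, finrank_euclideanSpace_fin])
  exact ⟨LinearMap.toContinuousLinearMap P, L.toContinuousLinearEquiv, by ext x <;> rfl⟩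

omit [FiniteDimensional ℝ F] in
/-- The inverse function theorem, with a smooth inverse on an open set. -/
lemma ContDiffOn.exists_openPartialHomeomorph {G : E → F} {T : Set E} (hT : IsOpen T)
    (hG : ContDiffOn ℝ ∞ G T) {a : E} (ha : a ∈ T) {L : E ≃L[ℝ] F}
    (hL : HasFDerivAt G (L : E →L[ℝ] F) a) :
    ∃ e : OpenPartialHomeomorph E F, a ∈ e.source ∧ e.source ⊆ T ∧ (∀ x, e x = G x) ∧
      ContDiffOn ℝ ∞ e.symm e.target := by
  have : CompleteSpace E := FiniteDimensional.complete ℝ E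
  have hGa := hG.contDiffAt (hT.mem_nhds ha)
  let e₀ := hGa.toOpenPartialHomeomorph G hL (by simp)
  -- The inverse is smooth at every point whose derivative is invertible. Restricting to this open
  -- set gives smoothness on the whole target rather than only at `G a`.
  let U : Set E := T ∩ fderiv ℝ G ⁻¹' range ((↑) : (E ≃L[ℝ] F) → E →L[ℝ] F)
  have hU : IsOpen U :=
    (hG.continuousOn_fderiv_of_isOpen hT (by simp)).isOpen_inter_preimage hT
      ContinuousLinearEquiv.isOpen
  refine ⟨e₀.restr U, ?_, ?_, fun x ↦ rfl, ?_⟩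
  · rw [e₀.restr_source' U hU]
    exact ⟨hGa.mem_toOpenPartialHomeomorph_source hL (by simp), ha, L, hL.fderiv.symm⟩
  · rw [e₀.restr_source' U hU]
    exact fun x hx ↦ hx.2.1
  · intro y hy
    have hy' := (e₀.restr U).map_target hy
    rw [e₀.restr_source' U hU] at hy'
    obtain ⟨-, hyT, L', hL'⟩ := hy'
    have hGy := hG.contDiffAt (hT.mem_nhds hyT)
    refine ((e₀.restr U).contDiffAt_symm (f₀' := L') hy ?_ hGy).contDiffWithinAt
    rw [hL']
    exact (hGy.differentiableAt (by simp)).hasFDerivAt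

variable {M : Type*} [TopologicalSpace M] [ChartedSpace E M] [IsManifold 𝓘(ℝ, E) ∞ M]

/-- Local normal form of a submersion. -/
lemma exists_sliceChart {f : M → F} (hf : ContMDiff 𝓘(ℝ, E) 𝓘(ℝ, F) ∞ f) {q : M}
    (hq : Function.Surjective (mfderiv 𝓘(ℝ, E) 𝓘(ℝ, F) f q))
    (hn : Module.finrank ℝ E = Module.finrank ℝ F + n) :
    ∃ e : OpenPartialHomeomorph M (F × EuclideanSpace ℝ (Fin n)), q ∈ e.source ∧
      (∀ x ∈ e.source, (e x).1 = f x) ∧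
      ContMDiffOn 𝓘(ℝ, E) 𝓘(ℝ, F × EuclideanSpace ℝ (Fin n)) ∞ e e.source ∧
      ContMDiffOn 𝓘(ℝ, F × EuclideanSpace ℝ (Fin n)) 𝓘(ℝ, E) ∞ e.symm e.target := by
  let χ := chartAt E q
  have hχ : ContMDiffOn 𝓘(ℝ, E) 𝓘(ℝ, E) ∞ χ χ.source := contMDiffOn_chart
  have hχs : ContMDiffOn 𝓘(ℝ, E) 𝓘(ℝ, E) ∞ χ.symm χ.target := contMDiffOn_chart_symm
  have hqs : q ∈ χ.source := mem_chart_source E q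
  have hqt : χ q ∈ χ.target := mem_chart_target E q
  have hg : ContDiffOn ℝ ∞ (f ∘ χ.symm) χ.target :=
    (hf.comp_contMDiffOn hχs).contDiffOn
  have hA : Function.Surjective (fderiv ℝ (f ∘ χ.symm) (χ q)) := by
    have h1 : f =ᶠ[𝓝 q] (f ∘ χ.symm) ∘ χ := by
      filter_upwards [χ.open_source.mem_nhds hqs] with x hx
      simp [χ.left_inv hx]
    have h2 : mfderiv 𝓘(ℝ, E) 𝓘(ℝ, F) f q = (fderiv ℝ (f ∘ χ.symm) (χ q)).comp
        (mfderiv 𝓘(ℝ, E) 𝓘(ℝ, E) χ q) := by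
      rw [h1.mfderiv_eq, mfderiv_comp q
        ((hg.contDiffAt (χ.open_target.mem_nhds hqt)).differentiableAt
          (by simp)).mdifferentiableAt
        ((hχ.contMDiffAt (χ.open_source.mem_nhds hqs)).mdifferentiableAt (by simp)),
        mfderiv_eq_fderiv]
      rfl
    rw [h2] at hq
    exact Function.Surjective.of_comp hq
  obtain ⟨P, L, hL⟩ := ContinuousLinearMap.exists_equiv_prod_of_surjective _ hA hn
  have hG : ContDiffOn ℝ ∞ (fun z ↦ ((f ∘ χ.symm) z, P z)) χ.target :=
    hg.prodMk P.contDiff.contDiffOn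
  have hGL : HasFDerivAt (fun z ↦ ((f ∘ χ.symm) z, P z))
      (L : E →L[ℝ] F × EuclideanSpace ℝ (Fin n)) (χ q) := by
    rw [hL]
    exact ((hg.contDiffAt (χ.open_target.mem_nhds hqt)).differentiableAt
      (by simp)).hasFDerivAt.prodMk P.hasFDerivAt
  obtain ⟨e, he1, he2, he3, he4⟩ := hG.exists_openPartialHomeomorph χ.open_target hqt hGL
  refine ⟨χ.trans e, ?_, ?_, ?_, ?_⟩
  · rw [OpenPartialHomeomorph.trans_source]
    exact ⟨hqs, he1⟩
  · intro x hx
    rw [OpenPartialHomeomorph.trans_source] at hx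
    simp [he3, χ.left_inv hx.1]
  · have h1 : ContMDiffOn 𝓘(ℝ, E) 𝓘(ℝ, F × EuclideanSpace ℝ (Fin n)) ∞ e e.source :=
      ((hG.mono he2).congr fun x _ ↦ he3 x).contMDiffOn
    rw [OpenPartialHomeomorph.trans_source]
    exact h1.comp (hχ.mono inter_subset_left) inter_subset_right
  · rw [OpenPartialHomeomorph.trans_target]
    exact hχs.comp (he4.contMDiffOn.mono inter_subset_left) inter_subset_right

/-- The chart of a level set induced by a slice chart of the ambient manifold. -/
def levelSetChart {f : M → F} {c : F}
    (e : OpenPartialHomeomorph M (F × EuclideanSpace ℝ (Fin n)))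
    (he : ∀ x ∈ e.source, (e x).1 = f x) (q : {x : M // f x = c}) :
    OpenPartialHomeomorph {x : M // f x = c} (EuclideanSpace ℝ (Fin n)) := by
  classical
  have hinv : ∀ y, (c, y) ∈ e.target → f (e.symm (c, y)) = c := fun y hy ↦ by
    rw [← he _ (e.map_target hy), e.right_inv hy]
  exact
  { toFun := fun x ↦ (e x).2
    -- The value `q` off the target is a default without significance.
    invFun := fun y ↦ if hy : (c, y) ∈ e.target then ⟨e.symm (c, y), hinv y hy⟩ else q
    source := {x | (x : M) ∈ e.source}
    target := {y | (c, y) ∈ e.target}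
    map_source' := fun x hx ↦ by
      have h1 : (c, (e x).2) = e x := Prod.ext ((he _ hx).trans x.2).symm rfl
      change (c, (e x).2) ∈ e.target
      rw [h1]
      exact e.map_source hx
    map_target' := fun y hy ↦ by
      change (c, y) ∈ e.target at hy
      simp only [hy, dif_pos]
      exact e.map_target hy
    left_inv' := fun x hx ↦ by
      have h1 : (c, (e x).2) = e x := Prod.ext ((he _ hx).trans x.2).symm rfl
      have h2 : (c, (e x).2) ∈ e.target := h1 ▸ e.map_source hx
      rw [dif_pos h2]
      exact Subtype.ext (by simp only [h1]; exact e.left_inv hx)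
    right_inv' := fun y hy ↦ by
      change (c, y) ∈ e.target at hy
      simp only [hy, dif_pos]
      rw [e.right_inv hy]
    open_source := e.open_source.preimage continuous_subtype_val
    open_target := e.open_target.preimage (by fun_prop)
    continuousOn_toFun := continuous_snd.comp_continuousOn
      (e.continuousOn.comp continuous_subtype_val.continuousOn fun _ hx ↦ hx)
    continuousOn_invFun := by
      refine (Topology.IsInducing.continuousOn_iff (g := (Subtype.val : {x : M // f x = c} → M))
        Topology.IsInducing.subtypeVal).2 ?_
      refine (e.continuousOn_symm.comp (s := {y | (c, y) ∈ e.target})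
        (f := fun y : EuclideanSpace ℝ (Fin n) ↦ (c, y)) (by fun_prop) fun _ hy ↦ hy).congr fun y hy ↦ ?_
      change (c, y) ∈ e.target at hy
      simp [hy] }

variable {f : M → F} {c : F} (hf : ContMDiff 𝓘(ℝ, E) 𝓘(ℝ, F) ∞ f)
  (hs : ∀ q, f q = c → Function.Surjective (mfderiv 𝓘(ℝ, E) 𝓘(ℝ, F) f q))
  (hn : Module.finrank ℝ E = Module.finrank ℝ F + n)

/-- A slice chart at a point of a regular level set. -/
def sliceChart (q : {x : M // f x = c}) :
    OpenPartialHomeomorph M (F × EuclideanSpace ℝ (Fin n)) :=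
  (exists_sliceChart hf (hs q q.2) hn).choose

lemma sliceChart_spec (q : {x : M // f x = c}) :
    (q : M) ∈ (sliceChart hf hs hn q).source ∧
      (∀ x ∈ (sliceChart hf hs hn q).source, (sliceChart hf hs hn q x).1 = f x) ∧
      ContMDiffOn 𝓘(ℝ, E) 𝓘(ℝ, F × EuclideanSpace ℝ (Fin n)) ∞ (sliceChart hf hs hn q)
        (sliceChart hf hs hn q).source ∧
      ContMDiffOn 𝓘(ℝ, F × EuclideanSpace ℝ (Fin n)) 𝓘(ℝ, E) ∞ (sliceChart hf hs hn q).symm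
        (sliceChart hf hs hn q).target :=
  (exists_sliceChart hf (hs q q.2) hn).choose_spec

/-- The charted space structure on a regular level set. -/
abbrev levelSetChartedSpace : ChartedSpace (EuclideanSpace ℝ (Fin n)) {x : M // f x = c} where
  atlas := range fun q ↦ levelSetChart (sliceChart hf hs hn q) (sliceChart_spec hf hs hn q).2.1 q
  chartAt q := levelSetChart (sliceChart hf hs hn q) (sliceChart_spec hf hs hn q).2.1 q
  mem_chart_source q := (sliceChart_spec hf hs hn q).1
  chart_mem_atlas q := ⟨q, rfl⟩

omit [FiniteDimensional ℝ E] [NormedSpace ℝ F] [FiniteDimensional ℝ F] [ChartedSpace E M] [IsManifold 𝓘(ℝ, E) ∞ M] in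
lemma levelSetChart_symm_coe (e : OpenPartialHomeomorph M (F × EuclideanSpace ℝ (Fin n)))
    (he : ∀ x ∈ e.source, (e x).1 = f x) (q : {x : M // f x = c}) {y : EuclideanSpace ℝ (Fin n)}
    (hy : (c, y) ∈ e.target) : ((levelSetChart e he q).symm y : M) = e.symm (c, y) := by
  classical
  exact congrArg Subtype.val (dif_pos hy)

omit [FiniteDimensional ℝ E] [FiniteDimensional ℝ F] [IsManifold 𝓘(ℝ, E) ∞ M] in
lemma contMDiffOn_levelSetChart_symm (e : OpenPartialHomeomorph M (F × EuclideanSpace ℝ (Fin n)))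
    (he : ∀ x ∈ e.source, (e x).1 = f x) (q : {x : M // f x = c})
    (hes : ContMDiffOn 𝓘(ℝ, F × EuclideanSpace ℝ (Fin n)) 𝓘(ℝ, E) ∞ e.symm e.target) :
    ContMDiffOn (𝓡 n) 𝓘(ℝ, E) ∞ (fun y ↦ ((levelSetChart e he q).symm y : M))
      (levelSetChart e he q).target := by
  refine (hes.comp (t := e.target) (f := fun y : EuclideanSpace ℝ (Fin n) ↦ (c, y))
    ((contDiff_const.prodMk contDiff_id).contMDiff.contMDiffOn) fun y hy ↦ hy).congr
    fun y hy ↦ levelSetChart_symm_coe e he q hy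

/-- A regular level set is a smooth manifold. -/
lemma isManifold_levelSet :
    letI := levelSetChartedSpace hf hs hn
    IsManifold (𝓡 n) ∞ {x : M // f x = c} := by
  let := levelSetChartedSpace hf hs hn
  refine isManifold_of_contDiffOn _ _ _ ?_
  rintro _ _ ⟨q, rfl⟩ ⟨q', rfl⟩
  obtain ⟨-, h1, -, h2⟩ := sliceChart_spec hf hs hn q
  obtain ⟨-, h1', h3, -⟩ := sliceChart_spec hf hs hn q'
  simp only [modelWithCornersSelf_coe, modelWithCornersSelf_coe_symm, Function.id_comp,
    Function.comp_id, preimage_id, range_id, inter_univ]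
  have h4 := contMDiffOn_levelSetChart_symm (sliceChart hf hs hn q) h1 q h2
  rw [← contMDiffOn_iff_contDiffOn]
  refine (contDiff_snd.contMDiff.comp_contMDiffOn
    (h3.comp (h4.mono ?_) ?_) : ContMDiffOn (𝓡 n) (𝓡 n) ∞ (fun y ↦ (sliceChart hf hs hn q'
      ((levelSetChart (sliceChart hf hs hn q) h1 q).symm y : M)).2) _)
  · exact fun y hy ↦ hy.1
  · exact fun y hy ↦ hy.2

/-- The inclusion of a regular level set is smooth. -/
lemma contMDiff_levelSet_val :
    letI := levelSetChartedSpace hf hs hn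
    ContMDiff (𝓡 n) 𝓘(ℝ, E) ∞ (Subtype.val : {x : M // f x = c} → M) := by
  let := levelSetChartedSpace hf hs hn
  have := isManifold_levelSet hf hs hn
  intro q
  obtain ⟨h0, h1, -, h2⟩ := sliceChart_spec hf hs hn q
  have h4 := contMDiffOn_levelSetChart_symm (sliceChart hf hs hn q) h1 q h2
  have h5 : ContMDiffOn (𝓡 n) (𝓡 n) ∞ (chartAt (EuclideanSpace ℝ (Fin n)) q)
    (chartAt (EuclideanSpace ℝ (Fin n)) q).source := contMDiffOn_chart
  have h6 := (chartAt (EuclideanSpace ℝ (Fin n)) q).open_source.mem_nhds (mem_chart_source _ q)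
  refine (((h4.comp h5 (chartAt (EuclideanSpace ℝ (Fin n)) q).mapsTo).contMDiffAt
    h6).congr_of_eventuallyEq ?_)
  filter_upwards [h6] with x hx
  exact congrArg Subtype.val ((chartAt (EuclideanSpace ℝ (Fin n)) q).left_inv hx).symm

/-- A map into a regular level set is smooth if it is smooth as a map to the ambient manifold. -/
lemma contMDiff_levelSet_of_val {E' H' N : Type*} [NormedAddCommGroup E'] [NormedSpace ℝ E']
    [TopologicalSpace H'] {I' : ModelWithCorners ℝ E' H'} [TopologicalSpace N]
    [ChartedSpace H' N] {g : N → {x : M // f x = c}}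
    (hg : ContMDiff I' 𝓘(ℝ, E) ∞ fun p ↦ (g p : M)) :
    letI := levelSetChartedSpace hf hs hn
    ContMDiff I' (𝓡 n) ∞ g := by
  let := levelSetChartedSpace hf hs hn
  have := isManifold_levelSet hf hs hn
  intro p
  obtain ⟨h0, h1, h3, h2⟩ := sliceChart_spec hf hs hn (g p)
  let χ := chartAt (EuclideanSpace ℝ (Fin n)) (g p)
  have hcont : Continuous g := Topology.IsInducing.subtypeVal.continuous_iff.2 hg.continuous
  have hp : (g p : M) ∈ (sliceChart hf hs hn (g p)).source := h0
  have h4 : ContMDiffAt I' (𝓡 n) ∞ (fun x ↦ χ (g x)) p :=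
    contDiff_snd.contMDiff.contMDiffAt.comp p
      (ContMDiffAt.comp p (h3.contMDiffAt ((sliceChart hf hs hn (g p)).open_source.mem_nhds hp))
        (hg p))
  have h5 : ContMDiffAt (𝓡 n) (𝓡 n) ∞ χ.symm (χ (g p)) :=
    contMDiffOn_chart_symm.contMDiffAt (χ.open_target.mem_nhds (mem_chart_target _ (g p)))
  refine (ContMDiffAt.comp p h5 h4).congr_of_eventuallyEq ?_
  filter_upwards [hcont.continuousAt.preimage_mem_nhds
    (χ.open_source.mem_nhds (mem_chart_source _ (g p)))] with x hx
  exact (χ.left_inv hx).symm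

end LevelSet


/-! ### Coordinate vector fields -/

section CoordField

/-- A family of linear maps on a finite-dimensional space is smooth if all its evaluations are. -/
lemma contMDiffAt_of_clm_apply {E H N F G : Type*} [NormedAddCommGroup E] [NormedSpace ℝ E]
    [TopologicalSpace H] {I : ModelWithCorners ℝ E H} [TopologicalSpace N] [ChartedSpace H N]
    [NormedAddCommGroup F] [NormedSpace ℝ F] [FiniteDimensional ℝ F]
    [NormedAddCommGroup G] [NormedSpace ℝ G] {f : N → F →L[ℝ] G} {x : N} {k : ℕ∞ω}
    (h : ∀ a, ContMDiffAt I 𝓘(ℝ, G) k (fun y ↦ f y a) x) :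
    ContMDiffAt I 𝓘(ℝ, F →L[ℝ] G) k f x := by
  let e₁ := ContinuousLinearEquiv.ofFinrankEq
    (Module.finrank_fin_fun ℝ (n := Module.finrank ℝ F)).symm
  let e₂ := (e₁.arrowCongr (1 : G ≃L[ℝ] G)).trans (ContinuousLinearEquiv.piRing (Fin _))
  rw [← Function.id_comp f, ← e₂.symm_comp_self]
  exact e₂.symm.contDiff.contMDiff.contMDiffAt.comp x (contMDiffAt_pi_space.2 fun i ↦ h _)

variable {E : Type*} [NormedAddCommGroup E] [NormedSpace ℝ E]
  {M : Type*} [TopologicalSpace M] [ChartedSpace E M]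
  {F : Type*} [NormedAddCommGroup F] [NormedSpace ℝ F]

/-- The vector field with constant coordinates `a` in the coordinate system `ψ`. -/
def coordField (ψ : M → F) (a : F) : Π x : M, TangentSpace 𝓘(ℝ, E) x :=
  fun x ↦ (mvfderiv 𝓘(ℝ, E) ψ x).inverse a

variable {ψ : M → F} {x : M}

lemma mvfderiv_coordField (hi : (mvfderiv 𝓘(ℝ, E) ψ x).IsInvertible) (a : F) :
    mvfderiv 𝓘(ℝ, E) ψ x (coordField ψ a x) = a := by
  obtain ⟨L, hL⟩ := hi
  rw [coordField, ← hL]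
  simp

lemma eq_coordField (hi : (mvfderiv 𝓘(ℝ, E) ψ x).IsInvertible)
    {ξ : TangentSpace 𝓘(ℝ, E) x} {a : F} (h : mvfderiv 𝓘(ℝ, E) ψ x ξ = a) :
    ξ = coordField ψ a x := by
  obtain ⟨L, hL⟩ := hi
  rw [← h, coordField, ← hL]
  simp

variable [IsManifold 𝓘(ℝ, E) ∞ M] [FiniteDimensional ℝ E]

/-- A coordinate field is the pullback of a constant field along `ψ`. -/
lemma contMDiffAt_coordField [CompleteSpace F] (hψ : ContMDiffAt 𝓘(ℝ, E) 𝓘(ℝ, F) ∞ ψ x)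
    (hi : (mvfderiv 𝓘(ℝ, E) ψ x).IsInvertible) (a : F) :
    ContMDiffAt 𝓘(ℝ, E) 𝓘(ℝ, E).tangent ∞ (T% (coordField ψ a : Π x : M, TangentSpace 𝓘(ℝ, E) x))
      x := by
  have : CompleteSpace E := FiniteDimensional.complete ℝ E
  exact ContMDiffAt.mpullback_vectorField_preimage (n := ∞) (m := ∞)
    (V := fun _ ↦ a) (contMDiffAt_vectorSpace_iff_contDiffAt.2 contDiffAt_const) hψ hi (by simp)

/-- Pullback commutes with the Lie bracket, and constant fields commute. -/
lemma mlieBracket_coordField [CompleteSpace F] (hψ : ContMDiffAt 𝓘(ℝ, E) 𝓘(ℝ, F) ∞ ψ x) (a b : F) :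
    mlieBracket 𝓘(ℝ, E) (coordField ψ a) (coordField ψ b) x = 0 := by
  have : CompleteSpace E := FiniteDimensional.complete ℝ E
  have : IsManifold 𝓘(ℝ, E) (minSmoothness ℝ 3) M := by
    rw [minSmoothness_of_isRCLikeNormedField]
    exact IsManifold.of_le (n := ∞) (by exact WithTop.coe_le_coe.2 (le_top : (3 : ℕ∞) ≤ ⊤))
  have hc : ∀ c : F, MDifferentiableAt 𝓘(ℝ, F) 𝓘(ℝ, F).tangent
      (fun y ↦ (⟨y, c⟩ : TangentBundle 𝓘(ℝ, F) F)) (ψ x) := fun c ↦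
    ContMDiffAt.mdifferentiableAt (n := ∞)
      (contMDiffAt_vectorSpace_iff_contDiffAt.2 contDiffAt_const) (by simp)
  have h0 : mlieBracket 𝓘(ℝ, F) (fun _ : F ↦ a) (fun _ ↦ b) (ψ x) = (0 : F) := by
    refine (congrFun (mlieBracketWithin_univ (I := 𝓘(ℝ, F)) (V := fun _ : F ↦ a)
      (W := fun _ : F ↦ b)) (ψ x)).symm.trans ?_
    refine (congrFun (mlieBracketWithin_eq_lieBracketWithin (V := fun _ : F ↦ a)
      (W := fun _ : F ↦ b)) (ψ x)).trans ?_
    simp [lieBracketWithin]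
    rfl
  have h1 := mpullback_mlieBracket (I := 𝓘(ℝ, E)) (n := ∞) (hc a) (hc b) hψ
    (by rw [minSmoothness_of_isRCLikeNormedField]; exact WithTop.coe_le_coe.2 (le_top : (2 : ℕ∞) ≤ ⊤))
  refine h1.symm.trans ?_
  change (mvfderiv 𝓘(ℝ, E) ψ x).inverse (mlieBracket 𝓘(ℝ, F) (fun _ : F ↦ a) (fun _ ↦ b) (ψ x)) = 0
  exact (congrArg _ h0).trans (map_zero _)

omit [FiniteDimensional ℝ E] in
lemma isInvertible_mvfderiv_extChartAt {y : M} (hy : y ∈ (extChartAt 𝓘(ℝ, E) x).source) :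
    (mvfderiv 𝓘(ℝ, E) (extChartAt 𝓘(ℝ, E) x) y).IsInvertible :=
  isInvertible_mfderiv_extChartAt hy

omit [FiniteDimensional ℝ E] in
lemma contMDiffAt_mvfderiv_apply {X : Π x : M, TangentSpace 𝓘(ℝ, E) x}
    (hψ : ContMDiffAt 𝓘(ℝ, E) 𝓘(ℝ, F) ∞ ψ x)
    (hX : ContMDiffAt 𝓘(ℝ, E) 𝓘(ℝ, E).tangent ∞ (T% X) x) :
    ContMDiffAt 𝓘(ℝ, E) 𝓘(ℝ, F) ∞ (fun y ↦ mvfderiv 𝓘(ℝ, E) ψ y (X y)) x :=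
  hψ.mfderiv_apply_section hX

/-- Read in a chart, the differential becomes a continuous map into the fixed space `E →L[ℝ] F`,
where the invertible maps form an open set. -/
lemma eventually_isInvertible_mvfderiv [CompleteSpace F] (hψ : ContMDiffAt 𝓘(ℝ, E) 𝓘(ℝ, F) ∞ ψ x)
    (hi : (mvfderiv 𝓘(ℝ, E) ψ x).IsInvertible) :
    ∀ᶠ y in 𝓝 x, (mvfderiv 𝓘(ℝ, E) ψ y).IsInvertible := by
  have : CompleteSpace E := FiniteDimensional.complete ℝ E
  let χ := extChartAt 𝓘(ℝ, E) x
  let G : M → E →L[ℝ] F := fun y ↦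
    mvfderiv 𝓘(ℝ, E) ψ y ∘L (mvfderiv 𝓘(ℝ, E) χ y).inverse
  have hχi := isInvertible_mvfderiv_extChartAt (mem_extChartAt_source (I := 𝓘(ℝ, E)) x)
  have hG : ContMDiffAt 𝓘(ℝ, E) 𝓘(ℝ, E →L[ℝ] F) ∞ G x := contMDiffAt_of_clm_apply fun a ↦
    contMDiffAt_mvfderiv_apply hψ (contMDiffAt_coordField contMDiffAt_extChartAt hχi a)
  have hGx : G x ∈ range ((↑) : (E ≃L[ℝ] F) → E →L[ℝ] F) := hi.comp hχi.inverse
  filter_upwards [hG.continuousAt.preimage_mem_nhds (ContinuousLinearEquiv.isOpen.mem_nhds hGx),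
    extChartAt_source_mem_nhds (I := 𝓘(ℝ, E)) x] with y ⟨L, hL⟩ hys
  obtain ⟨K, hK⟩ := isInvertible_mvfderiv_extChartAt hys
  refine ⟨K.trans L, ?_⟩
  ext ξ
  have h1 : mvfderiv 𝓘(ℝ, E) ψ y ((mvfderiv 𝓘(ℝ, E) χ y).inverse (K ξ)) = L (K ξ) :=
    (DFunLike.congr_fun hL (K ξ)).symm
  rw [← hK] at h1
  simpa using h1.symm

end CoordField

/-! ### Smoothness tested by inner products -/

namespace LorentzMetric

variable {E : Type*} [NormedAddCommGroup E] [NormedSpace ℝ E]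
  {M : Type*} [TopologicalSpace M] [ChartedSpace E M] [IsManifold 𝓘(ℝ, E) ∞ M]
  (g : LorentzMetric 𝓘(ℝ, E) M)

lemma contMDiffAt_val {x : M} {X Y : Π x : M, TangentSpace 𝓘(ℝ, E) x}
    (hX : ContMDiffAt 𝓘(ℝ, E) 𝓘(ℝ, E).tangent ∞ (T% X) x)
    (hY : ContMDiffAt 𝓘(ℝ, E) 𝓘(ℝ, E).tangent ∞ (T% Y) x) :
    ContMDiffAt 𝓘(ℝ, E) 𝓘(ℝ, ℝ) ∞ (fun y ↦ g.val y (X y) (Y y)) x := by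
  have h := ContMDiffAt.clm_bundle_apply₂ (F₁ := E) (F₂ := E) (F₃ := ℝ)
    (E₃ := Bundle.Trivial M ℝ) (g.contMDiff x) hX hY
  rw [contMDiffAt_totalSpace] at h
  exact h.2

variable [FiniteDimensional ℝ E]

/-- A vector field is smooth if its inner products with smooth vector fields are. -/
lemma contMDiffAt_of_val {x : M} {W : Π x : M, TangentSpace 𝓘(ℝ, E) x}
    (h : ∀ X : Π x : M, TangentSpace 𝓘(ℝ, E) x,
      ContMDiffAt 𝓘(ℝ, E) 𝓘(ℝ, E).tangent ∞ (T% X) x →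
      ContMDiffAt 𝓘(ℝ, E) 𝓘(ℝ, ℝ) ∞ (fun y ↦ g.val y (W y) (X y)) x) :
    ContMDiffAt 𝓘(ℝ, E) 𝓘(ℝ, E).tangent ∞ (T% W) x := by
  have : CompleteSpace E := FiniteDimensional.complete ℝ E
  let χ : M → E := extChartAt 𝓘(ℝ, E) x
  have hχi : ∀ y ∈ (extChartAt 𝓘(ℝ, E) x).source, (mvfderiv 𝓘(ℝ, E) χ y).IsInvertible :=
    fun y hy ↦ isInvertible_mvfderiv_extChartAt hy
  have hx := mem_extChartAt_source (I := 𝓘(ℝ, E)) x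
  have hXs : ∀ a, ContMDiffAt 𝓘(ℝ, E) 𝓘(ℝ, E).tangent ∞
      (T% (coordField χ a : Π x : M, TangentSpace 𝓘(ℝ, E) x)) x :=
    contMDiffAt_coordField contMDiffAt_extChartAt (hχi x hx)
  -- In chart coordinates `T` is the Gram form of the metric and `l` the covector `g(W, ·)`. The
  -- coordinates of `W` are `T⁻¹ l`, smooth because inversion of linear maps is.
  let B : M → E →L[ℝ] E := fun y ↦ (mvfderiv 𝓘(ℝ, E) χ y).inverse
  let G : M → E →L[ℝ] E →L[ℝ] ℝ := fun y ↦ g.val y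
  let T : M → E →L[ℝ] E →L[ℝ] ℝ := fun y ↦ (G y).bilinearComp (B y) (B y)
  let l : M → E →L[ℝ] ℝ := fun y ↦ (G y (W y)) ∘L B y
  have hT : ContMDiffAt 𝓘(ℝ, E) 𝓘(ℝ, E →L[ℝ] E →L[ℝ] ℝ) ∞ T x :=
    contMDiffAt_of_clm_apply fun a ↦ contMDiffAt_of_clm_apply fun b ↦
      g.contMDiffAt_val (hXs a) (hXs b)
  have hl : ContMDiffAt 𝓘(ℝ, E) 𝓘(ℝ, E →L[ℝ] ℝ) ∞ l x :=
    contMDiffAt_of_clm_apply fun a ↦ h _ (hXs a)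
  have hTinj : ∀ y ∈ (extChartAt 𝓘(ℝ, E) x).source, ∀ a, T y a = 0 → a = 0 := by
    intro y hy a ha
    have h1 : B y a = 0 := g.eq_zero_of_val_eq_zero fun b ↦ by
      have h2 := DFunLike.congr_fun ha (mvfderiv 𝓘(ℝ, E) χ y b)
      rw [eq_coordField (hχi y hy) (rfl : mvfderiv 𝓘(ℝ, E) χ y b = _)]
      exact h2
    have h2 := mvfderiv_coordField (hχi y hy) a
    exact h2.symm.trans ((congrArg (mvfderiv 𝓘(ℝ, E) χ y) h1).trans (map_zero _))
  have hTi : ∀ y ∈ (extChartAt 𝓘(ℝ, E) x).source, (T y).IsInvertible := by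
    intro y hy
    let L := LinearEquiv.ofInjectiveOfFinrankEq (T y).toLinearMap
      (by
        rw [← LinearMap.ker_eq_bot, LinearMap.ker_eq_bot']
        exact hTinj y hy)
      (by
        rw [← (LinearMap.toContinuousLinearMap (𝕜 := ℝ) (E := E) (F' := ℝ)).finrank_eq]
        exact (Subspace.dual_finrank_eq (K := ℝ) (V := E)).symm)
    exact ⟨L.toContinuousLinearEquiv, by ext; rfl⟩
  let c : M → E := fun y ↦ (T y).inverse (l y)
  have hc : ContMDiffAt 𝓘(ℝ, E) 𝓘(ℝ, E) ∞ c x :=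
    (((hTi x hx).contDiffAt_map_inverse (n := ∞)).contMDiffAt.comp x hT).clm_apply hl
  let b := Module.finBasis ℝ E
  have hWc : ∀ y ∈ (extChartAt 𝓘(ℝ, E) x).source,
      W y = ∑ i, (b.coord i (c y)) • coordField χ (b i) y := by
    intro y hy
    have h1 : T y (mvfderiv 𝓘(ℝ, E) χ y (W y)) = l y := by
      ext a
      change g.val y (B y (mvfderiv 𝓘(ℝ, E) χ y (W y))) (B y a) = g.val y (W y) (B y a)
      rw [show B y (mvfderiv 𝓘(ℝ, E) χ y (W y)) = W y from (eq_coordField (hχi y hy) rfl).symm]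
    have h2 : c y = mvfderiv 𝓘(ℝ, E) χ y (W y) := by
      obtain ⟨L, hL⟩ := hTi y hy
      change (T y).inverse (l y) = _
      rw [← h1, ← hL]
      simp
    have h3 : W y = B y (c y) := by
      rw [h2]
      exact eq_coordField (hχi y hy) rfl
    refine h3.trans ((congrArg (B y) (b.sum_repr (c y)).symm).trans ((map_sum _ _ _).trans ?_))
    exact Finset.sum_congr rfl fun i _ ↦ map_smul (B y) _ _
  have hb : ∀ i, ContMDiffAt 𝓘(ℝ, E) 𝓘(ℝ, ℝ) ∞ (fun y ↦ b.coord i (c y)) x := fun i ↦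
    (LinearMap.toContinuousLinearMap (b.coord i)).contDiff.contMDiff.contMDiffAt.comp x hc
  refine (ContMDiffAt.sum_section (s := Finset.univ)
    fun i _ ↦ (hb i).smul_section (hXs (b i))).congr_of_eventuallyEq ?_
  filter_upwards [extChartAt_source_mem_nhds (I := 𝓘(ℝ, E)) x] with y hy
  exact congrArg (TotalSpace.mk' E y) (hWc y hy)

end LorentzMetric

/-! ### Smooth families of bilinear forms -/

section HomBundle

variable {E : Type*} [NormedAddCommGroup E] [NormedSpace ℝ E] [FiniteDimensional ℝ E]
  {Q : Type*} [TopologicalSpace Q] [ChartedSpace E Q] [IsManifold 𝓘(ℝ, E) ∞ Q]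
  {F H N : Type*} [NormedAddCommGroup F] [NormedSpace ℝ F]
  [TopologicalSpace H] {J : ModelWithCorners ℝ F H} [TopologicalSpace N] [ChartedSpace H N]

omit [FiniteDimensional ℝ E] in
lemma contMDiffAt_trivializationAt_symm (q : Q) (a : E) :
    ContMDiffAt 𝓘(ℝ, E) 𝓘(ℝ, E).tangent ∞
      (fun y ↦ (⟨y, (trivializationAt E (TangentSpace 𝓘(ℝ, E)) q).symm y a⟩ :
        TangentBundle 𝓘(ℝ, E) Q)) q := by
  let e := trivializationAt E (TangentSpace 𝓘(ℝ, E) : Q → Type _) q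
  have hq : q ∈ e.baseSet := FiberBundle.mem_baseSet_trivializationAt' q
  refine ContMDiffOn.contMDiffAt (s := e.baseSet) ?_ (e.open_baseSet.mem_nhds hq)
  rw [e.contMDiffOn_section_baseSet_iff]
  refine (contMDiffOn_const (c := a)).congr fun y hy ↦ ?_
  rw [e.apply_mk_symm hy]

/-- A family of bilinear forms on tangent spaces is smooth if its values on smooth vector fields
are. -/
lemma contMDiffAt_hom_bundle_of_sections {b : N → Q} {x₀ : N}
    {ϕ : Π x, TangentSpace 𝓘(ℝ, E) (b x) →L[ℝ] TangentSpace 𝓘(ℝ, E) (b x) →L[ℝ] ℝ}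
    (hb : ContMDiffAt J 𝓘(ℝ, E) ∞ b x₀)
    (h : ∀ Y Z : Π q : Q, TangentSpace 𝓘(ℝ, E) q,
      ContMDiffAt 𝓘(ℝ, E) 𝓘(ℝ, E).tangent ∞ (T% Y) (b x₀) →
      ContMDiffAt 𝓘(ℝ, E) 𝓘(ℝ, E).tangent ∞ (T% Z) (b x₀) →
      ContMDiffAt J 𝓘(ℝ, ℝ) ∞ (fun x ↦ ϕ x (Y (b x)) (Z (b x))) x₀) :
    ContMDiffAt J (𝓘(ℝ, E).prod 𝓘(ℝ, E →L[ℝ] E →L[ℝ] ℝ)) ∞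
      (fun x ↦ TotalSpace.mk' (E →L[ℝ] E →L[ℝ] ℝ)
        (E := fun q : Q ↦ TangentSpace 𝓘(ℝ, E) q →L[ℝ] TangentSpace 𝓘(ℝ, E) q →L[ℝ] ℝ)
        (b x) (ϕ x)) x₀ := by
  refine (contMDiffAt_hom_bundle _).2 ⟨hb, ?_⟩
  refine contMDiffAt_of_clm_apply fun a ↦ contMDiffAt_of_clm_apply fun c ↦ ?_
  refine (h _ _ (contMDiffAt_trivializationAt_symm (b x₀) a)
    (contMDiffAt_trivializationAt_symm (b x₀) c)).congr_of_eventuallyEq ?_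
  let e := trivializationAt E (TangentSpace 𝓘(ℝ, E) : Q → Type _) (b x₀)
  have hq : b x₀ ∈ e.baseSet := FiberBundle.mem_baseSet_trivializationAt' (b x₀)
  filter_upwards [hb.continuousAt.preimage_mem_nhds (e.open_baseSet.mem_nhds hq)] with x hx
  have hx' : b x ∈ (trivializationAt E (fun q : Q ↦ TangentSpace 𝓘(ℝ, E) q) (b x₀)).baseSet := hx
  rw [inCoordinates_apply_eq₂ hx' hx' (mem_univ _)]
  exact DFunLike.congr_fun (Bundle.Trivial.linearMapAt_trivialization ℝ Q ℝ (b x)) _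

end HomBundle

/-! ### Gradients, and metric coefficients along a parallel coordinate field -/

namespace LorentzMetric

variable {E : Type*} [NormedAddCommGroup E] [NormedSpace ℝ E] [FiniteDimensional ℝ E]
  {M : Type*} [TopologicalSpace M] [ChartedSpace E M] [IsManifold 𝓘(ℝ, E) ∞ M]
  (g : LorentzMetric 𝓘(ℝ, E) M)

/-- The gradient of a function. -/
def gradient (f : M → ℝ) (x : M) : TangentSpace 𝓘(ℝ, E) x :=
  (g.flat x).symm (mvfderiv 𝓘(ℝ, E) f x)

lemma val_gradient (f : M → ℝ) (x : M) (ξ : TangentSpace 𝓘(ℝ, E) x) :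
    g.val x (g.gradient f x) ξ = mvfderiv 𝓘(ℝ, E) f x ξ := by
  rw [← g.flat_apply, gradient, LinearEquiv.apply_symm_apply]

lemma contMDiff_gradient {f : M → ℝ} (hf : ContMDiff 𝓘(ℝ, E) 𝓘(ℝ, ℝ) ∞ f) :
    ContMDiff 𝓘(ℝ, E) 𝓘(ℝ, E).tangent ∞ (T% (g.gradient f)) := fun x ↦
  g.contMDiffAt_of_val fun X hX ↦ by
    simp only [val_gradient]
    exact contMDiffAt_mvfderiv_apply (hf x) hX

/-- If `∂_e` is parallel, then the coefficients of the metric do not depend on this coordinate. -/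
lemma mvfderiv_val_coordField {F : Type*} [NormedAddCommGroup F] [NormedSpace ℝ F]
    [CompleteSpace F] {ψ : M → F} {x : M} (hψ : ContMDiffAt 𝓘(ℝ, E) 𝓘(ℝ, F) ∞ ψ x)
    (hi : (mvfderiv 𝓘(ℝ, E) ψ x).IsInvertible) {V : Π x : M, TangentSpace 𝓘(ℝ, E) x} {e : F}
    (hV : ContMDiffAt 𝓘(ℝ, E) 𝓘(ℝ, E).tangent ∞ (T% V) x)
    (hVψ : ∀ᶠ y in 𝓝 x, mvfderiv 𝓘(ℝ, E) ψ y (V y) = e) (hVp : g.leviCivita V x = 0) (a b : F) :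
    mvfderiv 𝓘(ℝ, E) (fun y ↦ g.val y (coordField ψ a y) (coordField ψ b y)) x (V x) = 0 := by
  have hd : ∀ c, MDiffAt (T% (coordField ψ c : Π x : M, TangentSpace 𝓘(ℝ, E) x)) x := fun c ↦
    (contMDiffAt_coordField hψ hi c).mdifferentiableAt (by simp)
  have hVd : MDiffAt (T% V) x := hV.mdifferentiableAt (by simp)
  have hVe : V =ᶠ[𝓝 x] coordField ψ e := by
    filter_upwards [hVψ, eventually_isInvertible_mvfderiv hψ hi] with y hy hyi
    exact eq_coordField hyi hy
  -- Vanishing torsion gives `∇_V ∂_c = ∇_{∂_c} V + [V, ∂_c]`, and both terms on the right are zero.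
  have h0 : ∀ c, g.leviCivita (coordField ψ c) x (V x) = 0 := by
    intro c
    have h1 := (g.leviCivita.torsion_eq_zero_iff.1 g.leviCivita_torsion) hVd (hd c)
    rw [hVp] at h1
    simpa using h1.trans ((Filter.EventuallyEq.mlieBracket_vectorField_eq hVe
      Filter.EventuallyEq.rfl).trans (mlieBracket_coordField hψ e c))
  rw [g.leviCivita_metric hVd (hd a) (hd b), h0, h0]
  simp

end LorentzMetric

/-! ### Global flows, isometries and time functions -/

section GlobalFlow

variable {E : Type*} [NormedAddCommGroup E] [NormedSpace ℝ E]
  {M : Type*} [TopologicalSpace M] [ChartedSpace E M]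

lemma ContinuousLinearMap.isInvertible_of_surjective [FiniteDimensional ℝ E] {A : E →L[ℝ] E}
    (hA : Function.Surjective A) : A.IsInvertible :=
  ⟨(LinearEquiv.ofBijective (A : E →ₗ[ℝ] E)
    ⟨LinearMap.injective_iff_surjective.2 hA, hA⟩).toContinuousLinearEquiv, by ext; rfl⟩

lemma HasMFDerivAt.hasDerivAt_comp_curve {F : Type*} [NormedAddCommGroup F] [NormedSpace ℝ F]
    {γ : ℝ → M} {t : ℝ} {ξ : TangentSpace 𝓘(ℝ, E) (γ t)}
    (hγ : HasMFDerivAt 𝓘(ℝ, ℝ) 𝓘(ℝ, E) γ t ((1 : ℝ →L[ℝ] ℝ).smulRight ξ)) {f : M → F}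
    (hf : MDifferentiableAt 𝓘(ℝ, E) 𝓘(ℝ, F) f (γ t)) :
    HasDerivAt (fun τ ↦ f (γ τ)) (mvfderiv 𝓘(ℝ, E) f (γ t) ξ) t := by
  have h := HasMFDerivAt.comp t hf.hasMFDerivAt hγ
  have e : mfderiv 𝓘(ℝ, E) 𝓘(ℝ, F) f (γ t) ∘L (1 : ℝ →L[ℝ] ℝ).smulRight ξ =
      (1 : ℝ →L[ℝ] ℝ).smulRight (mvfderiv 𝓘(ℝ, E) f (γ t) ξ) := by
    ext
    change mfderiv 𝓘(ℝ, E) 𝓘(ℝ, F) f (γ t) ((1 : ℝ) • ξ) = (1 : ℝ) • mvfderiv 𝓘(ℝ, E) f (γ t) ξ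
    rw [one_smul, one_smul (M := ℝ) (mvfderiv 𝓘(ℝ, E) f (γ t) ξ)]
    rfl
  have h' : HasFDerivAt (fun τ ↦ f (γ τ))
      ((1 : ℝ →L[ℝ] ℝ).smulRight (mvfderiv 𝓘(ℝ, E) f (γ t) ξ)) t :=
    hasMFDerivAt_iff_hasFDerivAt.1 (e ▸ h)
  simpa using h'.hasDerivAt

lemma IsMIntegralCurveOn.hasMFDerivAt_of_isOpen {X : Π x : M, TangentSpace 𝓘(ℝ, E) x} {γ : ℝ → M}
    {O : Set ℝ} (hγ : IsMIntegralCurveOn γ X O) (hO : IsOpen O) {t : ℝ} (ht : t ∈ O) :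
    HasMFDerivAt 𝓘(ℝ, ℝ) 𝓘(ℝ, E) γ t ((1 : ℝ →L[ℝ] ℝ).smulRight (X (γ t))) :=
  (hγ t ht).hasMFDerivAt (hO.mem_nhds ht)

/-- The derivative of a time-dependent map, in terms of the partial derivatives. -/
lemma mfderiv_prod_apply_of_curve {E' N : Type*} [NormedAddCommGroup E'] [NormedSpace ℝ E']
    {H' : Type*} [TopologicalSpace H'] {I' : ModelWithCorners ℝ E' H'}
    [TopologicalSpace N] [ChartedSpace H' N] {φ : ℝ × N → M} {p : ℝ × N}
    (hφ : MDifferentiableAt (𝓘(ℝ, ℝ).prod I') 𝓘(ℝ, E) φ p)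
    {ξ : TangentSpace 𝓘(ℝ, E) (φ p)} (hξ : HasMFDerivAt 𝓘(ℝ, ℝ) 𝓘(ℝ, E) (fun t ↦ φ (t, p.2)) p.1
      ((1 : ℝ →L[ℝ] ℝ).smulRight ξ)) (r : ℝ) (η : TangentSpace I' p.2) :
    mfderiv (𝓘(ℝ, ℝ).prod I') 𝓘(ℝ, E) φ p (r, η) =
      r • ξ + mfderiv I' 𝓘(ℝ, E) (fun x ↦ φ (p.1, x)) p.2 η := by
  refine (mfderiv_prod_eq_add_apply hφ).trans ?_
  rw [hξ.mfderiv]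
  rfl

lemma mvfderiv_comp_mfderiv_apply {E' N F : Type*} [NormedAddCommGroup E'] [NormedSpace ℝ E']
    {H' : Type*} [TopologicalSpace H'] {I' : ModelWithCorners ℝ E' H'}
    [TopologicalSpace N] [ChartedSpace H' N] [NormedAddCommGroup F] [NormedSpace ℝ F]
    {f : M → F} {h : N → M} {x : N} (hf : MDifferentiableAt 𝓘(ℝ, E) 𝓘(ℝ, F) f (h x))
    (hh : MDifferentiableAt I' 𝓘(ℝ, E) h x) (ξ : TangentSpace I' x) :
    mvfderiv I' (fun y ↦ f (h y)) x ξ = mvfderiv 𝓘(ℝ, E) f (h x) (mfderiv I' 𝓘(ℝ, E) h x ξ) :=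
  mfderiv_comp_apply x hf hh ξ

lemma mvfderiv_prodMk_apply {F F' : Type*} [NormedAddCommGroup F] [NormedSpace ℝ F]
    [NormedAddCommGroup F'] [NormedSpace ℝ F'] {f : M → F} {h : M → F'} {x : M}
    (hf : MDifferentiableAt 𝓘(ℝ, E) 𝓘(ℝ, F) f x) (hh : MDifferentiableAt 𝓘(ℝ, E) 𝓘(ℝ, F') h x)
    (ξ : TangentSpace 𝓘(ℝ, E) x) :
    mvfderiv 𝓘(ℝ, E) (fun x ↦ (f x, h x)) x ξ = (mvfderiv 𝓘(ℝ, E) f x ξ, mvfderiv 𝓘(ℝ, E) h x ξ) := by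
  have h1 := hf.prodMk_space hh
  refine Prod.ext ?_ ?_
  · refine ((mvfderiv_comp_mfderiv_apply (f := (Prod.fst : F × F' → F))
      (ContinuousLinearMap.fst ℝ F F').differentiableAt.mdifferentiableAt h1 ξ).trans ?_).symm
    exact DFunLike.congr_fun ((mfderiv_eq_fderiv (f := (Prod.fst : F × F' → F))).trans
      (ContinuousLinearMap.fst ℝ F F').fderiv) _
  · refine ((mvfderiv_comp_mfderiv_apply (f := (Prod.snd : F × F' → F'))
      (ContinuousLinearMap.snd ℝ F F').differentiableAt.mdifferentiableAt h1 ξ).trans ?_).symm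
    exact DFunLike.congr_fun ((mfderiv_eq_fderiv (f := (Prod.snd : F × F' → F'))).trans
      (ContinuousLinearMap.snd ℝ F F').fderiv) _

variable [IsManifold 𝓘(ℝ, E) ∞ M]

/-- `φ` is the global flow of the vector field `X`. -/
structure IsGlobalFlow (X : Π x : M, TangentSpace 𝓘(ℝ, E) x) (φ : ℝ × M → M) : Prop where
  zero (x : M) : φ (0, x) = x
  curve (x : M) : IsMIntegralCurve (I := 𝓘(ℝ, E)) (fun t ↦ φ (t, x)) X

omit [IsManifold 𝓘(ℝ, E) ∞ M] in
lemma IsCompleteVectorField.exists_isGlobalFlow {X : Π x : M, TangentSpace 𝓘(ℝ, E) x}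
    (h : IsCompleteVectorField X) : ∃ φ : ℝ × M → M, IsGlobalFlow X φ := by
  choose γ h0 h using h
  exact ⟨fun p ↦ γ p.2 p.1, h0, h⟩

namespace IsGlobalFlow

variable {X : Π x : M, TangentSpace 𝓘(ℝ, E) x} {φ : ℝ × M → M} (hφ : IsGlobalFlow X φ)

include hφ

omit [IsManifold 𝓘(ℝ, E) ∞ M] in
lemma hasDerivAt_comp {F : Type*} [NormedAddCommGroup F] [NormedSpace ℝ F] {f : M → F} {t : ℝ}
    {x : M} (hf : MDifferentiableAt 𝓘(ℝ, E) 𝓘(ℝ, F) f (φ (t, x))) :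
    HasDerivAt (fun τ ↦ f (φ (τ, x))) (mvfderiv 𝓘(ℝ, E) f (φ (t, x)) (X (φ (t, x)))) t :=
  HasMFDerivAt.hasDerivAt_comp_curve (hφ.curve x t) hf

variable [FiniteDimensional ℝ E] [T2Space M] (hX : ContMDiff 𝓘(ℝ, E) 𝓘(ℝ, E).tangent ∞ (T% X))

include hX

lemma contMDiff : ContMDiff (𝓘(ℝ, ℝ).prod 𝓘(ℝ, E)) 𝓘(ℝ, E) ∞ φ := by
  rw [← contMDiffOn_univ]
  refine contMDiffOn_flow hX isOpen_univ (by simp) (fun x ↦ ?_) (fun x _ ↦ hφ.zero x)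
    fun x ↦ (hφ.curve x).isMIntegralCurveOn _
  simpa using ordConnected_univ

omit [FiniteDimensional ℝ E] in
lemma eq_of_curve {γ : ℝ → M} (hγ : IsMIntegralCurve (I := 𝓘(ℝ, E)) γ X) (t : ℝ) :
    γ t = φ (t, γ 0) :=
  IsMIntegralCurveOn.eq_of_ordConnected hX isOpen_univ ordConnected_univ
    (hγ.isMIntegralCurveOn _) ((hφ.curve _).isMIntegralCurveOn _) (mem_univ 0) (mem_univ t)
    (hφ.zero _).symm

omit [FiniteDimensional ℝ E] in
lemma add (t τ : ℝ) (x : M) : φ (t, φ (τ, x)) = φ (t + τ, x) :=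
  by simpa using (hφ.eq_of_curve hX ((hφ.curve x).comp_add τ) t).symm

lemma contMDiff_slice (t : ℝ) : ContMDiff 𝓘(ℝ, E) 𝓘(ℝ, E) ∞ fun x ↦ φ (t, x) :=
  (hφ.contMDiff hX).comp (contMDiff_const.prodMk contMDiff_id)

lemma mfderiv_apply (t : ℝ) (x : M) (r : ℝ) (ξ : TangentSpace 𝓘(ℝ, E) x) :
    mfderiv (𝓘(ℝ, ℝ).prod 𝓘(ℝ, E)) 𝓘(ℝ, E) φ (t, x) (r, ξ) =
      r • X (φ (t, x)) + mfderiv 𝓘(ℝ, E) 𝓘(ℝ, E) (fun x ↦ φ (t, x)) x ξ :=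
  mfderiv_prod_apply_of_curve (p := (t, x)) ((hφ.contMDiff hX).mdifferentiable (by simp) _)
    (hφ.curve x t) r ξ

/-- The chain rule for flowing by a time that depends on the point, applied below to retractions
such as `y ↦ φ (-v y, y)` onto a level set of `v`. -/
lemma mvfderiv_comp_apply {F : Type*} [NormedAddCommGroup F] [NormedSpace ℝ F] {f : M → F}
    {τ : M → ℝ} {x : M} (hf : MDifferentiableAt 𝓘(ℝ, E) 𝓘(ℝ, F) f (φ (τ x, x)))
    (hτ : MDifferentiableAt 𝓘(ℝ, E) 𝓘(ℝ, ℝ) τ x) (ξ : TangentSpace 𝓘(ℝ, E) x) :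
    mvfderiv 𝓘(ℝ, E) (fun y ↦ f (φ (τ y, y))) x ξ =
      mvfderiv 𝓘(ℝ, E) τ x ξ • mvfderiv 𝓘(ℝ, E) f (φ (τ x, x)) (X (φ (τ x, x))) +
        mvfderiv 𝓘(ℝ, E) (fun y ↦ f (φ (τ x, y))) x ξ := by
  have hd : MDifferentiableAt (𝓘(ℝ, ℝ).prod 𝓘(ℝ, E)) 𝓘(ℝ, E) φ (τ x, x) :=
    (hφ.contMDiff hX).mdifferentiable (by simp) _
  let p : M → ℝ × M := fun y ↦ (τ y, y)
  have hp : MDifferentiableAt 𝓘(ℝ, E) (𝓘(ℝ, ℝ).prod 𝓘(ℝ, E)) p x :=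
    hτ.prodMk mdifferentiableAt_id
  have h1 : mfderiv 𝓘(ℝ, E) 𝓘(ℝ, E) (fun y ↦ φ (τ y, y)) x ξ =
      mfderiv (𝓘(ℝ, ℝ).prod 𝓘(ℝ, E)) 𝓘(ℝ, E) φ (τ x, x) (mvfderiv 𝓘(ℝ, E) τ x ξ, ξ) := by
    refine (mfderiv_comp_apply (g := φ) (f := p) x hd hp ξ).trans ?_
    have h2 : mfderiv 𝓘(ℝ, E) (𝓘(ℝ, ℝ).prod 𝓘(ℝ, E)) p x = (mvfderiv 𝓘(ℝ, E) τ x).prod (.id ℝ _) :=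
      (hτ.mfderiv_prod mdifferentiableAt_id).trans (by rw [mfderiv_id]; rfl)
    rw [h2]
    rfl
  rw [mvfderiv_comp_mfderiv_apply (h := fun y ↦ φ (τ y, y)) hf
    (MDifferentiableAt.comp (f := p) (g := φ) x hd hp), h1,
    hφ.mfderiv_apply hX, map_add, map_smul, mvfderiv_comp_mfderiv_apply (h := fun y ↦ φ (τ x, y)) hf
      ((hφ.contMDiff_slice hX _).mdifferentiable (by simp) x)]

/-- The flow of a parallel vector field with a global time function consists of isometries. -/
theorem val_mfderiv_mfderiv (g : LorentzMetric 𝓘(ℝ, E) M) (hXp : g.IsParallel X) {v : M → ℝ}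
    (hv : ContMDiff 𝓘(ℝ, E) 𝓘(ℝ, ℝ) ∞ v) (hvφ : ∀ t x, v (φ (t, x)) = v x + t) (t : ℝ) (x : M)
    (ξ η : TangentSpace 𝓘(ℝ, E) x) :
    g.val (φ (t, x)) (mfderiv 𝓘(ℝ, E) 𝓘(ℝ, E) (fun x ↦ φ (t, x)) x ξ)
      (mfderiv 𝓘(ℝ, E) 𝓘(ℝ, E) (fun x ↦ φ (t, x)) x η) = g.val x ξ η := by
  have : CompleteSpace E := FiniteDimensional.complete ℝ E
  let χ : M → E := extChartAt 𝓘(ℝ, E) x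
  let e : E := mvfderiv 𝓘(ℝ, E) χ x (X x)
  -- `κ` retracts along the flow onto the level set of `v` through `x`. Thus `ψ` extends coordinates
  -- at `x` along the entire flow line, with `ψ ∘ φ_t = ψ + t e`; in these coordinates `X` is the
  -- constant field `e`.
  let κ : M → M := fun y ↦ φ (v x - v y, y)
  let ψ : M → E := fun y ↦ (v y - v x) • e + χ (κ y)
  have hκ : ContMDiff 𝓘(ℝ, E) 𝓘(ℝ, E) ∞ κ :=
    (hφ.contMDiff hX).comp ((contMDiff_const.sub hv).prodMk contMDiff_id)
  have hκx : κ x = x := by simp [κ, hφ.zero]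
  have hκφ : ∀ t y, κ (φ (t, y)) = κ y := fun t y ↦ by
    simp only [κ, hφ.add hX, hvφ]
    congr 2; ring
  have hψφ : ∀ t y, ψ (φ (t, y)) = ψ y + t • e := fun t y ↦ by
    simp only [ψ, hκφ, hvφ]
    module
  let U : Set M := κ ⁻¹' (extChartAt 𝓘(ℝ, E) x).source
  have hU : IsOpen U := (isOpen_extChartAt_source x).preimage hκ.continuous
  have hxU : ∀ t, φ (t, x) ∈ U := fun t ↦ by
    change κ (φ (t, x)) ∈ (extChartAt 𝓘(ℝ, E) x).source
    rw [hκφ, hκx]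
    exact mem_extChartAt_source x
  have hχ : ∀ y ∈ (extChartAt 𝓘(ℝ, E) x).source, ContMDiffAt 𝓘(ℝ, E) 𝓘(ℝ, E) ∞ χ y := fun y hy ↦
    contMDiffAt_extChartAt' (by rwa [extChartAt_source] at hy)
  have hψ : ∀ y ∈ U, ContMDiffAt 𝓘(ℝ, E) 𝓘(ℝ, E) ∞ ψ y := fun y hy ↦
    (((hv y).sub contMDiffAt_const).smul contMDiffAt_const).add ((hχ _ hy).comp y (hκ y))
  have hψX : ∀ y ∈ U, mvfderiv 𝓘(ℝ, E) ψ y (X y) = e := by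
    intro y hy
    have h0 := hφ.zero y
    have h1 := hφ.hasDerivAt_comp (f := ψ) (t := 0) (x := y)
      (by rw [h0]; exact (hψ y hy).mdifferentiableAt (by simp))
    simp only [hψφ] at h1
    have h2 : HasDerivAt (fun t : ℝ ↦ ψ y + t • e) e 0 := by
      simpa using ((hasDerivAt_id (0 : ℝ)).smul_const e).const_add (ψ y)
    have h3 := h1.unique h2
    rwa [h0] at h3
  have hψd : ∀ t, MDifferentiableAt 𝓘(ℝ, E) 𝓘(ℝ, E) ψ (φ (t, x)) := fun t ↦
    (hψ _ (hxU t)).mdifferentiableAt (by simp)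
  have hφd : ∀ t, MDifferentiableAt 𝓘(ℝ, E) 𝓘(ℝ, E) (fun x ↦ φ (t, x)) x := fun t ↦
    (hφ.contMDiff_slice hX t).mdifferentiable (by simp) x
  have hchain : ∀ t (ζ : TangentSpace 𝓘(ℝ, E) x), mvfderiv 𝓘(ℝ, E) ψ (φ (t, x))
      (mfderiv 𝓘(ℝ, E) 𝓘(ℝ, E) (fun x ↦ φ (t, x)) x ζ) = mvfderiv 𝓘(ℝ, E) ψ x ζ := by
    intro t ζ
    have h1 : (fun y ↦ ψ (φ (t, y))) = ψ + fun _ ↦ t • e := funext fun y ↦ hψφ t y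
    rw [← mvfderiv_comp_mfderiv_apply (h := fun y ↦ φ (t, y)) (hψd t) (hφd t) ζ, h1, mvfderiv_add (by simpa [hφ.zero] using hψd 0) mdifferentiableAt_const, mvfderiv_const]
    simp
  have hχd := (hχ x (mem_extChartAt_source x)).mdifferentiableAt (by simp)
  have hvd := hv.mdifferentiable (by simp) x
  -- At `x` one has `dκ(ζ) = ζ - dv(ζ) X`, and the term `(v - v x) e` of `ψ`, with `e = dχ(X)`,
  -- restores what is lost.
  have hψx : mvfderiv 𝓘(ℝ, E) ψ x = mvfderiv 𝓘(ℝ, E) χ x := by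
    ext ζ
    have h0 : φ (v x - v x, x) = x := by simp [hφ.zero]
    have h1 := hφ.mvfderiv_comp_apply hX (f := χ) (τ := fun y ↦ v x - v y) (x := x)
      (by rw [h0]; exact hχd) (mdifferentiableAt_const.sub hvd) ζ
    have h2 : (fun y ↦ χ (φ (v x - v x, y))) = χ := by ext y; simp [hφ.zero]
    have h3 : mvfderiv 𝓘(ℝ, E) (fun y ↦ v x - v y) x = - mvfderiv 𝓘(ℝ, E) v x := by
      have := mvfderiv_sub (g := fun _ ↦ v x) (g' := v) (x := x) mdifferentiableAt_const hvd
      rw [mvfderiv_const, zero_sub] at this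
      exact this
    rw [h0, h2, h3] at h1
    have hχκ : MDifferentiableAt 𝓘(ℝ, E) 𝓘(ℝ, E) (fun y ↦ χ (κ y)) x :=
      MDifferentiableAt.comp (g := χ) x (by rw [hκx]; exact hχd) (hκ.mdifferentiable (by simp) x)
    have hv1 : MDifferentiableAt 𝓘(ℝ, E) 𝓘(ℝ, ℝ) (fun y ↦ v y - v x) x :=
      hvd.sub mdifferentiableAt_const
    have h4 : mvfderiv 𝓘(ℝ, E) ψ x = _ :=
      mvfderiv_add (g := (fun y ↦ v y - v x) • fun _ ↦ e) (g' := fun y ↦ χ (κ y)) (x := x)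
        (hv1.smul mdifferentiableAt_const) hχκ
    have h5 : mvfderiv 𝓘(ℝ, E) (fun y ↦ v y - v x) x = mvfderiv 𝓘(ℝ, E) v x := by
      have := mvfderiv_sub (g := v) (g' := fun _ ↦ v x) (x := x) hvd mdifferentiableAt_const
      rw [mvfderiv_const, sub_zero] at this
      exact this
    rw [h4, mvfderiv_smul hv1 mdifferentiableAt_const, mvfderiv_const, h5]
    have h6 : mvfderiv 𝓘(ℝ, E) (fun y ↦ χ (κ y)) x ζ = _ := h1
    rw [add_apply, h6]
    simp [e]
  -- Since `dψ ∘ dφ_t = dψ_x` is onto, `dψ` is onto at `φ (t, x)`, and a surjective endomorphism of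
  -- `E` is invertible.
  have hψi : ∀ t, (mvfderiv 𝓘(ℝ, E) ψ (φ (t, x))).IsInvertible := by
    intro t
    obtain ⟨L, hL⟩ := isInvertible_mvfderiv_extChartAt (mem_extChartAt_source (I := 𝓘(ℝ, E)) x)
    refine ContinuousLinearMap.isInvertible_of_surjective (E := E) fun a ↦
      ⟨mfderiv 𝓘(ℝ, E) 𝓘(ℝ, E) (fun x ↦ φ (t, x)) x (L.symm a), (hchain t _).trans ?_⟩
    rw [hψx, ← hL, ContinuousLinearEquiv.coe_coe, L.apply_symm_apply]
  have hX' : ∀ t (ζ : TangentSpace 𝓘(ℝ, E) x), mfderiv 𝓘(ℝ, E) 𝓘(ℝ, E) (fun x ↦ φ (t, x)) x ζ =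
      coordField ψ (mvfderiv 𝓘(ℝ, E) ψ x ζ) (φ (t, x)) := fun t ζ ↦
    eq_coordField (hψi t) (hchain t ζ)
  -- As `dφ_t` carries coordinate vectors to coordinate vectors, `k` is a metric coefficient along
  -- the flow line. Its derivative vanishes because `X` is a parallel coordinate field.
  let k : ℝ → ℝ := fun t ↦ g.val (φ (t, x)) (mfderiv 𝓘(ℝ, E) 𝓘(ℝ, E) (fun x ↦ φ (t, x)) x ξ)
      (mfderiv 𝓘(ℝ, E) 𝓘(ℝ, E) (fun x ↦ φ (t, x)) x η)
  have hk : ∀ t, HasDerivAt k 0 t := by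
    intro t
    have hs : ∀ a, ContMDiffAt 𝓘(ℝ, E) 𝓘(ℝ, E).tangent ∞
        (T% (coordField ψ a : Π x : M, TangentSpace 𝓘(ℝ, E) x)) (φ (t, x)) :=
      contMDiffAt_coordField (hψ _ (hxU t)) (hψi t)
    have h1 := hφ.hasDerivAt_comp (t := t) (x := x)
      ((g.contMDiffAt_val (hs (mvfderiv 𝓘(ℝ, E) ψ x ξ))
        (hs (mvfderiv 𝓘(ℝ, E) ψ x η))).mdifferentiableAt (by simp))
    rw [g.mvfderiv_val_coordField (hψ _ (hxU t)) (hψi t) (hX _)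
      (Filter.eventually_of_mem (hU.mem_nhds (hxU t)) hψX) (hXp _)] at h1
    refine h1.congr_of_eventuallyEq (Filter.Eventually.of_forall fun τ ↦ ?_)
    simp only [k, hX']
  have hk0 : k 0 = g.val x ξ η := by
    have h1 : ∀ f : M → M, f = id → g.val (f x) (mfderiv 𝓘(ℝ, E) 𝓘(ℝ, E) f x ξ)
        (mfderiv 𝓘(ℝ, E) 𝓘(ℝ, E) f x η) = g.val x ξ η := by
      rintro _ rfl
      rw [mfderiv_id]
      rfl
    exact h1 _ (funext hφ.zero)
  rw [← hk0]
  exact is_const_of_deriv_eq_zero (fun t ↦ (hk t).differentiableAt) (fun t ↦ (hk t).deriv) t 0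

/-- A hypersurface that meets every integral curve exactly once and transversally is the zero set
of a global time function of the flow. -/
theorem exists_timeFunction {S : Set M}
    (hS : ∀ x ∈ S, ∃ f : M → ℝ, IsLocalDefiningFunctionAt 𝓘(ℝ, E) S f x ∧
      mvfderiv 𝓘(ℝ, E) f x (X x) ≠ 0) (hu : ∀ x, ∃! t, φ (t, x) ∈ S) :
    ∃ v : M → ℝ, ContMDiff 𝓘(ℝ, E) 𝓘(ℝ, ℝ) ∞ v ∧ (∀ t x, v (φ (t, x)) = v x + t) ∧
      ∀ x, x ∈ S ↔ v x = 0 := by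
  -- `τ x` is the time at which the flow line from `x` hits `S`; the time function is `-τ`.
  choose τ hτ hτu using hu
  have hτφ : ∀ t x, τ (φ (t, x)) = τ x - t := fun t x ↦ by
    refine (hτu _ _ ?_).symm
    simpa [hφ.add hX] using hτ x
  refine ⟨fun x ↦ - τ x, ?_, fun t x ↦ by simp only [hτφ]; ring, fun x ↦ ⟨fun hx ↦ ?_, fun hx ↦ ?_⟩⟩
  · suffices H : ContMDiff 𝓘(ℝ, E) 𝓘(ℝ, ℝ) ∞ τ from contDiff_neg.contMDiff.comp H
    intro x₀
    have : CompleteSpace E := FiniteDimensional.complete ℝ E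
    obtain ⟨f, ⟨⟨U, hU, hyU, hfU, hSU⟩, -⟩, hfX⟩ := hS _ (hτ x₀)
    let χ := extChartAt 𝓘(ℝ, E) x₀
    let G : E × ℝ → ℝ := fun p ↦ f (φ (p.2, χ.symm p.1))
    have hχx : χ.symm (χ x₀) = x₀ := extChartAt_to_inv (I := 𝓘(ℝ, E)) x₀
    have hφu : ContMDiffAt 𝓘(ℝ, E × ℝ) 𝓘(ℝ, E) ∞ (fun p : E × ℝ ↦ φ (p.2, χ.symm p.1))
        (χ x₀, τ x₀) := by
      refine (hφ.contMDiff hX).contMDiffAt.comp _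
        (ContMDiffAt.prodMk contDiff_snd.contMDiff.contMDiffAt ?_)
      exact ((contMDiffOn_extChartAt_symm x₀).contMDiffAt
        ((isOpen_extChartAt_target x₀).mem_nhds (mem_extChartAt_target x₀))).comp (χ x₀, τ x₀)
        contDiff_fst.contMDiff.contMDiffAt
    have hf : ContMDiffAt 𝓘(ℝ, E) 𝓘(ℝ, ℝ) ∞ f (φ (τ x₀, χ.symm (χ x₀))) := by
      rw [hχx]; exact hfU.contMDiffAt (hU.mem_nhds hyU)
    have hG : ContDiffAt ℝ ∞ G (χ x₀, τ x₀) := (ContMDiffAt.comp (g := f)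
      (f := fun p : E × ℝ ↦ φ (p.2, χ.symm p.1)) (χ x₀, τ x₀) hf hφu).contDiffAt
    have hG0 : G (χ x₀, τ x₀) = 0 := by
      have : φ (τ x₀, x₀) ∈ S ∩ U := ⟨hτ x₀, hyU⟩
      rw [hSU] at this
      change f (φ (τ x₀, χ.symm (χ x₀))) = 0
      rw [hχx]
      exact this.2
    -- The partial derivative in time is multiplication by `df(X)`, nonzero by transversality.
    have hinv : (fderiv ℝ G (χ x₀, τ x₀) ∘L .inr ℝ E ℝ).IsInvertible := by
      refine ContinuousLinearMap.isInvertible_of_surjective fun r ↦ ?_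
      have h1 : HasFDerivAt (fun t ↦ G (χ x₀, t)) (fderiv ℝ G (χ x₀, τ x₀) ∘L .inr ℝ E ℝ) (τ x₀) :=
        (hG.differentiableAt (by simp)).hasFDerivAt.comp (τ x₀) (hasFDerivAt_prodMk_right _ _)
      have h2 := hφ.hasDerivAt_comp (t := τ x₀) (x := x₀) (f := f)
        ((hfU.contMDiffAt (hU.mem_nhds hyU)).mdifferentiableAt (by simp))
      have h3 : (fun t ↦ G (χ x₀, t)) = fun t ↦ f (φ (t, x₀)) := by
        ext t
        change f (φ (t, χ.symm (χ x₀))) = _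
        rw [hχx]
      rw [h3] at h1
      rw [h1.unique h2.hasFDerivAt]
      exact ⟨r / mvfderiv 𝓘(ℝ, E) f (φ (τ x₀, x₀)) (X (φ (τ x₀, x₀))), by
        simp [div_mul_cancel₀ _ hfX]⟩
    have hev := hG.eventually_apply_eq_iff_implicitFunction (by simp) hinv
    have hsm := hG.contDiffAt_implicitFunction (by simp) hinv
    have hself := hG.implicitFunction_apply_self (by simp) hinv
    let σ := hG.implicitFunction (by simp) hinv
    have hσ : ContMDiffAt 𝓘(ℝ, E) 𝓘(ℝ, ℝ) ∞ (fun y ↦ σ (χ y)) x₀ :=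
      ContMDiffAt.comp x₀ hsm.contMDiffAt contMDiffAt_extChartAt
    have hσ0 : σ (χ x₀) = τ x₀ := hself
    refine hσ.congr_of_eventuallyEq ?_
    have hc1 : ContinuousAt (fun y ↦ (χ y, σ (χ y))) x₀ :=
      (contMDiffAt_extChartAt (I := 𝓘(ℝ, E)) (n := ∞)).continuousAt.prodMk hσ.continuousAt
    have hc2 : ContinuousAt (fun y ↦ φ (σ (χ y), y)) x₀ :=
      (hφ.contMDiff hX).continuous.continuousAt.comp (hσ.continuousAt.prodMk continuousAt_id)
    have hev' : ∀ᶠ p in 𝓝 (χ x₀, σ (χ x₀)), G p = G (χ x₀, τ x₀) ↔ σ p.1 = p.2 := by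
      rw [hσ0]; exact hev
    have hU' : U ∈ 𝓝 (φ (σ (χ x₀), x₀)) := by
      rw [hσ0]; exact hU.mem_nhds hyU
    filter_upwards [hc1.eventually hev', hc2.preimage_mem_nhds hU',
      extChartAt_source_mem_nhds (I := 𝓘(ℝ, E)) x₀] with y hy hyU hys
    have h1 := hy.2 rfl
    rw [hG0] at h1
    change f (φ (σ (χ y), χ.symm (χ y))) = 0 at h1
    rw [χ.left_inv hys] at h1
    -- The implicit solution `σ` is a hitting time, so global uniqueness identifies it with `τ`; no
    -- continuity of `τ` is needed beforehand.
    have h2 : φ (σ (χ y), y) ∈ S ∩ U := hSU ▸ ⟨hyU, h1⟩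
    exact (hτu _ _ h2.1).symm
  · rw [neg_eq_zero]
    exact (hτu _ _ (by simpa only [hφ.zero] using hx)).symm
  · have := hτ x
    rwa [neg_eq_zero.1 hx, hφ.zero] at this

/-- A time function and a local defining function of its zero set have the same tangent
hyperplanes. -/
lemma mvfderiv_eq_of_isLocalDefiningFunctionAt {S : Set M} {v : M → ℝ}
    (hv : ContMDiff 𝓘(ℝ, E) 𝓘(ℝ, ℝ) ∞ v) (hvφ : ∀ t x, v (φ (t, x)) = v x + t)
    (hvS : ∀ x, x ∈ S ↔ v x = 0) {x : M} (hx : x ∈ S) {f : M → ℝ}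
    (hf : IsLocalDefiningFunctionAt 𝓘(ℝ, E) S f x) (ξ : TangentSpace 𝓘(ℝ, E) x) :
    mvfderiv 𝓘(ℝ, E) f x ξ = mvfderiv 𝓘(ℝ, E) v x ξ * mvfderiv 𝓘(ℝ, E) f x (X x) := by
  obtain ⟨⟨U, hU, hxU, hfU, hSU⟩, -⟩ := hf
  have h0 : φ (-v x, x) = x := by rw [(hvS x).1 hx, neg_zero, hφ.zero]
  have hvd := hv.mdifferentiable (by simp) x
  have h1 := hφ.mvfderiv_comp_apply hX (f := f) (τ := fun y ↦ - v y) (x := x)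
    (by rw [h0]; exact (hfU.contMDiffAt (hU.mem_nhds hxU)).mdifferentiableAt (by simp)) hvd.neg ξ
  have h2 : (fun y ↦ f (φ (-v x, y))) = f := by
    ext y; rw [(hvS x).1 hx, neg_zero, hφ.zero]
  have h3 : mvfderiv 𝓘(ℝ, E) (fun y ↦ - v y) x = - mvfderiv 𝓘(ℝ, E) v x := mvfderiv_neg
  have hκ : Continuous fun y ↦ φ (-v y, y) :=
    (hφ.contMDiff hX).continuous.comp (hv.continuous.neg.prodMk continuous_id)
  -- The retraction `y ↦ φ (-v y, y)` lands in `S`, where `f` vanishes. Differentiating this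
  -- identity gives the claim.
  have h4 : (fun y ↦ f (φ (-v y, y))) =ᶠ[𝓝 x] fun _ ↦ 0 := by
    filter_upwards [(hU.preimage hκ).mem_nhds (show φ (-v x, x) ∈ U by rwa [h0])] with y hy
    have h5 : φ (-v y, y) ∈ S ∩ U := ⟨(hvS _).2 (by rw [hvφ, add_neg_cancel]), hy⟩
    rw [hSU] at h5
    exact h5.2
  have h5 : mvfderiv 𝓘(ℝ, E) (fun y ↦ f (φ (-v y, y))) x = 0 := by
    have := h4.mfderiv_eq (I := 𝓘(ℝ, E)) (I' := 𝓘(ℝ, ℝ))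
    rw [mfderiv_const] at this
    simp only [mvfderiv, this]
    rfl
  rw [h5, h0, h2, h3] at h1
  simp only [neg_apply, zero_apply, smul_eq_mul] at h1
  linarith

end IsGlobalFlow

end GlobalFlow


/-! ### The transverse field of a spacelike time function -/

section Foliation

variable {E : Type*} [NormedAddCommGroup E] [NormedSpace ℝ E]
  {M : Type*} [TopologicalSpace M] [ChartedSpace E M] [IsManifold 𝓘(ℝ, E) ∞ M]

/-- A lightlike gradient field `V = grad s` with an isometric global flow `φ` and a time function
`v` of `φ` whose level sets are spacelike. -/
structure IsSpacelikeTimeFunction (g : LorentzMetric 𝓘(ℝ, E) M)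
    (V : Π x : M, TangentSpace 𝓘(ℝ, E) x) (φ : ℝ × M → M) (s v : M → ℝ) : Prop where
  contMDiff_field : ContMDiff 𝓘(ℝ, E) 𝓘(ℝ, E).tangent ∞ (T% V)
  flow : IsGlobalFlow V φ
  contMDiff_s : ContMDiff 𝓘(ℝ, E) 𝓘(ℝ, ℝ) ∞ s
  contMDiff_v : ContMDiff 𝓘(ℝ, E) 𝓘(ℝ, ℝ) ∞ v
  null : ∀ x, g.val x (V x) (V x) = 0
  grad : g.IsGradient V s
  v_flow : ∀ t x, v (φ (t, x)) = v x + t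
  isometry : ∀ t x (ξ η : TangentSpace 𝓘(ℝ, E) x),
    g.val (φ (t, x)) (mfderiv 𝓘(ℝ, E) 𝓘(ℝ, E) (fun x ↦ φ (t, x)) x ξ)
      (mfderiv 𝓘(ℝ, E) 𝓘(ℝ, E) (fun x ↦ φ (t, x)) x η) = g.val x ξ η
  pos : ∀ x (ξ : TangentSpace 𝓘(ℝ, E) x), mvfderiv 𝓘(ℝ, E) v x ξ = 0 → ξ ≠ 0 → 0 < g.val x ξ ξ

variable [FiniteDimensional ℝ E]

/-- The field orthogonal to the level sets of `(v, s)` with `dv = 0` and `ds = 1`. -/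
def LorentzMetric.transverse (g : LorentzMetric 𝓘(ℝ, E) M) (V : Π x : M, TangentSpace 𝓘(ℝ, E) x)
    (v : M → ℝ) (x : M) : TangentSpace 𝓘(ℝ, E) x :=
  g.gradient v x - g.val x (g.gradient v x) (g.gradient v x) • V x

namespace IsSpacelikeTimeFunction

variable {g : LorentzMetric 𝓘(ℝ, E) M}
    {V : Π x : M, TangentSpace 𝓘(ℝ, E) x} {φ : ℝ × M → M} {s v : M → ℝ}
    (h : IsSpacelikeTimeFunction g V φ s v)

include h

omit [FiniteDimensional ℝ E] in
lemma mdiff_v (x : M) : MDifferentiableAt 𝓘(ℝ, E) 𝓘(ℝ, ℝ) v x :=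
  h.contMDiff_v.mdifferentiable (by simp) x

omit [FiniteDimensional ℝ E] in
lemma mdiff_s (x : M) : MDifferentiableAt 𝓘(ℝ, E) 𝓘(ℝ, ℝ) s x :=
  h.contMDiff_s.mdifferentiable (by simp) x

omit [FiniteDimensional ℝ E] in
lemma dv_V (x : M) : mvfderiv 𝓘(ℝ, E) v x (V x) = 1 := by
  have h1 := h.flow.hasDerivAt_comp (t := 0) (h.mdiff_v (φ (0, x)))
  simp only [h.v_flow] at h1
  have h2 := h1.unique ((hasDerivAt_id (0 : ℝ)).const_add (v x))
  rwa [h.flow.zero] at h2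

omit [FiniteDimensional ℝ E] in
lemma ds_V (x : M) : mvfderiv 𝓘(ℝ, E) s x (V x) = 0 := by
  rw [← h.grad, h.null]

omit [FiniteDimensional ℝ E] in
lemma s_flow (t : ℝ) (x : M) : s (φ (t, x)) = s x := by
  have h1 : ∀ t, HasDerivAt (fun t ↦ s (φ (t, x))) 0 t := fun t ↦ by
    have := h.flow.hasDerivAt_comp (t := t) (h.mdiff_s (φ (t, x)))
    rwa [h.ds_V] at this
  have h2 := is_const_of_deriv_eq_zero (fun t ↦ (h1 t).differentiableAt)
    (fun t ↦ (h1 t).deriv) t 0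
  simpa only [h.flow.zero] using h2

omit h in
lemma val_transverse (hgrad : g.IsGradient V s) (x : M) (ξ : TangentSpace 𝓘(ℝ, E) x) :
    g.val x (g.transverse V v x) ξ = mvfderiv 𝓘(ℝ, E) v x ξ -
      g.val x (g.gradient v x) (g.gradient v x) * mvfderiv 𝓘(ℝ, E) s x ξ := by
  rw [LorentzMetric.transverse, map_sub, map_smul, sub_apply, smul_apply, g.val_gradient, hgrad,
    smul_eq_mul]

lemma dv_transverse (x : M) : mvfderiv 𝓘(ℝ, E) v x (g.transverse V v x) = 0 := by
  rw [LorentzMetric.transverse, map_sub, map_smul, h.dv_V, g.val_gradient]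
  simp

lemma ds_transverse (x : M) : mvfderiv 𝓘(ℝ, E) s x (g.transverse V v x) = 1 := by
  rw [← h.grad, g.symm, val_transverse h.grad, h.dv_V, h.ds_V]
  simp

/-- The field is tangent to the spacelike level sets of `v`, and nonzero because `ds` takes the
value `1` on it. This positive number becomes `u⁻²`. -/
lemma val_transverse_self_pos (x : M) : 0 < g.val x (g.transverse V v x) (g.transverse V v x) := by
  refine h.pos x _ (h.dv_transverse x) fun h0 ↦ ?_
  have := h.ds_transverse x
  rw [h0, map_zero] at this
  exact zero_ne_one this

lemma contMDiff_transverse :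
    ContMDiff 𝓘(ℝ, E) 𝓘(ℝ, E).tangent ∞ (T% (g.transverse V v)) := fun x ↦ by
  have hg := g.contMDiff_gradient h.contMDiff_v x
  exact hg.sub_section ((g.contMDiffAt_val hg hg).smul_section (h.contMDiff_field x))

variable [T2Space M]

lemma dv_mfderiv_flow (t : ℝ) (x : M) (ξ : TangentSpace 𝓘(ℝ, E) x) :
    mvfderiv 𝓘(ℝ, E) v (φ (t, x)) (mfderiv 𝓘(ℝ, E) 𝓘(ℝ, E) (fun x ↦ φ (t, x)) x ξ) =
      mvfderiv 𝓘(ℝ, E) v x ξ := by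
  rw [← mvfderiv_comp_mfderiv_apply (h := fun y ↦ φ (t, y)) (h.mdiff_v _)
    ((h.flow.contMDiff_slice h.contMDiff_field t).mdifferentiable (by simp) x)]
  have h1 : (fun y ↦ v (φ (t, y))) = v + fun _ ↦ t := funext fun y ↦ h.v_flow t y
  rw [h1, mvfderiv_add (h.mdiff_v x) mdifferentiableAt_const, mvfderiv_const, add_zero]

lemma ds_mfderiv_flow (t : ℝ) (x : M) (ξ : TangentSpace 𝓘(ℝ, E) x) :
    mvfderiv 𝓘(ℝ, E) s (φ (t, x)) (mfderiv 𝓘(ℝ, E) 𝓘(ℝ, E) (fun x ↦ φ (t, x)) x ξ) =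
      mvfderiv 𝓘(ℝ, E) s x ξ := by
  rw [← mvfderiv_comp_mfderiv_apply (h := fun y ↦ φ (t, y)) (h.mdiff_s _)
    ((h.flow.contMDiff_slice h.contMDiff_field t).mdifferentiable (by simp) x)]
  have h1 : (fun y ↦ s (φ (t, y))) = s := funext fun y ↦ h.s_flow t y
  rw [h1]

omit [T2Space M] in
lemma surjective_mfderiv_flow (t : ℝ) (x : M) :
    Function.Surjective (mfderiv 𝓘(ℝ, E) 𝓘(ℝ, E) (fun x ↦ φ (t, x)) x) := by
  let A : E →L[ℝ] E := mfderiv 𝓘(ℝ, E) 𝓘(ℝ, E) (fun x ↦ φ (t, x)) x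
  have hinj : Function.Injective (A : E →ₗ[ℝ] E) := by
    rw [← LinearMap.ker_eq_bot, LinearMap.ker_eq_bot']
    intro ξ hξ
    refine g.eq_zero_of_val_eq_zero (x := x) fun η ↦ ?_
    rw [← h.isometry t x ξ η]
    have h1 : mfderiv 𝓘(ℝ, E) 𝓘(ℝ, E) (fun x ↦ φ (t, x)) x ξ = 0 := hξ
    rw [h1, map_zero, zero_apply]
  exact (LinearMap.injective_iff_surjective (f := (A : E →ₗ[ℝ] E))).1 hinj

/-- The flow preserves `g`, `dv` and `ds`, and these determine the transverse field by its inner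
products with all vectors. -/
lemma mfderiv_flow_transverse (t : ℝ) (x : M) :
    mfderiv 𝓘(ℝ, E) 𝓘(ℝ, E) (fun x ↦ φ (t, x)) x (g.transverse V v x) =
      g.transverse V v (φ (t, x)) := by
  have hgr : mfderiv 𝓘(ℝ, E) 𝓘(ℝ, E) (fun x ↦ φ (t, x)) x (g.gradient v x) =
      g.gradient v (φ (t, x)) := by
    refine g.ext_val fun b ↦ ?_
    obtain ⟨η, rfl⟩ := h.surjective_mfderiv_flow t x b
    rw [h.isometry, g.val_gradient, g.val_gradient, h.dv_mfderiv_flow]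
  refine g.ext_val fun b ↦ ?_
  obtain ⟨η, rfl⟩ := h.surjective_mfderiv_flow t x b
  rw [h.isometry, val_transverse h.grad, val_transverse h.grad, h.dv_mfderiv_flow,
    h.ds_mfderiv_flow, ← hgr, h.isometry]

/-- The flow of `V` maps integral curves of the transverse field to such curves. -/
lemma isMIntegralCurveOn_flow_comp (t : ℝ) {γ : ℝ → M} {O : Set ℝ}
    (hγ : IsMIntegralCurveOn γ (g.transverse V v) O) :
    IsMIntegralCurveOn (fun τ ↦ φ (t, γ τ)) (g.transverse V v) O := by
  intro τ hτ
  have h1 := HasMFDerivAt.comp_hasMFDerivWithinAt τ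
    ((h.flow.contMDiff_slice h.contMDiff_field t).mdifferentiable (by simp) (γ τ)).hasMFDerivAt
    (hγ τ hτ)
  refine h1.congr_mfderiv ?_
  ext
  change mfderiv 𝓘(ℝ, E) 𝓘(ℝ, E) (fun x ↦ φ (t, x)) (γ τ) ((1 : ℝ) • _) = (1 : ℝ) • _
  rw [one_smul, one_smul, h.mfderiv_flow_transverse]

end IsSpacelikeTimeFunction

end Foliation


/-! ### Integral curves over the whole range of `s` -/

section Extension

variable {E : Type*} [NormedAddCommGroup E] [NormedSpace ℝ E] [FiniteDimensional ℝ E]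
  {M : Type*} [TopologicalSpace M] [ChartedSpace E M] [IsManifold 𝓘(ℝ, E) ∞ M] [T2Space M]
  {W : Π x : M, TangentSpace 𝓘(ℝ, E) x} {s : M → ℝ} {S : Set M}

omit [FiniteDimensional ℝ E] [IsManifold 𝓘(ℝ, E) ∞ M] [T2Space M] in
/-- A function with constant derivative along a vector field is affine along integral curves. -/
lemma IsMIntegralCurveOn.comp_eq_add {r : ℝ} (hs : MDifferentiable 𝓘(ℝ, E) 𝓘(ℝ, ℝ) s)
    (hsW : ∀ x, mvfderiv 𝓘(ℝ, E) s x (W x) = r) {γ : ℝ → M} {O : Set ℝ} (hO : IsOpen O)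
    (hO' : O.OrdConnected) (hγ : IsMIntegralCurveOn γ W O) {t t' : ℝ} (ht : t ∈ O) (ht' : t' ∈ O) :
    s (γ t') = s (γ t) + r * (t' - t) := by
  have hd : ∀ τ ∈ O, HasDerivAt (fun τ ↦ s (γ τ) - r * τ) 0 τ := fun τ hτ ↦ by
    have h1 := (hγ.hasMFDerivAt_of_isOpen hO hτ).hasDerivAt_comp_curve (hs (γ τ))
    rw [hsW] at h1
    simpa using h1.fun_sub ((hasDerivAt_id τ).const_mul r)
  have := hO'.convex.is_const_of_fderivWithin_eq_zero (𝕜 := ℝ)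
    (f := fun τ ↦ s (γ τ) - r * τ)
    (fun τ hτ ↦ (hd τ hτ).differentiableAt.differentiableWithinAt)
    (fun τ hτ ↦ by
      rw [fderivWithin_of_isOpen hO hτ, (hd τ hτ).hasFDerivAt.fderiv]
      ext; simp) ht ht'
  linarith

/-- If the fibres of `s` in a set `S` invariant under a field `W` with `ds(W) = 1` are compact and
connected, then nearby fibres are joined by integral curves of `W` existing for a uniform time. -/
lemma exists_uniform_integralCurve_of_fibre
    (hW : ContMDiff 𝓘(ℝ, E) 𝓘(ℝ, E).tangent ∞ (T% W)) (hs : ContMDiff 𝓘(ℝ, E) 𝓘(ℝ, ℝ) ∞ s)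
    (hsW : ∀ x, mvfderiv 𝓘(ℝ, E) s x (W x) = 1)
    (hS : ∀ (γ : ℝ → M) (O : Set ℝ), IsOpen O → O.OrdConnected → IsMIntegralCurveOn γ W O →
      ∀ t ∈ O, ∀ t' ∈ O, γ t ∈ S → γ t' ∈ S)
    (hfib : ∀ c ∈ s '' S, IsCompact (S ∩ s ⁻¹' {c}) ∧ IsConnected (S ∩ s ⁻¹' {c}))
    {c : ℝ} (hc : c ∈ s '' S) :
    ∃ ε > 0, ∀ c' ∈ Ioo (c - ε) (c + ε), c' ∈ s '' S ∧ ∀ x ∈ S, s x = c' →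
      ∃ γ : ℝ → M, γ c' = x ∧ IsMIntegralCurveOn γ W (Ioo (c - ε) (c + ε)) := by
  have hsd := hs.mdifferentiable (by simp)
  obtain ⟨hFc, hFconn⟩ := hfib c hc
  obtain ⟨ε₀, hε₀, U, hU, hFU, H⟩ := hFc.exists_uniform_isMIntegralCurveOn hW
  choose! Γ hΓ0 hΓ using H
  let θ : ℝ × M → M := fun p ↦ Γ p.2 p.1
  have hθ : ContinuousOn θ (Ioo (-ε₀) ε₀ ×ˢ U) := by
    refine (contMDiffOn_flow hW (isOpen_Ioo.prod hU) (φ := θ) (fun p hp ↦ ⟨by simp [hε₀], hp.2⟩)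
      (fun x ↦ ?_) (fun x hx ↦ hΓ0 x hx.2) fun x t ht ↦ ?_).continuousOn
    · by_cases hx : x ∈ U
      · have : {t | (t, x) ∈ Ioo (-ε₀) ε₀ ×ˢ U} = Ioo (-ε₀) ε₀ := by ext; simp [hx]
        rw [this]; exact ordConnected_Ioo
      · have : {t | (t, x) ∈ Ioo (-ε₀) ε₀ ×ˢ U} = ∅ := by ext; simp [hx]
        rw [this]; exact ordConnected_empty
    · exact (hΓ x ht.2 t ht.1).mono fun τ hτ ↦ hτ.1
  have hsub : Icc (-(ε₀ / 2)) (ε₀ / 2) ×ˢ (S ∩ s ⁻¹' {c}) ⊆ Ioo (-ε₀) ε₀ ×ˢ U :=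
    prod_mono (Icc_subset_Ioo (by linarith) (by linarith)) hFU
  -- Uniform existence is used again, near the compact set swept out by the fibre over `c`, so that
  -- points near a flowed fibre can be flowed back.
  obtain ⟨ε₁, hε₁, U₁, hU₁, hKU, H₁⟩ :=
    ((isCompact_Icc.prod hFc).image_of_continuousOn (hθ.mono hsub)).exists_uniform_isMIntegralCurveOn
      hW
  refine ⟨min (ε₀ / 2) ε₁, lt_min (by linarith) hε₁, fun c' hc' ↦ ?_⟩
  have h1 := min_le_left (ε₀ / 2) ε₁
  have h2 := min_le_right (ε₀ / 2) ε₁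
  have hδ : c' - c ∈ Icc (-(ε₀ / 2)) (ε₀ / 2) := ⟨by linarith [hc'.1], by linarith [hc'.2]⟩
  have hδ₀ : c' - c ∈ Ioo (-ε₀) ε₀ := ⟨by linarith [hδ.1], by linarith [hδ.2]⟩
  have h0₀ : (0 : ℝ) ∈ Ioo (-ε₀) ε₀ := by simp [hε₀]
  let A : Set M := (fun x ↦ θ (c' - c, x)) '' (S ∩ s ⁻¹' {c})
  have hAc : IsCompact A := hFc.image_of_continuousOn <|
    hθ.comp (by fun_prop : ContinuousOn (fun x : M ↦ (c' - c, x)) _) fun x hx ↦ ⟨hδ₀, hFU hx⟩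
  have hAF : A ⊆ S ∩ s ⁻¹' {c'} := by
    rintro _ ⟨x, hx, rfl⟩
    refine ⟨hS (Γ x) _ isOpen_Ioo ordConnected_Ioo (hΓ x (hFU hx)) 0 h0₀ _ hδ₀ ?_, ?_⟩
    · rw [hΓ0 x (hFU hx)]; exact hx.1
    · have h3 := (hΓ x (hFU hx)).comp_eq_add hsd hsW isOpen_Ioo ordConnected_Ioo h0₀ hδ₀
      rw [hΓ0 x (hFU hx), hx.2] at h3
      change s (Γ x (c' - c)) = c'
      rw [h3]; ring
  have hAU : A ⊆ U₁ := by
    rintro _ ⟨x, hx, rfl⟩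
    exact hKU ⟨(c' - c, x), ⟨hδ, hx⟩, rfl⟩
  have hAne : A.Nonempty := hFconn.nonempty.image _
  have hc'S : c' ∈ s '' S := by
    obtain ⟨y, hy⟩ := hAne
    exact ⟨y, (hAF hy).1, (hAF hy).2⟩
  -- A point of the fibre over `c'` close to `A` flows back into the fibre over `c` and hence lies
  -- in `A`. So `A` is relatively open in the fibre over `c'`.
  have hUA : S ∩ s ⁻¹' {c'} ∩ U₁ ⊆ A := by
    rintro y ⟨⟨hyS, hyc⟩, hyU⟩
    obtain ⟨γ, hγ0, hγ⟩ := H₁ y hyU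
    have hm : -(c' - c) ∈ Ioo (-ε₁) ε₁ := ⟨by linarith [hc'.2], by linarith [hc'.1]⟩
    have h0₁ : (0 : ℝ) ∈ Ioo (-ε₁) ε₁ := by simp [hε₁]
    have hz : γ (-(c' - c)) ∈ S ∩ s ⁻¹' {c} := by
      refine ⟨hS γ _ isOpen_Ioo ordConnected_Ioo hγ 0 h0₁ _ hm (by rwa [hγ0]), ?_⟩
      have h3 := hγ.comp_eq_add hsd hsW isOpen_Ioo ordConnected_Ioo h0₁ hm
      rw [hγ0, hyc] at h3
      change s (γ (-(c' - c))) = c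
      rw [h3]; ring
    refine ⟨_, hz, ?_⟩
    have hγ' := hγ.comp_add (-(c' - c))
    have h4 := IsMIntegralCurveOn.eq_of_ordConnected hW
      (O := Ioo (-ε₀) ε₀ ∩ Ioo (-ε₁ + (c' - c)) (ε₁ + (c' - c)))
      (isOpen_Ioo.inter isOpen_Ioo) (ordConnected_Ioo.inter ordConnected_Ioo)
      ((hΓ _ (hFU hz)).mono inter_subset_left)
      (hγ'.mono fun τ hτ ↦ by
        change τ + -(c' - c) ∈ Ioo (-ε₁) ε₁
        exact ⟨by linarith [hτ.2.1], by linarith [hτ.2.2]⟩)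
      (t := 0) (t' := c' - c)
      ⟨h0₀, by linarith [hm.1], by linarith [hm.2]⟩
      ⟨hδ₀, by linarith, by linarith⟩ (by rw [hΓ0 _ (hFU hz)]; simp)
    change Γ (γ (-(c' - c))) (c' - c) = y
    rw [h4]
    simp [hγ0]
  -- `A` is also compact, hence closed, and nonempty; the fibre over `c'` is connected, so `A`
  -- exhausts it.
  have hFA : S ∩ s ⁻¹' {c'} ⊆ A := by
    by_contra hne
    obtain ⟨y, hy, hyA⟩ := not_subset.1 hne
    obtain ⟨a, ha⟩ := hAne
    obtain ⟨z, hz, hzU, hzA⟩ := (hfib c' hc'S).2.isPreconnected U₁ Aᶜ hU₁ hAc.isClosed.isOpen_compl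
      (fun x _ ↦ by
        by_cases hx : x ∈ A
        · exact Or.inl (hAU hx)
        · exact Or.inr hx) ⟨a, hAF ha, hAU ha⟩ ⟨y, hy, hyA⟩
    exact hzA (hUA ⟨hz, hzU⟩)
  refine ⟨hc'S, fun x hx hxc ↦ ?_⟩
  obtain ⟨z, hz, hzx⟩ := hFA ⟨hx, hxc⟩
  have hzx' : Γ z (c' - c) = x := hzx
  refine ⟨fun τ ↦ Γ z (τ + -c), by simpa [sub_eq_add_neg] using hzx', ?_⟩
  refine ((hΓ z (hFU hz)).comp_add (-c)).mono fun τ hτ ↦ ?_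
  change τ + -c ∈ Ioo (-ε₀) ε₀
  exact ⟨by linarith [hτ.1], by linarith [hτ.2]⟩

/-- If the fibres of `s` in a connected set `S` invariant under a field `W` with `ds(W) = 1` are
compact and connected, then the integral curves of `W` in `S` exist over all of `s(S)`. -/
theorem exists_integralCurve_of_fibres
    (hW : ContMDiff 𝓘(ℝ, E) 𝓘(ℝ, E).tangent ∞ (T% W)) (hs : ContMDiff 𝓘(ℝ, E) 𝓘(ℝ, ℝ) ∞ s)
    (hsW : ∀ x, mvfderiv 𝓘(ℝ, E) s x (W x) = 1)
    (hS : ∀ (γ : ℝ → M) (O : Set ℝ), IsOpen O → O.OrdConnected → IsMIntegralCurveOn γ W O →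
      ∀ t ∈ O, ∀ t' ∈ O, γ t ∈ S → γ t' ∈ S)
    (hfib : ∀ c ∈ s '' S, IsCompact (S ∩ s ⁻¹' {c}) ∧ IsConnected (S ∩ s ⁻¹' {c}))
    (hconn : IsPreconnected S) :
    IsOpen (s '' S) ∧
      ∀ x ∈ S, ∃ γ : ℝ → M, γ (s x) = x ∧ IsMIntegralCurveOn γ W (s '' S) := by
  have hsd := hs.mdifferentiable (by simp)
  have hloc := fun c hc ↦ exists_uniform_integralCurve_of_fibre hW hs hsW hS hfib (c := c) hc
  have hJ : IsOpen (s '' S) := by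
    refine isOpen_iff_mem_nhds.2 fun c hc ↦ ?_
    obtain ⟨ε, hε, H⟩ := hloc c hc
    exact Filter.mem_of_superset (Ioo_mem_nhds (by linarith) (by linarith)) fun c' hc' ↦ (H c' hc').1
  have hJc : IsPreconnected (s '' S) := hconn.image s hs.continuous.continuousOn
  refine ⟨hJ, fun x hx ↦ ?_⟩
  -- `P a b` says that every point over `a` has an integral curve reaching the parameter `b`. It
  -- holds both ways between nearby values, and is transitive because curves that agree at one
  -- parameter can be glued.
  let P : ℝ → ℝ → Prop := fun a b ↦ ∀ x ∈ S, s x = a → ∃ O : Set ℝ, IsOpen O ∧ O.OrdConnected ∧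
    a ∈ O ∧ b ∈ O ∧ ∃ γ : ℝ → M, γ a = x ∧ IsMIntegralCurveOn γ W O
  have hP : ∀ a ∈ s '' S, ∀ b ∈ s '' S, P a b := by
    intro a ha b hb
    refine hJc.induction₂' P (fun c hc ↦ ?_) ?_ ha hb
    · obtain ⟨ε, hε, H⟩ := hloc c hc
      have hcc : c ∈ Ioo (c - ε) (c + ε) := by simp [hε]
      filter_upwards [mem_nhdsWithin_of_mem_nhds (isOpen_Ioo.mem_nhds hcc)] with c' hc'
      exact ⟨fun x hx hxc ↦ ⟨_, isOpen_Ioo, ordConnected_Ioo, hcc, hc', (H c hcc).2 x hx hxc⟩,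
        fun x hx hxc ↦ ⟨_, isOpen_Ioo, ordConnected_Ioo, hc', hcc, (H c' hc').2 x hx hxc⟩⟩
    · intro a b c _ _ _ hab hbc x hx hxa
      obtain ⟨O, hO, hO', haO, hbO, γ, hγa, hγ⟩ := hab x hx hxa
      have hsb := hγ.comp_eq_add hsd hsW hO hO' haO hbO
      rw [hγa, hxa] at hsb
      obtain ⟨T, hT, hT', hbT, hcT, δ, hδb, hδ⟩ :=
        hbc (γ b) (hS γ O hO hO' hγ a haO b hbO (by rwa [hγa])) (by rw [hsb]; ring)
      have heq : ∀ t ∈ O ∩ T, γ t = δ t := fun t ht ↦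
        IsMIntegralCurveOn.eq_of_ordConnected hW (hO.inter hT) (hO'.inter hT')
          (hγ.mono inter_subset_left) (hδ.mono inter_subset_right) ⟨hbO, hbT⟩ ht hδb.symm
      classical
      let ρ : ℝ → M := O.piecewise γ δ
      have hρO : EqOn ρ γ O := fun t ht ↦ O.piecewise_eq_of_mem _ _ ht
      have hρT : EqOn ρ δ T := fun t ht ↦ by
        by_cases hto : t ∈ O
        · exact (hρO hto).trans (heq t ⟨hto, ht⟩)
        · exact O.piecewise_eq_of_notMem _ _ hto
      refine ⟨O ∪ T, hO.union hT, ?_, Or.inl haO, Or.inr hcT, ρ, (hρO haO).trans hγa, ?_⟩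
      · rw [← isPreconnected_iff_ordConnected] at hO' hT' ⊢
        exact hO'.union b hbO hbT hT'
      · have hloc : ∀ (τ : ℝ → M) (N : Set ℝ), IsOpen N → EqOn ρ τ N → IsMIntegralCurveOn τ W N →
            ∀ t ∈ N, HasMFDerivAt 𝓘(ℝ, ℝ) 𝓘(ℝ, E) ρ t ((1 : ℝ →L[ℝ] ℝ).smulRight (W (ρ t))) := by
          intro τ N hN he hτ t ht
          rw [he ht]
          exact (hτ.hasMFDerivAt_of_isOpen hN ht).congr_of_eventuallyEq
            (Filter.eventually_of_mem (hN.mem_nhds ht) he)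
        rintro t (ht | ht)
        · exact (hloc γ O hO hρO hγ t ht).hasMFDerivWithinAt
        · exact (hloc δ T hT hρT hδ t ht).hasMFDerivWithinAt
  have : Nonempty M := ⟨x⟩
  choose! O hO hO' haO hbO Γ hΓa hΓ using fun b (hb : b ∈ s '' S) ↦
    hP (s x) ⟨x, hx, rfl⟩ b hb x hx rfl
  -- There is one curve `Γ b` for each endpoint `b`. By uniqueness they agree on overlaps, so the
  -- diagonal locally coincides with `Γ b` and is itself an integral curve.
  refine ⟨fun b ↦ Γ b b, hΓa _ ⟨x, hx, rfl⟩, fun b hb ↦ ?_⟩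
  have hev : (fun b ↦ Γ b b) =ᶠ[𝓝 b] Γ b := ?_
  · exact (((hΓ b hb).hasMFDerivAt_of_isOpen (hO b hb) (hbO b hb)).congr_of_eventuallyEq
      hev).hasMFDerivWithinAt
  filter_upwards [(hO b hb).mem_nhds (hbO b hb), hJ.mem_nhds hb] with b' hb' hb'J
  exact IsMIntegralCurveOn.eq_of_ordConnected hW ((hO b' hb'J).inter (hO b hb))
    ((hO' b' hb'J).inter (hO' b hb)) ((hΓ b' hb'J).mono inter_subset_left)
    ((hΓ b hb).mono inter_subset_right) ⟨haO b' hb'J, haO b hb⟩ ⟨hbO b' hb'J, hb'⟩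
    ((hΓa b' hb'J).trans (hΓa b hb).symm)

end Extension


/-! ### Transport along the transverse field -/

section Transport

variable {E : Type*} [NormedAddCommGroup E] [NormedSpace ℝ E]
  {M : Type*} [TopologicalSpace M] [ChartedSpace E M] [IsManifold 𝓘(ℝ, E) ∞ M]

/-- `c ↦ Θ (c, x)` is the integral curve of `W` through `x` parametrized by `s ∈ J`. -/
structure IsTransport (W : Π x : M, TangentSpace 𝓘(ℝ, E) x) (s : M → ℝ)
    (J : TopologicalSpace.Opens ℝ) (Θ : ℝ × M → M) : Prop where
  ordConnected : (J : Set ℝ).OrdConnected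
  mem (x : M) : s x ∈ J
  apply_self (x : M) : Θ (s x, x) = x
  curve (x : M) : IsMIntegralCurveOn (fun c ↦ Θ (c, x)) W J

namespace IsSpacelikeTimeFunction

variable [FiniteDimensional ℝ E] [T2Space M] {g : LorentzMetric 𝓘(ℝ, E) M}
    {V : Π x : M, TangentSpace 𝓘(ℝ, E) x} {φ : ℝ × M → M} {s v : M → ℝ}
    (h : IsSpacelikeTimeFunction g V φ s v)

include h

/-- Complete curves over `J` are known inside `{v = 0}`. A general point is moved there by `φ`,
transported and moved back, which is legitimate because `φ` maps integral curves of the transverse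
field to such curves. -/
lemma exists_isTransport
    (hfib : ∀ c ∈ s '' {x | v x = 0}, IsCompact ({x | v x = 0} ∩ s ⁻¹' {c}) ∧
      IsConnected ({x | v x = 0} ∩ s ⁻¹' {c}))
    (hconn : IsPreconnected {x | v x = 0}) :
    ∃ (J : TopologicalSpace.Opens ℝ) (Θ : ℝ × M → M),
      (J : Set ℝ) = s '' {x | v x = 0} ∧ IsTransport (g.transverse V v) s J Θ := by
  obtain ⟨hJ, hcurve⟩ := exists_integralCurve_of_fibres h.contMDiff_transverse h.contMDiff_s
    h.ds_transverse (S := {x | v x = 0}) (fun γ O hO hO' hγ t ht t' ht' h0 ↦ by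
      have := hγ.comp_eq_add (h.contMDiff_v.mdifferentiable (by simp)) h.dv_transverse hO hO' ht ht'
      change v (γ t') = 0
      change v (γ t) = 0 at h0
      rw [this, h0]; simp) hfib hconn
  have h0 : ∀ x, v (φ (-v x, x)) = 0 := fun x ↦ by rw [h.v_flow]; ring
  choose Γ hΓs hΓ using fun x ↦ hcurve (φ (-v x, x)) (h0 x)
  simp only [h.s_flow] at hΓs
  refine ⟨⟨_, hJ⟩, fun p ↦ φ (v p.2, Γ p.2 p.1), rfl, ?_, fun x ↦ ⟨_, h0 x, h.s_flow _ _⟩,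
    fun x ↦ ?_, fun x ↦ h.isMIntegralCurveOn_flow_comp (v x) (hΓ x)⟩
  · rw [← isPreconnected_iff_ordConnected]
    exact hconn.image s h.contMDiff_s.continuous.continuousOn
  · change φ (v x, Γ x (s x)) = x
    rw [hΓs, h.flow.add h.contMDiff_field, add_neg_cancel, h.flow.zero]

variable {J : TopologicalSpace.Opens ℝ} {Θ : ℝ × M → M}
  (hΘ : IsTransport (g.transverse V v) s J Θ)

include hΘ

omit [T2Space M] in
lemma s_transport {c : ℝ} (hc : c ∈ J) (x : M) : s (Θ (c, x)) = c := by
  have := (hΘ.curve x).comp_eq_add (h.contMDiff_s.mdifferentiable (by simp)) h.ds_transverse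
    J.isOpen hΘ.ordConnected (hΘ.mem x) hc
  rw [hΘ.apply_self] at this
  rw [this]; ring

omit [T2Space M] in
lemma v_transport {c : ℝ} (hc : c ∈ J) (x : M) : v (Θ (c, x)) = v x := by
  have := (hΘ.curve x).comp_eq_add (h.contMDiff_v.mdifferentiable (by simp)) h.dv_transverse
    J.isOpen hΘ.ordConnected (hΘ.mem x) hc
  rw [hΘ.apply_self] at this
  rw [this]; ring

lemma transport_transport {c c' : ℝ} (hc : c ∈ J) (hc' : c' ∈ J) (x : M) :
    Θ (c', Θ (c, x)) = Θ (c', x) := by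
  refine IsMIntegralCurveOn.eq_of_ordConnected h.contMDiff_transverse J.isOpen hΘ.ordConnected
    (hΘ.curve _) (hΘ.curve x) hc hc' ?_
  have := hΘ.apply_self (Θ (c, x))
  rwa [h.s_transport hΘ hc] at this

lemma transport_flow {c : ℝ} (hc : c ∈ J) (t : ℝ) (x : M) :
    Θ (c, φ (t, x)) = φ (t, Θ (c, x)) := by
  refine IsMIntegralCurveOn.eq_of_ordConnected h.contMDiff_transverse J.isOpen hΘ.ordConnected
    (hΘ.curve _) (h.isMIntegralCurveOn_flow_comp t (hΘ.curve x)) (hΘ.mem x) hc ?_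
  have := hΘ.apply_self (φ (t, x))
  rw [h.s_flow] at this
  rw [this, hΘ.apply_self]

/-- In the shifted time `t = c - s x` the transport is a flow starting at time `0` on an open
domain, so `contMDiffOn_flow` applies. -/
lemma contMDiffOn_transport :
    ContMDiffOn (𝓘(ℝ, ℝ).prod 𝓘(ℝ, E)) 𝓘(ℝ, E) ∞ Θ (J ×ˢ univ) := by
  have hD : IsOpen {p : ℝ × M | s p.2 + p.1 ∈ J} :=
    J.isOpen.preimage ((h.contMDiff_s.continuous.comp continuous_snd).add continuous_fst)
  have h1 := contMDiffOn_flow h.contMDiff_transverse hD (φ := fun p ↦ Θ (s p.2 + p.1, p.2))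
    (fun p _ ↦ by simpa using hΘ.mem p.2)
    (fun x ↦ hΘ.ordConnected.preimage_mono fun a b hab ↦ by gcongr)
    (fun x _ ↦ by simpa using hΘ.apply_self x) (fun x ↦ by
      have h1 : (fun t ↦ Θ (s x + t, x)) = (fun c ↦ Θ (c, x)) ∘ (· + s x) := by
        ext t; simp [add_comm]
      have h2 : {t | (t, x) ∈ {p : ℝ × M | s p.2 + p.1 ∈ J}} = {t | t + s x ∈ (J : Set ℝ)} := by
        ext t; simp [add_comm]
      rw [h1, h2]
      exact (hΘ.curve x).comp_add (s x))
  have h2 : ContMDiff (𝓘(ℝ, ℝ).prod 𝓘(ℝ, E)) (𝓘(ℝ, ℝ).prod 𝓘(ℝ, E)) ∞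
      fun p : ℝ × M ↦ (p.1 - s p.2, p.2) :=
    (contMDiff_fst.sub (h.contMDiff_s.comp contMDiff_snd)).prodMk contMDiff_snd
  refine (h1.comp h2.contMDiffOn (s := (J : Set ℝ) ×ˢ univ) fun p hp ↦ ?_).congr fun p _ ↦ ?_
  · simpa using hp.1
  · simp

end IsSpacelikeTimeFunction

end Transport


/-! ### Pulled-back metrics and their smooth dependence on parameters -/

section Pullback

/-- The unit ball of a positive definite form on a finite-dimensional space is bounded. -/
lemma ContinuousLinearMap.isVonNBounded_of_pos {F : Type*} [NormedAddCommGroup F]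
    [NormedSpace ℝ F] [FiniteDimensional ℝ F] (b : F →L[ℝ] F →L[ℝ] ℝ)
    (hb : ∀ x, x ≠ 0 → 0 < b x x) : Bornology.IsVonNBounded ℝ {x | b x x < 1} := by
  rw [NormedSpace.isVonNBounded_iff, isBounded_iff_forall_norm_le]
  -- The sphere is empty when `F` is zero. Otherwise the minimum of the form on the sphere bounds
  -- the ball.
  rcases (Metric.sphere (0 : F) 1).eq_empty_or_nonempty with h0 | hne
  · refine ⟨0, fun x _ ↦ ?_⟩
    by_contra! hx
    have : ‖x‖⁻¹ • x ∈ Metric.sphere (0 : F) 1 := by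
      rw [mem_sphere_zero_iff_norm, norm_smul, norm_inv, norm_norm, inv_mul_cancel₀ hx.ne']
    rw [h0] at this
    exact this
  · obtain ⟨y, hy, hmin⟩ := (isCompact_sphere (0 : F) 1).exists_isMinOn hne
      (f := fun x ↦ b x x) (b.continuous.clm_apply continuous_id).continuousOn
    have hy0 : 0 < b y y := hb y (ne_zero_of_mem_unit_sphere ⟨y, hy⟩)
    refine ⟨√(b y y)⁻¹, fun x hx ↦ ?_⟩
    rcases eq_or_ne x 0 with rfl | hx0
    · simp
    have hxn : 0 < ‖x‖ := norm_pos_iff.2 hx0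
    have h1 : b y y ≤ b (‖x‖⁻¹ • x) (‖x‖⁻¹ • x) := hmin (by
      rw [mem_sphere_zero_iff_norm, norm_smul, norm_inv, norm_norm, inv_mul_cancel₀ hxn.ne'])
    have hx1 : b x x < 1 := hx
    simp only [map_smul, smul_apply, smul_eq_mul] at h1
    refine Real.le_sqrt_of_sq_le ?_
    rw [le_inv_comm₀ (by positivity) hy0]
    calc b y y ≤ ‖x‖⁻¹ * (‖x‖⁻¹ * b x x) := h1
      _ ≤ ‖x‖⁻¹ * (‖x‖⁻¹ * 1) := by gcongr
      _ = (‖x‖ ^ 2)⁻¹ := by rw [mul_one, sq, mul_inv]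

variable {E : Type*} [NormedAddCommGroup E] [NormedSpace ℝ E]
  {M : Type*} [TopologicalSpace M] [ChartedSpace E M] [IsManifold 𝓘(ℝ, E) ∞ M]
  {E' : Type*} [NormedAddCommGroup E'] [NormedSpace ℝ E']
  {Q : Type*} [TopologicalSpace Q] [ChartedSpace E' Q]

/-- The pullback of the metric under a map. -/
def LorentzMetric.pullback (g : LorentzMetric 𝓘(ℝ, E) M) (f : Q → M) (q : Q) :
    TangentSpace 𝓘(ℝ, E') q →L[ℝ] TangentSpace 𝓘(ℝ, E') q →L[ℝ] ℝ :=
  let b : E →L[ℝ] E →L[ℝ] ℝ := g.val (f q)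
  let L : E' →L[ℝ] E := mfderiv 𝓘(ℝ, E') 𝓘(ℝ, E) f q
  let c : E' →L[ℝ] E' →L[ℝ] ℝ := b.bilinearComp L L
  c

lemma LorentzMetric.pullback_apply (g : LorentzMetric 𝓘(ℝ, E) M) (f : Q → M) (q : Q)
    (ξ η : TangentSpace 𝓘(ℝ, E') q) :
    g.pullback f q ξ η = g.val (f q) (mfderiv 𝓘(ℝ, E') 𝓘(ℝ, E) f q ξ)
      (mfderiv 𝓘(ℝ, E') 𝓘(ℝ, E) f q η) := rfl

variable [IsManifold 𝓘(ℝ, E') ∞ Q] {F H N : Type*} [NormedAddCommGroup F] [NormedSpace ℝ F]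
  [TopologicalSpace H] {J : ModelWithCorners ℝ F H} [TopologicalSpace N] [ChartedSpace H N]
  [IsManifold J ∞ N]

/-- Applying the partial differential of a smooth map to a smooth field gives a smooth field. -/
lemma contMDiffAt_mfderiv_snd_apply {B : N × Q → M}
    (hB : ContMDiff (J.prod 𝓘(ℝ, E')) 𝓘(ℝ, E) ∞ B) {p : N × Q}
    {Y : Π q : Q, TangentSpace 𝓘(ℝ, E') q}
    (hY : ContMDiffAt 𝓘(ℝ, E') 𝓘(ℝ, E').tangent ∞ (T% Y) p.2) :
    ContMDiffAt (J.prod 𝓘(ℝ, E')) 𝓘(ℝ, E).tangent ∞ (fun p : N × Q ↦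
      (⟨B p, mfderiv 𝓘(ℝ, E') 𝓘(ℝ, E) (fun q ↦ B (p.1, q)) p.2 (Y p.2)⟩ :
        TangentBundle 𝓘(ℝ, E) M)) p := by
  have : IsManifold (J.prod 𝓘(ℝ, E')) 1 (N × Q) := IsManifold.of_le (n := ∞) (by simp)
  have : IsManifold 𝓘(ℝ, E) 1 M := IsManifold.of_le (n := ∞) (by simp)
  have : IsManifold 𝓘(ℝ, E') 1 Q := IsManifold.of_le (n := ∞) (by simp)
  refine ContMDiffAt.clm_apply_of_inCoordinates
    (b₁ := fun p : N × Q ↦ p.2) (b₂ := B)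
    (ϕ := fun p : N × Q ↦ mfderiv 𝓘(ℝ, E') 𝓘(ℝ, E) (fun q ↦ B (p.1, q)) p.2)
    (v := fun p : N × Q ↦ Y p.2) ?_ (hY.comp p contMDiffAt_snd) hB.contMDiffAt
  refine ContMDiffAt.mfderiv (x₀ := p) (n := ∞) (fun (p : N × Q) q ↦ B (p.1, q)) Prod.snd ?_
    contMDiffAt_snd (by simp)
  exact (hB.comp ((contMDiff_fst.comp contMDiff_fst).prodMk contMDiff_snd)).contMDiffAt

variable [FiniteDimensional ℝ E']

/-- The pullbacks of the metric under a smooth family of maps form a smooth family. -/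
lemma LorentzMetric.contMDiff_pullback (g : LorentzMetric 𝓘(ℝ, E) M) {B : N × Q → M}
    (hB : ContMDiff (J.prod 𝓘(ℝ, E')) 𝓘(ℝ, E) ∞ B) :
    ContMDiff (J.prod 𝓘(ℝ, E')) (𝓘(ℝ, E').prod 𝓘(ℝ, E' →L[ℝ] E' →L[ℝ] ℝ)) ∞
      (fun p : N × Q ↦ TotalSpace.mk' (E' →L[ℝ] E' →L[ℝ] ℝ)
        (E := fun x : Q ↦ TangentSpace 𝓘(ℝ, E') x →L[ℝ] TangentSpace 𝓘(ℝ, E') x →L[ℝ] ℝ)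
        p.2 (g.pullback (fun q ↦ B (p.1, q)) p.2)) := fun p ↦ by
  refine contMDiffAt_hom_bundle_of_sections (b := Prod.snd) contMDiffAt_snd fun Y Z hY hZ ↦ ?_
  have h := ContMDiffAt.clm_bundle_apply₂ (F₁ := E) (F₂ := E) (F₃ := ℝ)
    (E₃ := Bundle.Trivial M ℝ) ((g.contMDiff (B p)).comp p hB.contMDiffAt)
    (contMDiffAt_mfderiv_snd_apply hB hY) (contMDiffAt_mfderiv_snd_apply hB hZ)
  exact (contMDiffAt_totalSpace.1 h).2

end Pullback


/-! ### The diffeomorphism from `ℝ × J × Q` and the metric in it -/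

section Trivialization

variable {E : Type*} [NormedAddCommGroup E] [NormedSpace ℝ E]
  {M : Type*} [TopologicalSpace M] [ChartedSpace E M]
  {E' : Type*} [NormedAddCommGroup E'] [NormedSpace ℝ E']
  {Q : Type*} [TopologicalSpace Q] [ChartedSpace E' Q]

/-- `ι` is a smooth parametrization of the set `{v = 0, s = c₀}` and `ρ` the smooth retraction
along the flow `φ` and the transport `Θ`. -/
structure IsSliceParametrization (φ : ℝ × M → M) (v s : M → ℝ) (Θ : ℝ × M → M) (c₀ : ℝ)
    (ι : Q → M) (ρ : M → Q) : Prop where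
  contMDiff_ι : ContMDiff 𝓘(ℝ, E') 𝓘(ℝ, E) ∞ ι
  contMDiff_ρ : ContMDiff 𝓘(ℝ, E) 𝓘(ℝ, E') ∞ ρ
  v_ι (q : Q) : v (ι q) = 0
  s_ι (q : Q) : s (ι q) = c₀
  ι_ρ (x : M) : ι (ρ x) = φ (-v x, Θ (c₀, x))
  ρ_ι (q : Q) : ρ (ι q) = q

variable [IsManifold 𝓘(ℝ, E) ∞ M] [FiniteDimensional ℝ E] [T2Space M]
  {g : LorentzMetric 𝓘(ℝ, E) M} {V : Π x : M, TangentSpace 𝓘(ℝ, E) x} {φ : ℝ × M → M}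
  {s v : M → ℝ} {J : TopologicalSpace.Opens ℝ} {Θ : ℝ × M → M} {c₀ : ℝ} {ι : Q → M} {ρ : M → Q}

namespace IsSpacelikeTimeFunction

variable (h : IsSpacelikeTimeFunction g V φ s v) (hΘ : IsTransport (g.transverse V v) s J Θ)
  (hι : IsSliceParametrization (E := E) (E' := E') φ v s Θ c₀ ι ρ) (hc₀ : c₀ ∈ J)

include h hΘ hι

lemma contMDiff_transport_slice :
    ContMDiff (𝓘(ℝ, ℝ).prod 𝓘(ℝ, E')) 𝓘(ℝ, E) ∞ fun p : J × Q ↦ Θ (p.1, ι p.2) := by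
  refine (h.contMDiffOn_transport hΘ).comp_contMDiff
    ((contMDiff_subtype_val.comp contMDiff_fst).prodMk (hι.contMDiff_ι.comp contMDiff_snd))
    fun p ↦ ⟨p.1.2, trivial⟩

lemma contMDiff_transport_slice_right (c : J) :
    ContMDiff 𝓘(ℝ, E') 𝓘(ℝ, E) ∞ fun q : Q ↦ Θ (c, ι q) :=
  (h.contMDiff_transport_slice hΘ hι).comp (contMDiff_const.prodMk contMDiff_id)

include hc₀

/-- Flow and transport commute, so `ρ` undoes both. This recovers the `Q`-component of a point and
makes the slice maps immersions. -/
lemma ρ_flow_transport (a : ℝ) {c : ℝ} (hc : c ∈ J) (q : Q) :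
    ρ (φ (a, Θ (c, ι q))) = q := by
  rw [← hι.ρ_ι (ρ _), hι.ι_ρ, h.v_flow, h.v_transport hΘ hc, hι.v_ι, h.transport_flow hΘ hc₀,
    h.transport_transport hΘ hc hc₀, h.flow.add h.contMDiff_field]
  have := hΘ.apply_self (ι q)
  rw [hι.s_ι] at this
  rw [this]
  simp [h.flow.zero, hι.ρ_ι]

/-- The trivialization `(a, c, q) ↦ φ (a, Θ (c, ι q))`. -/
def trivialization : Diffeomorph (𝓘(ℝ, ℝ).prod (𝓘(ℝ, ℝ).prod 𝓘(ℝ, E'))) 𝓘(ℝ, E)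
    (ℝ × J × Q) M ∞ where
  toFun p := φ (p.1, Θ (p.2.1, ι p.2.2))
  invFun x := (v x, ⟨s x, hΘ.mem x⟩, ρ x)
  left_inv p := by
    refine Prod.ext ?_ (Prod.ext (Subtype.ext ?_) ?_)
    · change v (φ _) = _
      rw [h.v_flow, h.v_transport hΘ p.2.1.2, hι.v_ι, zero_add]
    · change s (φ _) = _
      rw [h.s_flow, h.s_transport hΘ p.2.1.2]
    · exact h.ρ_flow_transport hΘ hι hc₀ _ p.2.1.2 _
  right_inv x := by
    change φ (v x, Θ (s x, ι (ρ x))) = x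
    rw [hι.ι_ρ, h.transport_flow hΘ (hΘ.mem x), h.flow.add h.contMDiff_field,
      h.transport_transport hΘ hc₀ (hΘ.mem x), hΘ.apply_self]
    simp [h.flow.zero]
  contMDiff_toFun := (h.flow.contMDiff h.contMDiff_field).comp
    (contMDiff_fst.prodMk ((h.contMDiff_transport_slice hΘ hι).comp contMDiff_snd))
  contMDiff_invFun := by
    refine h.contMDiff_v.prodMk (ContMDiff.prodMk ?_ hι.contMDiff_ρ)
    rw [← ContMDiff.subtypeVal_comp_iff]
    exact h.contMDiff_s

omit hc₀

lemma dv_mfderiv_transport_slice (c : J) (q : Q) (ξ : TangentSpace 𝓘(ℝ, E') q) :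
    mvfderiv 𝓘(ℝ, E) v (Θ (c, ι q)) (mfderiv 𝓘(ℝ, E') 𝓘(ℝ, E) (fun q ↦ Θ (c, ι q)) q ξ) = 0 := by
  rw [← mvfderiv_comp_mfderiv_apply (h := fun q ↦ Θ (c, ι q)) (h.mdiff_v _)
    ((h.contMDiff_transport_slice_right hΘ hι c).mdifferentiable (by simp) q)]
  have : (fun q ↦ v (Θ (c, ι q))) = fun _ ↦ (0 : ℝ) := by
    ext q; rw [h.v_transport hΘ c.2, hι.v_ι]
  rw [this, mvfderiv_const]; rfl

lemma ds_mfderiv_transport_slice (c : J) (q : Q) (ξ : TangentSpace 𝓘(ℝ, E') q) :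
    mvfderiv 𝓘(ℝ, E) s (Θ (c, ι q)) (mfderiv 𝓘(ℝ, E') 𝓘(ℝ, E) (fun q ↦ Θ (c, ι q)) q ξ) = 0 := by
  rw [← mvfderiv_comp_mfderiv_apply (h := fun q ↦ Θ (c, ι q)) (h.mdiff_s _)
    ((h.contMDiff_transport_slice_right hΘ hι c).mdifferentiable (by simp) q)]
  have : (fun q ↦ s (Θ (c, ι q))) = fun _ ↦ (c : ℝ) := by
    ext q; rw [h.s_transport hΘ c.2]
  rw [this, mvfderiv_const]; rfl

include hc₀ in
lemma mfderiv_transport_slice_ne_zero (c : J) (q : Q) {ξ : TangentSpace 𝓘(ℝ, E') q} (hξ : ξ ≠ 0) :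
    mfderiv 𝓘(ℝ, E') 𝓘(ℝ, E) (fun q ↦ Θ (c, ι q)) q ξ ≠ 0 := by
  intro h0
  have h1 := mfderiv_comp_apply (I' := 𝓘(ℝ, E)) (I'' := 𝓘(ℝ, E')) q
    (g := ρ) (f := fun q ↦ Θ (c, ι q))
    (hι.contMDiff_ρ.mdifferentiable (by simp) _)
    ((h.contMDiff_transport_slice_right hΘ hι c).mdifferentiable (by simp) q) ξ
  have h2 : ρ ∘ (fun q ↦ Θ (c, ι q)) = id := by
    ext q
    have := h.ρ_flow_transport hΘ hι hc₀ 0 c.2 q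
    rwa [h.flow.zero] at this
  rw [h2, mfderiv_id, h0, map_zero] at h1
  exact hξ h1

/-- The derivative splits into the velocities in the three factors: `V` for the flow time, the
flow-invariant transverse field for the parameter in `J`, and the pushed-forward slice vector for
`Q`. -/
lemma mfderiv_trivialization_apply (p : ℝ × J × Q)
    (ξ : TangentSpace (𝓘(ℝ, ℝ).prod (𝓘(ℝ, ℝ).prod 𝓘(ℝ, E'))) p) :
    mfderiv (𝓘(ℝ, ℝ).prod (𝓘(ℝ, ℝ).prod 𝓘(ℝ, E'))) 𝓘(ℝ, E)
      (fun p : ℝ × J × Q ↦ φ (p.1, Θ (p.2.1, ι p.2.2))) p ξ =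
    mvfderiv (𝓘(ℝ, ℝ).prod (𝓘(ℝ, ℝ).prod 𝓘(ℝ, E'))) (fun p : ℝ × J × Q ↦ p.1) p ξ •
        V (φ (p.1, Θ (p.2.1, ι p.2.2))) +
      mvfderiv (𝓘(ℝ, ℝ).prod (𝓘(ℝ, ℝ).prod 𝓘(ℝ, E'))) (fun p : ℝ × J × Q ↦ (p.2.1 : ℝ)) p ξ •
        g.transverse V v (φ (p.1, Θ (p.2.1, ι p.2.2))) +
      mfderiv 𝓘(ℝ, E) 𝓘(ℝ, E) (fun x ↦ φ (p.1, x)) (Θ (p.2.1, ι p.2.2))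
        (mfderiv 𝓘(ℝ, E') 𝓘(ℝ, E) (fun q ↦ Θ (p.2.1, ι q)) p.2.2
          (mfderiv (𝓘(ℝ, ℝ).prod (𝓘(ℝ, ℝ).prod 𝓘(ℝ, E'))) 𝓘(ℝ, E')
            (fun p : ℝ × J × Q ↦ p.2.2) p ξ)) := by
  have hB := (h.contMDiff_transport_slice hΘ hι).mdifferentiable (by simp)
  have hφ := (h.flow.contMDiff h.contMDiff_field).mdifferentiable (by simp)
  have hφB : MDifferentiableAt (𝓘(ℝ, ℝ).prod (𝓘(ℝ, ℝ).prod 𝓘(ℝ, E'))) 𝓘(ℝ, E)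
      (fun p : ℝ × J × Q ↦ φ (p.1, Θ (p.2.1, ι p.2.2))) p :=
    ((h.flow.contMDiff h.contMDiff_field).comp (contMDiff_fst.prodMk
      ((h.contMDiff_transport_slice hΘ hι).comp contMDiff_snd))).mdifferentiable (by simp) p
  have h1 : mvfderiv (𝓘(ℝ, ℝ).prod (𝓘(ℝ, ℝ).prod 𝓘(ℝ, E'))) (fun p : ℝ × J × Q ↦ p.1) p ξ =
      ξ.1 := by
    change mfderiv _ _ (Prod.fst : ℝ × J × Q → ℝ) p ξ = _
    rw [mfderiv_fst]; rfl
  have h2 : mfderiv (𝓘(ℝ, ℝ).prod (𝓘(ℝ, ℝ).prod 𝓘(ℝ, E'))) 𝓘(ℝ, E')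
      (fun p : ℝ × J × Q ↦ p.2.2) p ξ = ξ.2.2 := by
    refine (mfderiv_comp_apply (I' := 𝓘(ℝ, ℝ).prod 𝓘(ℝ, E')) (g := Prod.snd) (f := Prod.snd) p
      mdifferentiableAt_snd mdifferentiableAt_snd ξ).trans ?_
    rw [mfderiv_snd, mfderiv_snd]; rfl
  have h3 : mvfderiv (𝓘(ℝ, ℝ).prod (𝓘(ℝ, ℝ).prod 𝓘(ℝ, E'))) (fun p : ℝ × J × Q ↦ (p.2.1 : ℝ)) p ξ
      = mvfderiv 𝓘(ℝ, ℝ) (Subtype.val : J → ℝ) p.2.1 ξ.2.1 := by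
    have hv := (contMDiff_subtype_val (I := 𝓘(ℝ, ℝ)) (n := ∞) (U := J)).mdifferentiable (by simp)
    refine (mvfderiv_comp_mfderiv_apply (f := Subtype.val) (h := fun p : ℝ × J × Q ↦ p.2.1)
      (hv _) (mdifferentiableAt_fst.comp p mdifferentiableAt_snd) ξ).trans ?_
    congr 1
    refine (mfderiv_comp_apply (I' := 𝓘(ℝ, ℝ).prod 𝓘(ℝ, E')) (g := Prod.fst) (f := Prod.snd) p
      mdifferentiableAt_fst mdifferentiableAt_snd ξ).trans ?_
    rw [mfderiv_snd, mfderiv_fst]; rfl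
  rw [h1, h2, h3]
  have h4 := mfderiv_prod_apply_of_curve (φ := fun p : ℝ × J × Q ↦ φ (p.1, Θ (p.2.1, ι p.2.2)))
    hφB (h.flow.curve (Θ (p.2.1, ι p.2.2)) p.1) ξ.1 ξ.2
  refine h4.trans ?_
  rw [add_assoc]
  congr 1
  refine (mfderiv_comp_apply (I' := 𝓘(ℝ, E)) (g := fun x ↦ φ (p.1, x))
    (f := fun p : J × Q ↦ Θ (p.1, ι p.2)) p.2
    ((h.flow.contMDiff_slice h.contMDiff_field p.1).mdifferentiable (by simp) _) (hB _) ξ.2).trans ?_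
  refine ((congrArg (mfderiv 𝓘(ℝ, E) 𝓘(ℝ, E) (fun x ↦ φ (p.1, x)) (Θ (p.2.1, ι p.2.2)))
    (mfderiv_prod_eq_add_apply (f := fun p : J × Q ↦ Θ (p.1, ι p.2)) (v := ξ.2) (hB p.2))).trans (map_add _ _ _)).trans ?_
  congr 1
  rw [← h.mfderiv_flow_transverse, ← map_smul]
  congr 1
  have hv := (contMDiff_subtype_val (I := 𝓘(ℝ, ℝ)) (n := ∞) (U := J)).mdifferentiable (by simp)
  have h5 := mfderiv_comp_apply (I' := 𝓘(ℝ, ℝ)) p.2.1 (g := fun c ↦ Θ (c, ι p.2.2))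
    (f := (Subtype.val : J → ℝ))
    (((hΘ.curve (ι p.2.2)).hasMFDerivAt_of_isOpen J.isOpen p.2.1.2).mdifferentiableAt) (hv _) ξ.2.1
  refine h5.trans ?_
  rw [((hΘ.curve (ι p.2.2)).hasMFDerivAt_of_isOpen J.isOpen p.2.1.2).mfderiv]
  rfl

/-- In the trivialization the metric takes the form of a simple pp-wave. -/
lemma val_mfderiv_trivialization (p : ℝ × J × Q)
    (ξ η : TangentSpace (𝓘(ℝ, ℝ).prod (𝓘(ℝ, ℝ).prod 𝓘(ℝ, E'))) p) :
    g.val (φ (p.1, Θ (p.2.1, ι p.2.2)))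
      (mfderiv (𝓘(ℝ, ℝ).prod (𝓘(ℝ, ℝ).prod 𝓘(ℝ, E'))) 𝓘(ℝ, E)
        (fun p : ℝ × J × Q ↦ φ (p.1, Θ (p.2.1, ι p.2.2))) p ξ)
      (mfderiv (𝓘(ℝ, ℝ).prod (𝓘(ℝ, ℝ).prod 𝓘(ℝ, E'))) 𝓘(ℝ, E)
        (fun p : ℝ × J × Q ↦ φ (p.1, Θ (p.2.1, ι p.2.2))) p η) =
    mvfderiv (𝓘(ℝ, ℝ).prod (𝓘(ℝ, ℝ).prod 𝓘(ℝ, E'))) (fun p : ℝ × J × Q ↦ p.1) p ξ *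
        mvfderiv (𝓘(ℝ, ℝ).prod (𝓘(ℝ, ℝ).prod 𝓘(ℝ, E'))) (fun p : ℝ × J × Q ↦ (p.2.1 : ℝ)) p η +
      mvfderiv (𝓘(ℝ, ℝ).prod (𝓘(ℝ, ℝ).prod 𝓘(ℝ, E'))) (fun p : ℝ × J × Q ↦ (p.2.1 : ℝ)) p ξ *
        mvfderiv (𝓘(ℝ, ℝ).prod (𝓘(ℝ, ℝ).prod 𝓘(ℝ, E'))) (fun p : ℝ × J × Q ↦ p.1) p η +
      g.val (Θ (p.2.1, ι p.2.2)) (g.transverse V v (Θ (p.2.1, ι p.2.2)))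
          (g.transverse V v (Θ (p.2.1, ι p.2.2))) *
        (mvfderiv (𝓘(ℝ, ℝ).prod (𝓘(ℝ, ℝ).prod 𝓘(ℝ, E'))) (fun p : ℝ × J × Q ↦ (p.2.1 : ℝ)) p ξ *
          mvfderiv (𝓘(ℝ, ℝ).prod (𝓘(ℝ, ℝ).prod 𝓘(ℝ, E'))) (fun p : ℝ × J × Q ↦ (p.2.1 : ℝ)) p η) +
      g.pullback (fun q ↦ Θ (p.2.1, ι q)) p.2.2
        (mfderiv (𝓘(ℝ, ℝ).prod (𝓘(ℝ, ℝ).prod 𝓘(ℝ, E'))) 𝓘(ℝ, E')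
            (fun p : ℝ × J × Q ↦ p.2.2) p ξ)
        (mfderiv (𝓘(ℝ, ℝ).prod (𝓘(ℝ, ℝ).prod 𝓘(ℝ, E'))) 𝓘(ℝ, E')
            (fun p : ℝ × J × Q ↦ p.2.2) p η) := by
  rw [h.mfderiv_trivialization_apply hΘ hι, h.mfderiv_trivialization_apply hΘ hι, g.pullback_apply,
    ← h.isometry p.1 _ (mfderiv 𝓘(ℝ, E') 𝓘(ℝ, E) (fun q ↦ Θ (p.2.1, ι q)) p.2.2 _),
    ← h.isometry p.1 _ (g.transverse V v _), h.mfderiv_flow_transverse]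
  generalize mvfderiv (𝓘(ℝ, ℝ).prod (𝓘(ℝ, ℝ).prod 𝓘(ℝ, E'))) (fun p : ℝ × J × Q ↦ p.1) p ξ = a
  generalize mvfderiv (𝓘(ℝ, ℝ).prod (𝓘(ℝ, ℝ).prod 𝓘(ℝ, E'))) (fun p : ℝ × J × Q ↦ p.1) p η = a'
  generalize mvfderiv (𝓘(ℝ, ℝ).prod (𝓘(ℝ, ℝ).prod 𝓘(ℝ, E'))) (fun p : ℝ × J × Q ↦ (p.2.1 : ℝ)) p ξ
    = b
  generalize mvfderiv (𝓘(ℝ, ℝ).prod (𝓘(ℝ, ℝ).prod 𝓘(ℝ, E'))) (fun p : ℝ × J × Q ↦ (p.2.1 : ℝ)) p η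
    = b'
  have hdv := fun ζ ↦ (h.dv_mfderiv_flow p.1 _ _).trans
    (h.dv_mfderiv_transport_slice hΘ hι p.2.1 p.2.2 ζ)
  have hds := fun ζ ↦ (h.ds_mfderiv_flow p.1 _ _).trans
    (h.ds_mfderiv_transport_slice hΘ hι p.2.1 p.2.2 ζ)
  -- Both `dv` and `ds` vanish on slice vectors, and the products with `V` and the transverse field
  -- are combinations of these differentials. Hence slice vectors are orthogonal to both fields.
  have hV : ∀ ζ, g.val _ (V (φ (p.1, Θ (p.2.1, ι p.2.2))))
      (mfderiv 𝓘(ℝ, E) 𝓘(ℝ, E) (fun x ↦ φ (p.1, x)) (Θ (p.2.1, ι p.2.2))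
        (mfderiv 𝓘(ℝ, E') 𝓘(ℝ, E) (fun q ↦ Θ (p.2.1, ι q)) p.2.2 ζ)) = 0 := fun ζ ↦ by
    rw [h.grad, hds]
  have hW : ∀ ζ, g.val _ (g.transverse V v (φ (p.1, Θ (p.2.1, ι p.2.2))))
      (mfderiv 𝓘(ℝ, E) 𝓘(ℝ, E) (fun x ↦ φ (p.1, x)) (Θ (p.2.1, ι p.2.2))
        (mfderiv 𝓘(ℝ, E') 𝓘(ℝ, E) (fun q ↦ Θ (p.2.1, ι q)) p.2.2 ζ)) = 0 := fun ζ ↦ by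
    rw [val_transverse h.grad, hdv, hds, mul_zero, sub_zero]
  have hV' := fun ζ ↦ (g.symm _ _ _).trans (hV ζ)
  have hW' := fun ζ ↦ (g.symm _ _ _).trans (hW ζ)
  have hVW := (h.grad _ _).trans (h.ds_transverse (φ (p.1, Θ (p.2.1, ι p.2.2))))
  have hWV := (g.symm _ _ _).trans hVW
  simp only [map_add, map_smul, add_apply, smul_apply, smul_eq_mul]
  rw [h.null, hV, hW, hV', hW', hVW, hWV]
  ring

end IsSpacelikeTimeFunction

end Trivialization


/-! ### From the hypersurface to a spacelike time function -/

section TimeFunction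

variable {E : Type*} [NormedAddCommGroup E] [NormedSpace ℝ E] [FiniteDimensional ℝ E]
  {M : Type*} [TopologicalSpace M] [ChartedSpace E M] [IsManifold 𝓘(ℝ, E) ∞ M] [T2Space M]
  {g : LorentzMetric 𝓘(ℝ, E) M} {V : Π x : M, TangentSpace 𝓘(ℝ, E) x} {s : M → ℝ} {S : Set M}

/-- A spacelike hypersurface met exactly once by the integral curves of a complete parallel
lightlike gradient field is the zero set of a spacelike time function. -/
theorem LorentzMetric.IsSpacelikeHypersurface.exists_isSpacelikeTimeFunction
    (hS : g.IsSpacelikeHypersurface S)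
    (hV : ContMDiff 𝓘(ℝ, E) 𝓘(ℝ, E).tangent ∞ (T% V)) (hs : ContMDiff 𝓘(ℝ, E) 𝓘(ℝ, ℝ) ∞ s)
    (hl : g.IsLightlike V) (hp : g.IsParallel V) (hc : IsCompleteVectorField V)
    (hgrad : g.IsGradient V s)
    (hu : ∀ γ : ℝ → M, IsMIntegralCurve (I := 𝓘(ℝ, E)) γ V → ∃! t : ℝ, γ t ∈ S) :
    ∃ (φ : ℝ × M → M) (v : M → ℝ), IsSpacelikeTimeFunction g V φ s v ∧ {x | v x = 0} = S := by
  obtain ⟨φ, hφ⟩ := hc.exists_isGlobalFlow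
  -- A nonzero null vector cannot lie in a hyperplane on which the metric is positive definite, so
  -- `V` is transverse to `S`.
  have hfV : ∀ {x : M} {f : M → ℝ}, (∀ ξ : TangentSpace 𝓘(ℝ, E) x, mvfderiv 𝓘(ℝ, E) f x ξ = 0 → ξ ≠ 0 →
      0 < g.val x ξ ξ) → mvfderiv 𝓘(ℝ, E) f x (V x) ≠ 0 := fun {x f} H h0 ↦
    (H _ h0 (hl x).2).ne' (hl x).1
  obtain ⟨v, hv, hvφ, hvS⟩ := hφ.exists_timeFunction hV (S := S) (fun x hx ↦ by
    obtain ⟨f, hf, hpos⟩ := hS x hx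
    exact ⟨f, hf, hfV hpos⟩) (fun x ↦ hu _ (hφ.curve x))
  have hiso := hφ.val_mfderiv_mfderiv hV g hp hv hvφ
  have hposS : ∀ x ∈ S, ∀ ξ : TangentSpace 𝓘(ℝ, E) x, mvfderiv 𝓘(ℝ, E) v x ξ = 0 → ξ ≠ 0 →
      0 < g.val x ξ ξ := fun x hx ξ hξ ↦ by
    obtain ⟨f, hf, hpos⟩ := hS x hx
    refine hpos ξ ?_
    rw [hφ.mvfderiv_eq_of_isLocalDefiningFunctionAt hV hv hvφ hvS hx hf, hξ, zero_mul]
  refine ⟨φ, v, ⟨hV, hφ, hs, hv, fun x ↦ (hl x).1, hgrad, hvφ, hiso, fun x ξ hξ hne ↦ ?_⟩,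
    by ext x; exact (hvS x).symm⟩
  -- The isometry `φ (-v x, ·)` carries the level set of `v` through `x` into `S`, where positivity
  -- is known.
  rw [← hiso (-v x) x ξ ξ]
  refine hposS _ ((hvS _).2 (by rw [hvφ]; ring)) _ ?_ fun h0 ↦ ?_
  · rw [← mvfderiv_comp_mfderiv_apply (h := fun y ↦ φ (-v x, y))
      (hv.mdifferentiable (by simp) _)
      ((hφ.contMDiff_slice hV _).mdifferentiable (by simp) x)]
    have h1 : (fun y ↦ v (φ (-v x, y))) = v + fun _ ↦ -v x := funext fun y ↦ hvφ _ y
    rw [h1, mvfderiv_add (hv.mdifferentiable (by simp) x) mdifferentiableAt_const, mvfderiv_const,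
      add_zero, hξ]
  · refine hne (g.eq_zero_of_val_eq_zero fun η ↦ ?_)
    rw [← hiso (-v x) x ξ η, h0, map_zero, zero_apply]

end TimeFunction

/-! ### The model slice as a manifold -/

section Slice

variable {E : Type*} [NormedAddCommGroup E] [NormedSpace ℝ E] [FiniteDimensional ℝ E]
  {M : Type*} [TopologicalSpace M] [ChartedSpace E M] [IsManifold 𝓘(ℝ, E) ∞ M] [T2Space M]
  {g : LorentzMetric 𝓘(ℝ, E) M} {V : Π x : M, TangentSpace 𝓘(ℝ, E) x} {φ : ℝ × M → M}
  {s v : M → ℝ} {J : TopologicalSpace.Opens ℝ} {Θ : ℝ × M → M} {c₀ : ℝ}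

namespace IsSpacelikeTimeFunction

variable (h : IsSpacelikeTimeFunction g V φ s v)

include h

omit [FiniteDimensional ℝ E] [T2Space M] in
lemma contMDiff_pair : ContMDiff 𝓘(ℝ, E) 𝓘(ℝ, ℝ × ℝ) ∞ fun x ↦ (v x, s x) :=
  h.contMDiff_v.prodMk_space h.contMDiff_s

omit [T2Space M] in
lemma surjective_mfderiv_pair (q : M) :
    Function.Surjective (mfderiv 𝓘(ℝ, E) 𝓘(ℝ, ℝ × ℝ) (fun x ↦ (v x, s x)) q) := by
  rintro ⟨a, b⟩
  refine ⟨a • V q + b • g.transverse V v q, (mvfderiv_prodMk_apply (h.mdiff_v q) (h.mdiff_s q)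
    _).trans (Prod.ext ?_ ?_)⟩
  · change mvfderiv 𝓘(ℝ, E) v q _ = a
    rw [map_add, map_smul, map_smul, h.dv_V, h.dv_transverse]; simp
  · change mvfderiv 𝓘(ℝ, E) s q _ = b
    rw [map_add, map_smul, map_smul, h.ds_V, h.ds_transverse]; simp

/-- The slice is a regular level set because `V` and the transverse field are dual to `dv` and `ds`.
The retraction brings `s` to `c₀` by transport and `v` to `0` by the flow. -/
lemma exists_slice (hΘ : IsTransport (g.transverse V v) s J Θ) (hc₀ : c₀ ∈ J) {n : ℕ}
    (hn : Module.finrank ℝ E = 2 + n) :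
    ∃ (_ : ChartedSpace (EuclideanSpace ℝ (Fin n)) {x : M // (v x, s x) = (0, c₀)})
      (_ : IsManifold (𝓡 n) ∞ {x : M // (v x, s x) = (0, c₀)})
      (ρ : M → {x : M // (v x, s x) = (0, c₀)}),
      IsSliceParametrization (E := E) (E' := EuclideanSpace ℝ (Fin n)) φ v s Θ c₀ Subtype.val ρ := by
  have hn' : Module.finrank ℝ E = Module.finrank ℝ (ℝ × ℝ) + n := by simpa using hn
  have hsurj := fun q (_ : (v q, s q) = (0, c₀)) ↦ h.surjective_mfderiv_pair q
  let cs := levelSetChartedSpace h.contMDiff_pair hsurj hn'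
  refine ⟨cs, isManifold_levelSet h.contMDiff_pair hsurj hn',
    fun x ↦ ⟨φ (-v x, Θ (c₀, x)), ?_⟩, ?_, ?_, ?_, ?_, fun x ↦ rfl, ?_⟩
  · rw [h.v_flow, h.v_transport hΘ hc₀, h.s_flow, h.s_transport hΘ hc₀, add_neg_cancel]
  · exact contMDiff_levelSet_val h.contMDiff_pair hsurj hn'
  · refine contMDiff_levelSet_of_val h.contMDiff_pair hsurj hn' ?_
    refine (h.flow.contMDiff h.contMDiff_field).comp (h.contMDiff_v.neg.prodMk ?_)
    exact (h.contMDiffOn_transport hΘ).comp_contMDiff (contMDiff_const.prodMk contMDiff_id)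
      fun x ↦ ⟨hc₀, trivial⟩
  · exact fun q ↦ congrArg Prod.fst q.2
  · exact fun q ↦ congrArg Prod.snd q.2
  · rintro ⟨q, hq⟩
    refine Subtype.ext ?_
    have h1 := hΘ.apply_self q
    rw [show s q = c₀ from congrArg Prod.snd hq] at h1
    change φ (-v q, Θ (c₀, q)) = q
    rw [h1, show v q = 0 from congrArg Prod.fst hq, neg_zero, h.flow.zero]

end IsSpacelikeTimeFunction

end Slice

/-! ### Assembly of the pp-wave data -/

section PPWave

variable {n : ℕ} {M : Type*} [TopologicalSpace M] [T2Space M]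
  [ChartedSpace (EuclideanSpace ℝ (Fin (n + 2))) M] [IsManifold (𝓡 (n + 2)) ∞ M]
  {Q : Type*} [TopologicalSpace Q] [ChartedSpace (EuclideanSpace ℝ (Fin n)) Q]
  [IsManifold (𝓡 n) ∞ Q]
  {g : LorentzMetric (𝓡 (n + 2)) M} {V : Π x : M, TangentSpace (𝓡 (n + 2)) x}
  {φ : ℝ × M → M} {s v : M → ℝ} {J : TopologicalSpace.Opens ℝ} {Θ : ℝ × M → M} {c₀ : ℝ}
  {ι : Q → M} {ρ : M → Q}

namespace IsSpacelikeTimeFunction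

variable (h : IsSpacelikeTimeFunction g V φ s v) (hΘ : IsTransport (g.transverse V v) s J Θ)
  (hι : IsSliceParametrization (E := EuclideanSpace ℝ (Fin (n + 2)))
    (E' := EuclideanSpace ℝ (Fin n)) φ v s Θ c₀ ι ρ) (hc₀ : c₀ ∈ J)

include h hΘ hι hc₀

/-- The metrics on the slices `{v = 0, s = c}`, transported to the model slice. -/
def sliceMetric (c : J) : ContMDiffRiemannianMetric (𝓡 n) ∞ (EuclideanSpace ℝ (Fin n))
    (fun x : Q ↦ TangentSpace (𝓡 n) x) :=
  have pos (q : Q) (ξ : TangentSpace (𝓡 n) q) (hξ : ξ ≠ 0) :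
      0 < g.pullback (fun q ↦ Θ (c, ι q)) q ξ ξ :=
    h.pos _ _ (h.dv_mfderiv_transport_slice hΘ hι c q ξ)
      (h.mfderiv_transport_slice_ne_zero hΘ hι hc₀ c q hξ)
  { inner := g.pullback fun q ↦ Θ (c, ι q)
    symm _ _ _ := g.symm _ _ _
    pos := pos
    isVonNBounded q := ContinuousLinearMap.isVonNBounded_of_pos
      (F := EuclideanSpace ℝ (Fin n)) (g.pullback (fun q ↦ Θ (c, ι q)) q) (pos q)
    contMDiff := (g.contMDiff_pullback (h.contMDiff_transport_slice hΘ hι)).comp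
      (contMDiff_const.prodMk contMDiff_id) }

lemma contMDiff_sliceMetric : ContMDiff (𝓘(ℝ, ℝ).prod (𝓡 n))
    ((𝓡 n).prod 𝓘(ℝ, EuclideanSpace ℝ (Fin n) →L[ℝ] EuclideanSpace ℝ (Fin n) →L[ℝ] ℝ)) ∞
    (fun p : J × Q ↦ TotalSpace.mk'
      (EuclideanSpace ℝ (Fin n) →L[ℝ] EuclideanSpace ℝ (Fin n) →L[ℝ] ℝ)
      (E := fun x : Q ↦ TangentSpace (𝓡 n) x →L[ℝ] TangentSpace (𝓡 n) x →L[ℝ] ℝ)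
      p.2 ((h.sliceMetric hΘ hι hc₀ p.1).inner p.2)) := by
  have h1 := g.contMDiff_pullback (h.contMDiff_transport_slice hΘ hι)
  exact h1

/-- The pp-wave in which the trivialization takes its values. -/
def ppWaveData : SimplePPWaveData n Q where
  J := J
  nonempty := ⟨c₀, hc₀⟩
  ordConnected := hΘ.ordConnected
  h := h.sliceMetric hΘ hι hc₀
  contMDiff_h := h.contMDiff_sliceMetric hΘ hι hc₀
  -- This choice makes `u⁻²` the squared length of the transverse field.
  u p := (√(g.val (Θ (p.1, ι p.2)) (g.transverse V v (Θ (p.1, ι p.2)))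
    (g.transverse V v (Θ (p.1, ι p.2)))))⁻¹
  u_pos p := inv_pos.2 (Real.sqrt_pos.2 (h.val_transverse_self_pos _))
  contMDiff_u p := by
    have h1 := h.val_transverse_self_pos (Θ (p.1, ι p.2))
    have h2 : ContDiffAt ℝ ∞ (fun y : ℝ ↦ (√y)⁻¹) (g.val (Θ (p.1, ι p.2))
        (g.transverse V v (Θ (p.1, ι p.2))) (g.transverse V v (Θ (p.1, ι p.2)))) :=
      (Real.contDiffAt_sqrt h1.ne').inv (Real.sqrt_pos.2 h1).ne'
    have h3 := (g.contMDiffAt_val (h.contMDiff_transverse (Θ (p.1, ι p.2)))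
      (h.contMDiff_transverse _)).comp p (h.contMDiff_transport_slice hΘ hι p)
    exact ContMDiffAt.comp p (g := fun y : ℝ ↦ (√y)⁻¹) h2.contMDiffAt h3

theorem isSimplePPWaveModeledOn : g.IsSimplePPWaveModeledOn Q := by
  refine ⟨h.ppWaveData hΘ hι hc₀, h.trivialization hΘ hι hc₀, fun p ξ η ↦ ?_⟩
  refine (h.val_mfderiv_trivialization hΘ hι p ξ η).trans ?_
  have hu : ((h.ppWaveData hΘ hι hc₀).u p.2)⁻¹ ^ 2 = g.val (Θ (p.2.1, ι p.2.2))
      (g.transverse V v (Θ (p.2.1, ι p.2.2))) (g.transverse V v (Θ (p.2.1, ι p.2.2))) := by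
    change ((√_)⁻¹)⁻¹ ^ 2 = _
    rw [inv_inv, Real.sq_sqrt (h.val_transverse_self_pos _).le]
  rw [SimplePPWaveData.metric, hu]
  rfl

end IsSpacelikeTimeFunction

end PPWave


/-! ### Existence of the pp-wave structure -/

section Splitting

variable {n : ℕ} {M : Type w} [TopologicalSpace M] [T2Space M] [SecondCountableTopology M]
  [ChartedSpace (EuclideanSpace ℝ (Fin (n + 2))) M] [IsManifold (𝓡 (n + 2)) ∞ M]
  {g : LorentzMetric (𝓡 (n + 2)) M} {V : Π x : M, TangentSpace (𝓡 (n + 2)) x} {s : M → ℝ}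

/-- A Lorentzian manifold with a complete parallel lightlike gradient field and a transversal
spacelike hypersurface with compact connected slices is a simple pp-wave. -/
theorem LorentzMetric.exists_isSimplePPWaveModeledOn
    (hV : ContMDiff (𝓡 (n + 2)) (𝓡 (n + 2)).tangent ∞ (T% V))
    (hs : ContMDiff (𝓡 (n + 2)) 𝓘(ℝ, ℝ) ∞ s)
    (hl : g.IsLightlike V) (hp : g.IsParallel V) (hc : IsCompleteVectorField V)
    (hgrad : g.IsGradient V s) {S : Set M} (hconn : IsConnected S)
    (hS : g.IsSpacelikeHypersurface S)
    (hu : ∀ γ : ℝ → M, IsMIntegralCurve (I := 𝓡 (n + 2)) γ V → ∃! t : ℝ, γ t ∈ S)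
    (hfib : ∀ c ∈ s '' S, IsCompact (S ∩ s ⁻¹' {c}) ∧ IsConnected (S ∩ s ⁻¹' {c})) :
    ∃ (Q : Type w) (_ : TopologicalSpace Q) (_ : T2Space Q) (_ : SecondCountableTopology Q)
      (_ : CompactSpace Q) (_ : ConnectedSpace Q)
      (_ : ChartedSpace (EuclideanSpace ℝ (Fin n)) Q) (_ : IsManifold (𝓡 n) ∞ Q),
      g.IsSimplePPWaveModeledOn Q := by
  obtain ⟨φ, v, h, rfl⟩ := hS.exists_isSpacelikeTimeFunction hV hs hl hp hc hgrad hu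
  obtain ⟨J, Θ, hJ, hΘ⟩ := h.exists_isTransport hfib hconn.isPreconnected
  obtain ⟨x₀, hx₀⟩ := hconn.nonempty
  have hfib₀ := hfib (s x₀) ⟨x₀, hx₀, rfl⟩
  have hQ : {x | v x = 0} ∩ s ⁻¹' {s x₀} = {x | (v x, s x) = (0, s x₀)} := by
    ext x; simp
  rw [hQ] at hfib₀
  obtain ⟨cs, im, ρ, hρ⟩ := h.exists_slice (n := n) hΘ (hΘ.mem x₀)
    (by rw [finrank_euclideanSpace_fin]; omega)
  exact ⟨{x : M // (v x, s x) = (0, s x₀)}, inferInstance, inferInstance,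
    Topology.IsEmbedding.subtypeVal.secondCountableTopology, isCompact_iff_compactSpace.1 hfib₀.1, isConnected_iff_connectedSpace.1 hfib₀.2, cs, im,
    h.isSimplePPWaveModeledOn hΘ hρ (hΘ.mem x₀)⟩

end Splitting


/-! ### Coordinates, gradient and hypersurface of a simple pp-wave -/

namespace SimplePPWaveData

variable {n : ℕ} {M : Type*} [TopologicalSpace M]
  [ChartedSpace (EuclideanSpace ℝ (Fin (n + 2))) M]
  {Q : Type*} [TopologicalSpace Q] [ChartedSpace (EuclideanSpace ℝ (Fin n)) Q]
  [IsManifold (𝓡 n) ∞ Q] {P : SimplePPWaveData n Q}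
  (Φ : Diffeomorph (ppModel n) (𝓡 (n + 2)) (ℝ × P.J × Q) M ∞)

/-- The coordinate `v` of a simple pp-wave, as a function on `M`. -/
def vCoord (x : M) : ℝ := (Φ.symm x).1

/-- The coordinate `s` of a simple pp-wave, as a function on `M`. -/
def sCoord (x : M) : ℝ := (Φ.symm x).2.1

/-- The projection of a simple pp-wave to the model of its wave fronts. -/
def proj (x : M) : Q := (Φ.symm x).2.2

@[simp] lemma vCoord_apply (p : ℝ × P.J × Q) : vCoord Φ (Φ p) = p.1 := by simp [vCoord]

@[simp] lemma sCoord_apply (p : ℝ × P.J × Q) : sCoord Φ (Φ p) = p.2.1 := by simp [sCoord]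

@[simp] lemma proj_apply (p : ℝ × P.J × Q) : proj Φ (Φ p) = p.2.2 := by simp [proj]

lemma contMDiff_vCoord : ContMDiff (𝓡 (n + 2)) 𝓘(ℝ, ℝ) ∞ (vCoord Φ) :=
  contMDiff_fst.comp Φ.symm.contMDiff

lemma contMDiff_sCoord : ContMDiff (𝓡 (n + 2)) 𝓘(ℝ, ℝ) ∞ (sCoord Φ) :=
  contMDiff_subtype_val.comp (contMDiff_fst.comp (contMDiff_snd.comp Φ.symm.contMDiff))

lemma contMDiff_proj : ContMDiff (𝓡 (n + 2)) (𝓡 n) ∞ (proj Φ) :=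
  contMDiff_snd.comp (contMDiff_snd.comp Φ.symm.contMDiff)

lemma exists_apply_eq (x : M) : ∃ p, Φ p = x :=
  ⟨Φ.symm x, Φ.apply_symm_apply x⟩

lemma mdifferentiableAt_param (p : ℝ × P.J × Q) :
    MDifferentiableAt (ppModel n) (𝓡 (n + 2)) Φ p :=
  Φ.contMDiff.mdifferentiable (by simp) p

lemma mvfderiv_vCoord (p : ℝ × P.J × Q) (ξ : TangentSpace (ppModel n) p) :
    mvfderiv (𝓡 (n + 2)) (vCoord Φ) (Φ p) (mfderiv (ppModel n) (𝓡 (n + 2)) Φ p ξ) =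
      P.dv p ξ := by
  refine (mvfderiv_comp_mfderiv_apply ((contMDiff_vCoord Φ).mdifferentiable (by simp) _)
    (mdifferentiableAt_param Φ p) ξ).symm.trans ?_
  simp only [vCoord_apply]; rfl

lemma mvfderiv_sCoord (p : ℝ × P.J × Q) (ξ : TangentSpace (ppModel n) p) :
    mvfderiv (𝓡 (n + 2)) (sCoord Φ) (Φ p) (mfderiv (ppModel n) (𝓡 (n + 2)) Φ p ξ) =
      P.ds p ξ := by
  refine (mvfderiv_comp_mfderiv_apply ((contMDiff_sCoord Φ).mdifferentiable (by simp) _)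
    (mdifferentiableAt_param Φ p) ξ).symm.trans ?_
  simp only [sCoord_apply]; rfl

/-- The differential of the projection, with values in the tangent space at the model point. -/
def dproj (p : ℝ × P.J × Q) : TangentSpace (𝓡 (n + 2)) (Φ p) →L[ℝ] TangentSpace (𝓡 n) p.2.2 :=
  P.dprQ p ∘L mfderiv (𝓡 (n + 2)) (ppModel n) Φ.symm (Φ p)

lemma mfderiv_symm_mfderiv (p : ℝ × P.J × Q) (ξ : TangentSpace (ppModel n) p) :
    mfderiv (𝓡 (n + 2)) (ppModel n) Φ.symm (Φ p) (mfderiv (ppModel n) (𝓡 (n + 2)) Φ p ξ) = ξ := by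
  refine (mfderiv_comp_apply p (Φ.symm.contMDiff.mdifferentiable (by simp) _)
    (mdifferentiableAt_param Φ p) ξ).symm.trans ?_
  have h1 : Φ.symm ∘ Φ = id := by ext1 q; simp
  rw [h1, mfderiv_id]; rfl

lemma exists_eq_mfderiv (p : ℝ × P.J × Q) (ξ : TangentSpace (𝓡 (n + 2)) (Φ p)) :
    ∃ ζ, ξ = mfderiv (ppModel n) (𝓡 (n + 2)) Φ p ζ := by
  obtain ⟨ζ, hζ⟩ := (Φ.mfderivToContinuousLinearEquiv (by simp) p).surjective ξ
  exact ⟨ζ, hζ.symm⟩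

lemma dproj_mfderiv (p : ℝ × P.J × Q) (ξ : TangentSpace (ppModel n) p) :
    dproj Φ p (mfderiv (ppModel n) (𝓡 (n + 2)) Φ p ξ) = P.dprQ p ξ :=
  congrArg (P.dprQ p) (mfderiv_symm_mfderiv Φ p ξ)

lemma mvfderiv_comp_proj {F : Type*} [NormedAddCommGroup F] [NormedSpace ℝ F] (p : ℝ × P.J × Q)
    {χ : Q → F} (hχ : MDifferentiableAt (𝓡 n) 𝓘(ℝ, F) χ p.2.2)
    (ξ : TangentSpace (𝓡 (n + 2)) (Φ p)) :
    mvfderiv (𝓡 (n + 2)) (fun x ↦ χ (proj Φ x)) (Φ p) ξ =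
      mvfderiv (𝓡 n) χ p.2.2 (dproj Φ p ξ) := by
  obtain ⟨ζ, rfl⟩ := exists_eq_mfderiv Φ p ξ
  have hχ' : MDifferentiableAt (𝓡 n) 𝓘(ℝ, F) χ (proj Φ (Φ p)) := by rwa [proj_apply]
  rw [dproj_mfderiv]
  refine (mvfderiv_comp_mfderiv_apply (hχ'.comp _ ((contMDiff_proj Φ).mdifferentiable (by simp) _))
    (mdifferentiableAt_param Φ p) ζ).symm.trans ?_
  have h1 : (fun q ↦ (χ ∘ proj Φ) (Φ q)) = fun q ↦ χ q.2.2 := by ext1 q; simp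
  rw [h1]
  exact mvfderiv_comp_mfderiv_apply (h := fun p : ℝ × P.J × Q ↦ p.2.2) hχ
    (mdifferentiableAt_snd.comp p mdifferentiableAt_snd) ζ

/-- The coordinate field `∂_v`. -/
def vField (p : ℝ × P.J × Q) : TangentSpace (ppModel n) p := ((1 : ℝ), (0 : ℝ × _))

lemma hasMFDerivAt_vLine (p : ℝ × P.J × Q) :
    HasMFDerivAt 𝓘(ℝ, ℝ) (𝓡 (n + 2)) (fun t ↦ Φ (t, p.2)) p.1 ((1 : ℝ →L[ℝ] ℝ).smulRight
      (mfderiv (ppModel n) (𝓡 (n + 2)) Φ p (vField p))) := by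
  have h1 := (mdifferentiableAt_param Φ p).hasMFDerivAt.comp p.1
    ((hasMFDerivAt_id p.1).prodMk (hasMFDerivAt_const p.2 p.1))
  refine h1.congr_mfderiv ?_
  ext
  change mfderiv (ppModel n) (𝓡 (n + 2)) Φ p (((1 : ℝ), (0 : ℝ × _))) = (1 : ℝ) • _
  rw [one_smul]; rfl

lemma dv_vField (p : ℝ × P.J × Q) : P.dv p (vField p) = 1 := by
  change mfderiv _ _ (Prod.fst : ℝ × P.J × Q → ℝ) p (vField p) = _
  rw [mfderiv_fst]; rfl

lemma ds_vField (p : ℝ × P.J × Q) : P.ds p (vField p) = 0 := by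
  have hv := (contMDiff_subtype_val (I := 𝓘(ℝ, ℝ)) (n := ∞) (U := P.J)).mdifferentiable (by simp)
  have h1 : mfderiv (ppModel n) (𝓘(ℝ, ℝ).prod (𝓡 n)) (Prod.snd : ℝ × P.J × Q → P.J × Q) p
      (vField p) = 0 := by
    rw [mfderiv_snd]; rfl
  refine (mfderiv_comp_apply (I' := 𝓘(ℝ, ℝ).prod (𝓡 n)) (g := fun z : P.J × Q ↦ (z.1 : ℝ))
    (f := Prod.snd) p ((hv _).comp _ mdifferentiableAt_fst) mdifferentiableAt_snd _).trans ?_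
  rw [h1, map_zero]; rfl

lemma dprQ_vField (p : ℝ × P.J × Q) : P.dprQ p (vField p) = 0 := by
  refine (mfderiv_comp_apply (I' := 𝓘(ℝ, ℝ).prod (𝓡 n)) (g := Prod.snd) (f := Prod.snd) p
    mdifferentiableAt_snd mdifferentiableAt_snd _).trans ?_
  rw [mfderiv_snd, mfderiv_snd]; rfl

variable {Φ} [IsManifold (𝓡 (n + 2)) ∞ M] {g : LorentzMetric (𝓡 (n + 2)) M}
  (hΦ : ∀ (p : ℝ × P.J × Q) (ξ η : TangentSpace (ppModel n) p),
      g.val (Φ p) (mfderiv (ppModel n) (𝓡 (n + 2)) Φ p ξ)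
        (mfderiv (ppModel n) (𝓡 (n + 2)) Φ p η) = P.metric p ξ η)

include hΦ

lemma val_apply (p : ℝ × P.J × Q) (ξ η : TangentSpace (𝓡 (n + 2)) (Φ p)) :
    g.val (Φ p) ξ η =
      mvfderiv (𝓡 (n + 2)) (vCoord Φ) (Φ p) ξ * mvfderiv (𝓡 (n + 2)) (sCoord Φ) (Φ p) η +
      mvfderiv (𝓡 (n + 2)) (sCoord Φ) (Φ p) ξ * mvfderiv (𝓡 (n + 2)) (vCoord Φ) (Φ p) η +
      (P.u p.2)⁻¹ ^ 2 * (mvfderiv (𝓡 (n + 2)) (sCoord Φ) (Φ p) ξ *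
        mvfderiv (𝓡 (n + 2)) (sCoord Φ) (Φ p) η) +
      (P.h p.2.1).inner p.2.2 (dproj Φ p ξ) (dproj Φ p η) := by
  obtain ⟨ξ, rfl⟩ := exists_eq_mfderiv Φ p ξ
  obtain ⟨η, rfl⟩ := exists_eq_mfderiv Φ p η
  rw [hΦ, mvfderiv_vCoord, mvfderiv_vCoord, mvfderiv_sCoord, mvfderiv_sCoord, dproj_mfderiv,
    dproj_mfderiv]
  rfl

lemma eq_zero_of_differentials (p : ℝ × P.J × Q) {ξ : TangentSpace (𝓡 (n + 2)) (Φ p)}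
    (hv : mvfderiv (𝓡 (n + 2)) (vCoord Φ) (Φ p) ξ = 0)
    (hs : mvfderiv (𝓡 (n + 2)) (sCoord Φ) (Φ p) ξ = 0) (hq : dproj Φ p ξ = 0) : ξ = 0 :=
  g.eq_zero_of_val_eq_zero fun η ↦ by rw [val_apply hΦ, hv, hs, hq]; simp

/-- The only nonzero component of `∂_v` is `dv(∂_v) = 1`, so contracting it with the pp-wave metric
leaves exactly `ds`. -/
lemma gradient_sCoord (p : ℝ × P.J × Q) :
    g.gradient (sCoord Φ) (Φ p) = mfderiv (ppModel n) (𝓡 (n + 2)) Φ p (vField p) :=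
  g.ext_val fun η ↦ by
    rw [g.val_gradient, val_apply hΦ, mvfderiv_vCoord, mvfderiv_sCoord, dproj_mfderiv,
      dv_vField, ds_vField, dprQ_vField]
    simp

lemma isMIntegralCurve_vLine (z : P.J × Q) :
    IsMIntegralCurve (I := 𝓡 (n + 2)) (fun t ↦ Φ (t, z)) (g.gradient (sCoord Φ)) := fun t ↦ by
  have h1 := hasMFDerivAt_vLine Φ (t, z)
  rwa [← gradient_sCoord hΦ] at h1

lemma isCompleteVectorField_gradient : IsCompleteVectorField (g.gradient (sCoord Φ)) := fun x ↦ by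
  obtain ⟨p, rfl⟩ := exists_apply_eq Φ x
  refine ⟨_, ?_, (isMIntegralCurve_vLine hΦ p.2).comp_add p.1⟩
  simp

lemma dv_gradient (x : M) : mvfderiv (𝓡 (n + 2)) (vCoord Φ) x (g.gradient (sCoord Φ) x) = 1 := by
  obtain ⟨p, rfl⟩ := exists_apply_eq Φ x
  rw [gradient_sCoord hΦ, mvfderiv_vCoord, dv_vField]

lemma ds_gradient (x : M) : mvfderiv (𝓡 (n + 2)) (sCoord Φ) x (g.gradient (sCoord Φ) x) = 0 := by
  obtain ⟨p, rfl⟩ := exists_apply_eq Φ x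
  rw [gradient_sCoord hΦ, mvfderiv_sCoord, ds_vField]

lemma dproj_gradient (p : ℝ × P.J × Q) : dproj Φ p (g.gradient (sCoord Φ) (Φ p)) = 0 := by
  rw [gradient_sCoord hΦ, dproj_mfderiv, dprQ_vField]

lemma isLightlike_gradient : g.IsLightlike (g.gradient (sCoord Φ)) := fun x ↦ by
  refine ⟨by rw [g.val_gradient, ds_gradient hΦ], fun h0 ↦ ?_⟩
  have := dv_gradient hΦ x
  rw [h0, map_zero] at this
  exact zero_ne_one this

/-- The set `{v = 0}` is a spacelike hypersurface. -/
lemma isSpacelikeHypersurface_vCoord : g.IsSpacelikeHypersurface {x | vCoord Φ x = 0} := by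
  refine fun x hx ↦ ⟨vCoord Φ, ⟨⟨univ, isOpen_univ, trivial, (contMDiff_vCoord Φ).contMDiffOn,
    by ext; simp⟩, fun h0 ↦ ?_⟩, fun ξ hξ hne ↦ ?_⟩
  · have := dv_gradient hΦ x
    rw [h0] at this
    exact zero_ne_one this
  · obtain ⟨p, rfl⟩ := exists_apply_eq Φ x
    rw [val_apply hΦ, hξ, zero_mul, mul_zero, add_zero, zero_add]
    have hu : 0 < (P.u p.2)⁻¹ ^ 2 := pow_pos (inv_pos.2 (P.u_pos _)) 2
    -- On `dv = 0` the metric is `u⁻² ds² + h_s`, a sum of nonnegative terms. If the `Q`-part of `ξ`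
    -- vanishes, then `ds(ξ)` does not.
    by_cases hq : dproj Φ p ξ = 0
    · have hs : mvfderiv (𝓡 (n + 2)) (sCoord Φ) (Φ p) ξ ≠ 0 := fun hs ↦
        hne (eq_zero_of_differentials hΦ p hξ hs hq)
      rw [hq, map_zero, add_zero]
      exact mul_pos hu (mul_self_pos.2 hs)
    · exact add_pos_of_nonneg_of_pos (mul_nonneg hu.le (mul_self_nonneg _))
        ((P.h p.2.1).pos _ _ hq)

/-- Along every integral curve the coordinate `v` grows at unit speed, so it vanishes exactly once.
-/
lemma existsUnique_vCoord_eq_zero {γ : ℝ → M}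
    (hγ : IsMIntegralCurve (I := 𝓡 (n + 2)) γ (g.gradient (sCoord Φ))) :
    ∃! t, γ t ∈ {x | vCoord Φ x = 0} := by
  have h1 := fun t ↦ (hγ.isMIntegralCurveOn univ).comp_eq_add
    ((contMDiff_vCoord Φ).mdifferentiable (by simp)) (dv_gradient hΦ) isOpen_univ ordConnected_univ
    (mem_univ 0) (mem_univ t)
  refine ⟨-vCoord Φ (γ 0), ?_, fun t ht ↦ ?_⟩
  · change vCoord Φ (γ _) = 0
    rw [h1]; ring
  · change vCoord Φ (γ t) = 0 at ht
    rw [h1] at ht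
    linarith

omit hΦ

omit [IsManifold (𝓡 (n + 2)) ∞ M] in
lemma sCoord_fibre_eq_range (c : P.J) :
    {x | vCoord Φ x = 0} ∩ sCoord Φ ⁻¹' {(c : ℝ)} = range fun q ↦ Φ (0, c, q) := by
  refine Subset.antisymm ?_ ?_
  · rintro x ⟨hv, hs⟩
    obtain ⟨⟨a, b, q⟩, rfl⟩ := exists_apply_eq Φ x
    have h1 : a = 0 := (vCoord_apply Φ _).symm.trans hv
    have h2 : b = c := Subtype.ext ((sCoord_apply Φ _).symm.trans hs)
    exact ⟨q, by rw [h1, h2]⟩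
  · rintro _ ⟨q, rfl⟩
    exact ⟨vCoord_apply Φ _, sCoord_apply Φ _⟩

omit [IsManifold (𝓡 (n + 2)) ∞ M] in
lemma isConnected_vCoord [ConnectedSpace Q] : IsConnected {x | vCoord Φ x = 0} := by
  have : ConnectedSpace P.J := isConnected_iff_connectedSpace.1
    ⟨P.nonempty, isPreconnected_iff_ordConnected.2 P.ordConnected⟩
  have h1 : {x | vCoord Φ x = 0} = range fun z ↦ Φ (0, z) := by
    refine Subset.antisymm (fun x hv ↦ ?_) ?_
    · obtain ⟨⟨a, z⟩, rfl⟩ := exists_apply_eq Φ x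
      have h1 : a = 0 := (vCoord_apply Φ _).symm.trans hv
      exact ⟨z, by rw [h1]⟩
    · rintro _ ⟨z, rfl⟩
      exact vCoord_apply Φ _
  rw [h1]
  exact isConnected_range (Φ.continuous.comp (by fun_prop))

end SimplePPWaveData


/-! ### A criterion for a coordinate field to be parallel -/

section Parallel

lemma ContinuousLinearMap.isInvertible_of_injective {E F : Type*} [NormedAddCommGroup E]
    [NormedSpace ℝ E] [NormedAddCommGroup F] [NormedSpace ℝ F] [FiniteDimensional ℝ E]
    [FiniteDimensional ℝ F] {A : E →L[ℝ] F} (hA : ∀ x, A x = 0 → x = 0)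
    (h : Module.finrank ℝ E = Module.finrank ℝ F) : A.IsInvertible :=
  ⟨(LinearEquiv.ofInjectiveOfFinrankEq (A : E →ₗ[ℝ] F)
    ((injective_iff_map_eq_zero A).2 hA) h).toContinuousLinearEquiv, by ext; rfl⟩

variable {E : Type*} [NormedAddCommGroup E] [NormedSpace ℝ E]
  {M : Type*} [TopologicalSpace M] [ChartedSpace E M]

variable [IsManifold 𝓘(ℝ, E) ∞ M] [FiniteDimensional ℝ E]

/-- A coordinate field `V = ∂_e` is parallel at `x` if the products `g(V, ∂_a)` have vanishing
differentials and the products `g(∂_a, ∂_b)` do not depend on the coordinate. -/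
lemma LorentzMetric.leviCivita_eq_zero_of_coordField (g : LorentzMetric 𝓘(ℝ, E) M) {F : Type*}
    [NormedAddCommGroup F] [NormedSpace ℝ F] [CompleteSpace F] {ψ : M → F} {x : M}
    (hψ : ContMDiffAt 𝓘(ℝ, E) 𝓘(ℝ, F) ∞ ψ x) (hi : (mvfderiv 𝓘(ℝ, E) ψ x).IsInvertible)
    {V : Π x : M, TangentSpace 𝓘(ℝ, E) x} {e : F}
    (hV : ContMDiffAt 𝓘(ℝ, E) 𝓘(ℝ, E).tangent ∞ (T% V) x)
    (hVψ : ∀ᶠ y in 𝓝 x, mvfderiv 𝓘(ℝ, E) ψ y (V y) = e)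
    (h1 : ∀ a, mvfderiv 𝓘(ℝ, E) (fun y ↦ g.val y (V y) (coordField ψ a y)) x = 0)
    (h2 : ∀ a b, mvfderiv 𝓘(ℝ, E) (fun y ↦ g.val y (coordField ψ a y) (coordField ψ b y)) x (V x)
      = 0) : g.leviCivita V x = 0 := by
  have hd : ∀ c, MDiffAt (T% (coordField ψ c : Π x : M, TangentSpace 𝓘(ℝ, E) x)) x := fun c ↦
    (contMDiffAt_coordField hψ hi c).mdifferentiableAt (by simp)
  have hVd : MDiffAt (T% V) x := hV.mdifferentiableAt (by simp)
  have hVe : V =ᶠ[𝓝 x] coordField ψ e := by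
    filter_upwards [hVψ, eventually_isInvertible_mvfderiv hψ hi] with y hy hyi
    exact eq_coordField hyi hy
  have hsurj : ∀ ξ : TangentSpace 𝓘(ℝ, E) x, ∃ a, ξ = coordField ψ a x := fun ξ ↦
    ⟨_, eq_coordField hi rfl⟩
  have h3 : ∀ a, mvfderiv 𝓘(ℝ, E) (fun y ↦ g.val y (coordField ψ a y) (V y)) x = 0 := fun a ↦ by
    rw [← h1 a]
    congr 1
    ext y
    exact g.symm _ _ _
  have hbl : ∀ a, mlieBracket 𝓘(ℝ, E) (coordField ψ a) V x = 0 := fun a ↦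
    (Filter.EventuallyEq.mlieBracket_vectorField_eq Filter.EventuallyEq.rfl hVe).trans
      (mlieBracket_coordField hψ a e)
  have hbr : ∀ a, mlieBracket 𝓘(ℝ, E) V (coordField ψ a) x = 0 := fun a ↦
    (Filter.EventuallyEq.mlieBracket_vectorField_eq hVe Filter.EventuallyEq.rfl).trans
      (mlieBracket_coordField hψ e a)
  ext ξ
  obtain ⟨a, rfl⟩ := hsurj ξ
  refine g.eq_zero_of_val_eq_zero fun η ↦ ?_
  obtain ⟨b, rfl⟩ := hsurj η
  -- Every term of the Koszul expression vanishes: the derivative terms by hypothesis, the bracket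
  -- terms because coordinate fields commute.
  have h4 := g.two_mul_val_leviCivitaAux hVd (hd a) (hd b)
  rw [LorentzMetric.koszul, h1, h2, h3, hbl, hbr, mlieBracket_coordField hψ a b] at h4
  have h5 : 2 * g.val x (g.leviCivitaAux V x (coordField ψ a x)) (coordField ψ b x) = 0 := by
    simpa using h4
  change g.val x (g.leviCivitaAux V x (coordField ψ a x)) (coordField ψ b x) = 0
  linarith

end Parallel

/-! ### `∂_v` is parallel on a simple pp-wave -/

namespace SimplePPWaveData

variable {n : ℕ} {M : Type*} [TopologicalSpace M]
  [ChartedSpace (EuclideanSpace ℝ (Fin (n + 2))) M]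
  {Q : Type*} [TopologicalSpace Q] [ChartedSpace (EuclideanSpace ℝ (Fin n)) Q]
  [IsManifold (𝓡 n) ∞ Q] {P : SimplePPWaveData n Q}
  {Φ : Diffeomorph (ppModel n) (𝓡 (n + 2)) (ℝ × P.J × Q) M ∞} [IsManifold (𝓡 (n + 2)) ∞ M]
  {g : LorentzMetric (𝓡 (n + 2)) M}
  (hΦ : ∀ (p : ℝ × P.J × Q) (ξ η : TangentSpace (ppModel n) p),
      g.val (Φ p) (mfderiv (ppModel n) (𝓡 (n + 2)) Φ p ξ)
        (mfderiv (ppModel n) (𝓡 (n + 2)) Φ p η) = P.metric p ξ η)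

include hΦ

/-- The coordinate field `∂_v` of a simple pp-wave is parallel. -/
theorem isParallel_gradient : g.IsParallel (g.gradient (sCoord Φ)) := fun x ↦ by
  obtain ⟨p, rfl⟩ := exists_apply_eq Φ x
  let χ : Q → EuclideanSpace ℝ (Fin n) := extChartAt (𝓡 n) p.2.2
  -- Local coordinates `(v, s, χ)` on `M`, with `χ` a chart of `Q` around the base point; in them
  -- the gradient of `s` is the constant field `(1, 0, 0)`.
  let ψ : M → ℝ × ℝ × EuclideanSpace ℝ (Fin n) := fun x ↦ (vCoord Φ x, sCoord Φ x, χ (proj Φ x))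
  have hχs : ∀ q ∈ (extChartAt (𝓡 n) p.2.2).source,
      ContMDiffAt (𝓡 n) 𝓘(ℝ, EuclideanSpace ℝ (Fin n)) ∞ χ q := fun q hq ↦
    contMDiffAt_extChartAt' (by rwa [← extChartAt_source (𝓡 n)])
  have hps : p.2.2 ∈ (extChartAt (𝓡 n) p.2.2).source := mem_extChartAt_source _
  have hψ : ContMDiffAt (𝓡 (n + 2)) 𝓘(ℝ, ℝ × ℝ × EuclideanSpace ℝ (Fin n)) ∞ ψ (Φ p) := by
    refine (contMDiff_vCoord Φ _).prodMk_space ((contMDiff_sCoord Φ _).prodMk_space ?_)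
    exact ContMDiffAt.comp (Φ p) (hχs _ (by rwa [proj_apply])) (contMDiff_proj Φ _)
  have hdψ : ∀ p' : ℝ × P.J × Q, p'.2.2 ∈ (extChartAt (𝓡 n) p.2.2).source →
      ∀ ξ : TangentSpace (𝓡 (n + 2)) (Φ p'), mvfderiv (𝓡 (n + 2)) ψ (Φ p') ξ =
        (mvfderiv (𝓡 (n + 2)) (vCoord Φ) (Φ p') ξ, mvfderiv (𝓡 (n + 2)) (sCoord Φ) (Φ p') ξ,
          mvfderiv (𝓡 n) χ p'.2.2 (dproj Φ p' ξ)) := fun p' hp' ξ ↦ by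
    have hχ := (hχs _ hp').mdifferentiableAt (by simp)
    have hχ' : MDifferentiableAt (𝓡 n) 𝓘(ℝ, EuclideanSpace ℝ (Fin n)) χ (proj Φ (Φ p')) := by
      rwa [proj_apply]
    have hχp : MDifferentiableAt (𝓡 (n + 2)) 𝓘(ℝ, EuclideanSpace ℝ (Fin n))
        (fun x ↦ χ (proj Φ x)) (Φ p') :=
      hχ'.comp _ ((contMDiff_proj Φ).mdifferentiable (by simp) _)
    have hs := (contMDiff_sCoord Φ).mdifferentiable (by simp) (Φ p')
    refine (mvfderiv_prodMk_apply ((contMDiff_vCoord Φ).mdifferentiable (by simp) _)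
      (hs.prodMk_space hχp) ξ).trans ?_
    rw [mvfderiv_prodMk_apply hs hχp, mvfderiv_comp_proj Φ p' hχ]
  have hχi : ∀ q ∈ (extChartAt (𝓡 n) p.2.2).source, (mvfderiv (𝓡 n) χ q).IsInvertible :=
    fun q hq ↦ isInvertible_mvfderiv_extChartAt hq
  have hi : (mvfderiv (𝓡 (n + 2)) ψ (Φ p)).IsInvertible := by
    refine ContinuousLinearMap.isInvertible_of_injective (E := EuclideanSpace ℝ (Fin (n + 2)))
      (fun ξ hξ ↦ ?_) (by simp; omega)
    have h1 := (hdψ p hps ξ).symm.trans hξ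
    refine eq_zero_of_differentials hΦ p (congrArg Prod.fst h1)
      (congrArg (fun z ↦ z.2.1) h1) ?_
    have h2 : mvfderiv (𝓡 n) χ p.2.2 (dproj Φ p ξ) = 0 := congrArg (fun z ↦ z.2.2) h1
    obtain ⟨L, hL⟩ := hχi _ hps
    rw [← hL] at h2
    exact L.map_eq_zero_iff.1 h2
  have hnear : ∀ᶠ y in 𝓝 (Φ p), (mvfderiv (𝓡 (n + 2)) ψ y).IsInvertible ∧
      ∃ p', Φ p' = y ∧ p'.2.2 ∈ (extChartAt (𝓡 n) p.2.2).source := by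
    have h1 : ∀ᶠ y in 𝓝 (Φ p), proj Φ y ∈ (extChartAt (𝓡 n) p.2.2).source := by
      refine (contMDiff_proj Φ).continuous.continuousAt.eventually_mem ?_
      rw [proj_apply]
      exact extChartAt_source_mem_nhds _
    filter_upwards [eventually_isInvertible_mvfderiv hψ hi, h1] with y hy hy'
    exact ⟨hy, Φ.symm y, Φ.apply_symm_apply y, hy'⟩
  have hs := contMDiff_sCoord Φ
  refine g.leviCivita_eq_zero_of_coordField hψ hi (e := (1, 0, 0)) (g.contMDiff_gradient hs _)
    ?_ (fun a ↦ ?_) fun a b ↦ ?_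
  · filter_upwards [hnear] with y hy
    obtain ⟨-, p', rfl, hp'⟩ := hy
    rw [hdψ p' hp', dv_gradient hΦ, ds_gradient hΦ, dproj_gradient hΦ, map_zero]
  · have h1 : (fun y ↦ g.val y (g.gradient (sCoord Φ) y) (coordField ψ a y)) =ᶠ[𝓝 (Φ p)]
        fun _ ↦ a.2.1 := by
      filter_upwards [hnear] with y hy
      obtain ⟨hy, p', rfl, hp'⟩ := hy
      rw [g.val_gradient]
      exact congrArg (fun z ↦ z.2.1) ((hdψ p' hp' _).symm.trans (mvfderiv_coordField hy a))
    exact h1.mfderiv_eq.trans mfderiv_const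
  · have hf := (g.contMDiffAt_val (contMDiffAt_coordField hψ hi a)
      (contMDiffAt_coordField hψ hi b)).mdifferentiableAt (by simp)
    have h1 := HasMFDerivAt.hasDerivAt_comp_curve (isMIntegralCurve_vLine hΦ p.2 p.1) hf
    -- The derivative along `∂_v` is taken on the line `t ↦ Φ (t, p.2)`. There the coefficients are
    -- constant, because `u` and `h` do not involve `v`.
    refine h1.unique (HasDerivAt.congr_of_eventuallyEq (hasDerivAt_const _
      (a.1 * b.2.1 + a.2.1 * b.1 + (P.u p.2)⁻¹ ^ 2 * (a.2.1 * b.2.1) +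
        (P.h p.2.1).inner p.2.2 (coordField χ a.2.2 p.2.2) (coordField χ b.2.2 p.2.2))) ?_)
    have h2 : Filter.Tendsto (fun t ↦ Φ (t, p.2)) (𝓝 p.1) (𝓝 (Φ p)) :=
      (Φ.continuous.comp (by fun_prop : Continuous fun t : ℝ ↦ (t, p.2))).tendsto p.1
    filter_upwards [h2.eventually hnear] with t ht
    have h3 := fun c ↦ (hdψ (t, p.2) hps _).symm.trans (mvfderiv_coordField ht.1 c)
    have hv := fun c ↦ congrArg Prod.fst (h3 c)
    have hs := fun c ↦ congrArg (fun z ↦ z.2.1) (h3 c)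
    have hq := fun c ↦ eq_coordField (hχi _ hps) (congrArg (fun z ↦ z.2.2) (h3 c))
    dsimp only at hv hs hq
    rw [val_apply hΦ, hv, hv, hs, hs, hq, hq]

end SimplePPWaveData

/-! ### The equivalence -/

section Characterization

theorem mainTheorem12 (n : ℕ) (M : Type w) [TopologicalSpace M] [T2Space M]
    [SecondCountableTopology M] [ChartedSpace (EuclideanSpace ℝ (Fin (n + 2))) M]
    [IsManifold (𝓡 (n + 2)) ∞ M] (g : LorentzMetric (𝓡 (n + 2)) M) :
    (∃ (Q : Type w) (_ : TopologicalSpace Q) (_ : T2Space Q) (_ : SecondCountableTopology Q)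
        (_ : CompactSpace Q) (_ : ConnectedSpace Q)
        (_ : ChartedSpace (EuclideanSpace ℝ (Fin n)) Q) (_ : IsManifold (𝓡 n) ∞ Q),
        g.IsSimplePPWaveModeledOn Q) ↔
      ∃ (V : Π x : M, TangentSpace (𝓡 (n + 2)) x) (s : M → ℝ),
        ContMDiff (𝓡 (n + 2)) (𝓡 (n + 2)).tangent ∞
          (fun x ↦ (⟨x, V x⟩ : TangentBundle (𝓡 (n + 2)) M)) ∧
        ContMDiff (𝓡 (n + 2)) 𝓘(ℝ, ℝ) ∞ s ∧
        g.IsLightlike V ∧ g.IsParallel V ∧ IsCompleteVectorField V ∧ g.IsGradient V s ∧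
        ∃ S : Set M, IsConnected S ∧ g.IsSpacelikeHypersurface S ∧
          (∀ γ : ℝ → M, IsMIntegralCurve (I := 𝓡 (n + 2)) γ V → ∃! t : ℝ, γ t ∈ S) ∧
          ∀ c ∈ s '' S, IsCompact (S ∩ s ⁻¹' {c}) ∧ IsConnected (S ∩ s ⁻¹' {c}) := by
  constructor
  · rintro ⟨Q, _, _, _, _, _, _, _, P, Φ, hΦ⟩
    refine ⟨g.gradient (SimplePPWaveData.sCoord Φ), SimplePPWaveData.sCoord Φ,
      g.contMDiff_gradient (SimplePPWaveData.contMDiff_sCoord Φ),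
      SimplePPWaveData.contMDiff_sCoord Φ, SimplePPWaveData.isLightlike_gradient hΦ,
      SimplePPWaveData.isParallel_gradient hΦ, SimplePPWaveData.isCompleteVectorField_gradient hΦ,
      g.val_gradient _, {x | SimplePPWaveData.vCoord Φ x = 0}, SimplePPWaveData.isConnected_vCoord,
      SimplePPWaveData.isSpacelikeHypersurface_vCoord hΦ,
      fun γ hγ ↦ SimplePPWaveData.existsUnique_vCoord_eq_zero hΦ hγ, ?_⟩
    rintro _ ⟨x, -, rfl⟩
    have h1 : Continuous fun q ↦ Φ (0, (Φ.symm x).2.1, q) := Φ.continuous.comp (by fun_prop)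
    have h2 := SimplePPWaveData.sCoord_fibre_eq_range (Φ := Φ) (Φ.symm x).2.1
    -- Viewing the value of `s` as a point of `J` displays the fibre as a continuous image of `Q`,
    -- hence compact and connected.
    change IsCompact (_ ∩ _ ⁻¹' {((Φ.symm x).2.1 : ℝ)}) ∧
      IsConnected (_ ∩ _ ⁻¹' {((Φ.symm x).2.1 : ℝ)})
    rw [h2]
    exact ⟨isCompact_range h1, isConnected_range h1⟩
  · rintro ⟨V, s, hV, hs, hl, hp, hc, hgrad, S, hconn, hS, hu, hfib⟩
    exact LorentzMetric.exists_isSimplePPWaveModeledOn hV hs hl hp hc hgrad hconn hS hu hfib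

end Characterization

end
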